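/- **Setting.** A *Netsor$\top$ program* of width $n$ generates vectors in $\mathbb R^n$, starting from finitely many input vectors $x^i$ $(i\in I)$ and input matrices $W=\omega_W/\sqrt n\in\mathbb R^{n\times n}$ $(W\in J)$, by the operations $h\mapsto Wh$, $h\mapsto W^\top h$ and coordinatewise application of measurable, polynomially bounded nonlinearities $\varphi:\mathbb R^m\to\mathbb R$ to earlier vectors. The parameters are sampled so that the tuples $(x^i_\alpha)_{i\in I}$, $\alpha=1,\dots,n$, are i.i.d. $\mathcal N(\mu^{\rm in},\Sigma^{\rm in})$, the entries of $\omega_W$ are i.i.d. $\mathcal N(0,\sigma_W^2)$, and all of these are independent. The program is *BP-like* if there is a nonempty set $V$ of input vectors that have mean zero and are independent of all other input vectors, such that, whenever $W^\top z$ is used in the program, $z$ is an odd function of $V$ (all other inputs being fixed), and whenever $Wz$ is used, $z$ does not depend on $V$. **Networks.** A neural network (feedforward, or recurrent and unrolled over time) on an input set $X$ assigns to every $\xi\in X$ a program, over input vectors and matrices shared by all $\xi$, that computes a vector $x(\xi)$; its output is $f(\xi)=v^\top x(\xi)/\sqrt n$, where the readout $v$ is one of the input vectors. The nonlinearities are polynomially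 bounded with polynomially bounded weak derivatives, of which a version is fixed for use in backpropagation. The parameters are the $x^i$ and the $\omega_W$, and the neural tangent kernel $\Theta_n(\xi,\xi')=\langle\nabla_\theta f(\xi),\nabla_\theta f(\xi')\rangle$ is formed with the gradients computed by backpropagation, so that $\sqrt n\,\nabla_{x^i}f(\xi)=\sum_{d\in D_i(\xi)}d$ and $n\,\nabla_{\omega_W}f(\xi)=\sum_{(d,h)\in D_W(\xi)}d\,h^\top$ for finite lists $D_i(\xi)$, $D_W(\xi)$ of vectors, respectively of pairs of vectors, of a Netsor$\top$ program. **Theorem.** Suppose that the program expressing the forward and the backward computations of the network is BP-like. 1. At all parameters at which every nonlinearity is differentiable at the values it is applied to, with gradient equal to the fixed weak derivatives, $f(\xi)$ is differentiable in the parameters and the backpropagated gradient is its gradient. 2. If for every $n$ the parameters are randomly initialized as above (on a common probability space, with any joint law across different $n$), then for every finite set of inputs, almost surely, for all $\xi,\xi'$ in that set, $$\Theta_n(\xi,\xi')\ \longrightarrow\ \mathring\Theta(\xi,\xi')\qquad(n\to\infty),$$ where $\mathring\Theta$ is the deterministic kernel $$\mathring\Theta(\xi,\xi')=\sum_{i\in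 I}\ \sum_{d\in D_i(\xi)}\ \sum_{d'\in D_i(\xi')}\mathbb E\big[Z^{d}Z^{d'}\big]+\sum_{W\in J}\ \sum_{(d,h)\in D_W(\xi)}\ \sum_{(d',h')\in D_W(\xi')}\mathbb E\big[Z^{d}Z^{d'}\big]\,\mathbb E\big[Z^{h}Z^{h'}\big].$$ Here $(Z^g)_g\sim\mathcal N(\mu,\Sigma)$ is indexed by the G-variables $g$ of the program (input vectors and results of matrix multiplications), $Z^h=\varphi(Z^{g_1},\dots,Z^{g_m})$ if $h=\varphi(g_1,\dots,g_m)$ with G-variables $g_1,\dots,g_m$, the mean is $\mu(x^i)=\mu^{\rm in}_i$ and $\mu(g)=0$ for all other $g$, and the covariance is defined recursively by $\Sigma(x^i,x^j)=\Sigma^{\rm in}_{ij}$, $\Sigma(Wh,Wh')=\sigma_W^2\,\mathbb E[Z^hZ^{h'}]$, $\Sigma(W^\top h,W^\top h')=\sigma_W^2\,\mathbb E[Z^hZ^{h'}]$, and $\Sigma(g,g')=0$ in all other cases. -/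

import Mathlib

open MeasureTheory ProbabilityTheory Filter Topology
open scoped NNReal

noncomputable section

namespace TensorProgram

/-- `|φ x| ≤ C (1 + ‖x‖ ^ p)` for some constants `C` and `p`. -/
def PolyBounded {m : ℕ} (φ : (Fin m → ℝ) → ℝ) : Prop :=
  ∃ (C : ℝ) (p : ℕ), ∀ x, |φ x| ≤ C * (1 + ‖x‖ ^ p)

/-- A nonlinearity `ℝᵐ → ℝ` of a program: measurable and polynomially bounded. -/
structure Nonlin (m : ℕ) where
  toFun : (Fin m → ℝ) → ℝ
  measurable : Measurable toFun
  polyBounded : PolyBounded toFun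

/-- A nonlinearity `ℝᵐ → ℝ` of a neural network: polynomially bounded, with polynomially bounded
weak partial derivatives. `deriv k` is the version of the `k`-th weak partial derivative that
backpropagation uses (for instance the step function for the rectifier `x ↦ max x 0`). -/
structure Activation (m : ℕ) extends Nonlin m where
  deriv : Fin m → (Fin m → ℝ) → ℝ
  deriv_measurable : ∀ k, Measurable (deriv k)
  deriv_polyBounded : ∀ k, PolyBounded (deriv k)
  deriv_weak : ∀ (k : Fin m) (η : (Fin m → ℝ) → ℝ), ContDiff ℝ (⊤ : ℕ∞) η → HasCompactSupport η →
    ∫ x, toFun x * fderiv ℝ η x (Pi.single k 1) = - ∫ x, deriv k x * η x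

/-- The map `(d, x) ↦ d * ∂ₖφ(x)`, by which backpropagation passes an adjoint through `φ`. -/
def Activation.back {m : ℕ} (φ : Activation m) (k : Fin m) : Nonlin (m + 1) where
  toFun y := y 0 * φ.deriv k (Fin.tail y)
  measurable := by
    refine (measurable_pi_apply 0).mul ((φ.deriv_measurable k).comp ?_)
    exact measurable_pi_lambda _ fun j => measurable_pi_apply j.succ
  polyBounded := by
    obtain ⟨C, p, h⟩ := φ.deriv_polyBounded k
    have hC : 0 ≤ C := by
      have h0 := (abs_nonneg _).trans (h 0)
      have h1 : (0 : ℝ) < 1 + ‖(0 : Fin m → ℝ)‖ ^ p := by positivity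
      exact nonneg_of_mul_nonneg_left h0 h1
    refine ⟨2 * C, p + 1, fun y => ?_⟩
    have hy : |y 0| ≤ ‖y‖ := by simpa using norm_le_pi_norm y 0
    have ht : ‖Fin.tail y‖ ≤ ‖y‖ :=
      (pi_norm_le_iff_of_nonneg (norm_nonneg y)).2 fun j => norm_le_pi_norm y j.succ
    have h2 : |φ.deriv k (Fin.tail y)| ≤ C * (1 + ‖y‖ ^ p) :=
      (h _).trans (by gcongr)
    have h3 : ‖y‖ ≤ 1 + ‖y‖ ^ (p + 1) := by
      rcases le_total ‖y‖ 1 with h1 | h1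
      · have : 0 ≤ ‖y‖ ^ (p + 1) := by positivity
        linarith
      · have := le_self_pow₀ h1 (Nat.succ_ne_zero p)
        simp only [Nat.succ_eq_add_one] at this
        linarith
    rw [abs_mul]
    calc |y 0| * |φ.deriv k (Fin.tail y)| ≤ ‖y‖ * (C * (1 + ‖y‖ ^ p)) := by gcongr
      _ = C * (‖y‖ + ‖y‖ ^ (p + 1)) := by ring
      _ ≤ C * ((1 + ‖y‖ ^ (p + 1)) + (1 + ‖y‖ ^ (p + 1))) := by gcongr; linarith
      _ = 2 * C * (1 + ‖y‖ ^ (p + 1)) := by ring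

/-! ### Programs

`I` indexes the input vectors and `J` the input matrices. A variable of a program is represented
by the expression that the lines of the program unfold to: an input vector, a product with an input
matrix or with its transpose, or the coordinatewise image of earlier variables under a nonlinearity.
A program is a set of variables that contains the subexpressions of its members. -/

inductive Term (I J : Type*)
  | vec (i : I) : Term I J
  | mul (W : J) (h : Term I J) : Term I J
  | mulT (W : J) (h : Term I J) : Term I J
  | nonlin {m : ℕ} (φ : Nonlin m) (args : Fin m → Term I J) : Term I J

/-- Parameters at width `n`: `θ.1 α i` is the `α`-th coordinate of the `i`-th input vector and
`θ.2 W α β` an entry of the unnormalized matrix `ω_W`; the input matrix itself is `ω_W / √n`. -/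
abbrev Params (I J : Type*) (n : ℕ) : Type _ :=
  (Fin n → EuclideanSpace ℝ I) × (J → Fin n → Fin n → ℝ)

/-- The law of the random initialization: the coordinates of the input vectors are independent
over `α` with law `N(mean, cov)`, and the entries of `ω_W` are independent with law
`N(0, σ_W ^ 2)`. -/
structure Init (I J : Type*) where
  mean : I → ℝ
  cov : Matrix I I ℝ
  cov_posSemidef : cov.PosSemidef
  std : J → ℝ≥0

section

variable {I J : Type*}

/-- The value of a variable at width `n`, a vector in `ℝⁿ`. -/
def Term.eval {n : ℕ} (θ : Params I J n) : Term I J → Fin n → ℝ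
  | .vec i => fun α => θ.1 α i
  | .mul W h => fun α => (√(n : ℝ))⁻¹ * ∑ β, θ.2 W α β * h.eval θ β
  | .mulT W h => fun α => (√(n : ℝ))⁻¹ * ∑ β, θ.2 W β α * h.eval θ β
  | .nonlin φ args => fun α => φ.toFun fun k => (args k).eval θ α

/-- `Subterm s t`: the variable `s` occurs in the expression `t` (possibly `s = t`). -/
inductive Subterm : Term I J → Term I J → Prop
  | refl (t : Term I J) : Subterm t t
  | mul {s h : Term I J} (W : J) : Subterm s h → Subterm s (.mul W h)
  | mulT {s h : Term I J} (W : J) : Subterm s h → Subterm s (.mulT W h)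
  | nonlin {s : Term I J} {m : ℕ} (φ : Nonlin m) (args : Fin m → Term I J) (k : Fin m) :
      Subterm s (args k) → Subterm s (.nonlin φ args)

/-- `θ'` arises from `θ` by changing input vectors with index in `V` only. -/
def AgreeOff (V : Set I) {n : ℕ} (θ θ' : Params I J n) : Prop :=
  (∀ α, ∀ i ∉ V, θ.1 α i = θ'.1 α i) ∧ θ.2 = θ'.2

/-- `θ'` arises from `θ` by negating the input vectors with index in `V`. -/
def NegatedOn (V : Set I) {n : ℕ} (θ θ' : Params I J n) : Prop :=
  AgreeOff V θ θ' ∧ ∀ α, ∀ i ∈ V, θ'.1 α i = - θ.1 α i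

/-- The vector, as a function of all inputs, does not depend on the input vectors in `V`. -/
def Term.IndepOf (V : Set I) (z : Term I J) : Prop :=
  ∀ (n : ℕ) (θ θ' : Params I J n), AgreeOff V θ θ' → z.eval θ' = z.eval θ

/-- The vector is an odd function of the input vectors in `V`, all other inputs being fixed. -/
def Term.OddIn (V : Set I) (z : Term I J) : Prop :=
  ∀ (n : ℕ) (θ θ' : Params I J n), NegatedOn V θ θ' → z.eval θ' = - z.eval θ

/-- A program is BP-like: for some nonempty set `V` of input vectors, sampled with mean zero and
independently of the other input vectors, `Wᵀ z` is used only for `z` odd in `V`, and `W z` is used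
only for `z` that do not depend on `V`. -/
def BPLike (ν : Init I J) (P : Set (Term I J)) : Prop :=
  ∃ V : Set I, V.Nonempty ∧
    (∀ i ∈ V, ν.mean i = 0) ∧
    (∀ i ∈ V, ∀ j ∉ V, ν.cov i j = 0) ∧
    (∀ (W : J) (z : Term I J), Term.mulT W z ∈ P → z.OddIn V) ∧
    (∀ (W : J) (z : Term I J), Term.mul W z ∈ P → z.IndepOf V)

/-! ### The limit mean `μ` and covariance `Σ` -/

open scoped Classical in
/-- The G-vars (input vectors and matrix products) of which a variable is a coordinatewise
function. -/
def Term.gvars : Term I J → Finset (Term I J)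
  | .vec i => {.vec i}
  | .mul W h => {.mul W h}
  | .mulT W h => {.mulT W h}
  | .nonlin _ args => Finset.univ.biUnion fun k => (args k).gvars

/-- The coordinatewise function that expresses a variable through the values `z g` of its
G-vars `g`. -/
def Term.value (z : Term I J → ℝ) : Term I J → ℝ
  | .vec i => z (.vec i)
  | .mul W h => z (.mul W h)
  | .mulT W h => z (.mulT W h)
  | .nonlin φ args => φ.toFun fun k => (args k).value z

/-- The limit mean `μ` of a G-var. -/
def limitMean (ν : Init I J) : Term I J → ℝ
  | .vec i => ν.mean i
  | _ => 0

/-- `E[a(Z) b(Z)]`, where `Z ~ N(μ, S)` is indexed by a finite set `F` of G-vars, which has to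
contain those of `a` and `b`. -/
def gaussianMoment (ν : Init I J) (a b : Term I J) (F : Finset (Term I J))
    (S : Matrix F F ℝ) : ℝ :=
  open scoped Classical in
  let ext : EuclideanSpace ℝ F → Term I J → ℝ := fun z g => if hg : g ∈ F then z ⟨g, hg⟩ else 0
  ∫ z, a.value (ext z) * b.value (ext z)
    ∂(multivariateGaussian (WithLp.toLp 2 fun g : F => limitMean ν g.1) S)

/-- The nesting depth of matrix products. -/
def Term.depth : Term I J → ℕ
  | .vec _ => 0
  | .mul _ h => h.depth + 1
  | .mulT _ h => h.depth + 1
  | .nonlin _ args => Finset.univ.sup fun k => (args k).depth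

theorem Term.depth_le_of_mem_gvars {t g : Term I J} (hg : g ∈ t.gvars) : g.depth ≤ t.depth := by
  induction t with
  | vec i => simp only [Term.gvars, Finset.mem_singleton] at hg; rw [hg]
  | mul W h _ => simp only [Term.gvars, Finset.mem_singleton] at hg; rw [hg]
  | mulT W h _ => simp only [Term.gvars, Finset.mem_singleton] at hg; rw [hg]
  | nonlin φ args ih =>
    simp only [Term.gvars, Finset.mem_biUnion, Finset.mem_univ, true_and] at hg
    obtain ⟨k, hk⟩ := hg
    exact (ih k hk).trans (Finset.le_sup (f := fun k => (args k).depth) (Finset.mem_univ k))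

open scoped Classical in
theorem Term.depth_le_max {a b g : Term I J} (hg : g ∈ a.gvars ∪ b.gvars) :
    g.depth ≤ max a.depth b.depth := by
  rcases Finset.mem_union.1 hg with h | h
  · exact (Term.depth_le_of_mem_gvars h).trans (le_max_left _ _)
  · exact (Term.depth_le_of_mem_gvars h).trans (le_max_right _ _)

open scoped Classical in
/-- The limit covariance `Σ` of two G-vars, by recursion on their depth:
`Σ(x, y)` is the initial covariance for input vectors,
`Σ(W h, W h') = σ_W ^ 2 E[h(Z) h'(Z)]` and `Σ(Wᵀ h, Wᵀ h') = σ_W ^ 2 E[h(Z) h'(Z)]` with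
`Z ~ N(μ, Σ)`, and `Σ = 0` in all other cases. -/
def limitCov (ν : Init I J) : Term I J → Term I J → ℝ
  | .vec i, .vec j => ν.cov i j
  | .mul W h, .mul W' h' =>
      if W = W' then
        (ν.std W : ℝ) ^ 2 * gaussianMoment ν h h' (h.gvars ∪ h'.gvars)
          (Matrix.of fun a b => limitCov ν a.1 b.1)
      else 0
  | .mulT W h, .mulT W' h' =>
      if W = W' then
        (ν.std W : ℝ) ^ 2 * gaussianMoment ν h h' (h.gvars ∪ h'.gvars)
          (Matrix.of fun a b => limitCov ν a.1 b.1)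
      else 0
  | _, _ => 0
termination_by g g' => max g.depth g'.depth
decreasing_by
  all_goals
    have ha := Term.depth_le_max a.2
    have hb := Term.depth_le_max b.2
    simp only [Term.depth]
    omega

open scoped Classical in
/-- `E[a(Z) b(Z)]` for `Z ~ N(μ, Σ)`. -/
def limitMoment (ν : Init I J) (a b : Term I J) : ℝ :=
  gaussianMoment ν a b (a.gvars ∪ b.gvars) (Matrix.of fun g g' => limitCov ν g.1 g'.1)

end

/-- The random initialization at width `n`. -/
def Init.law {I J : Type*} [Fintype I] [DecidableEq I] [Fintype J] (ν : Init I J) (n : ℕ) :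
    Measure (Params I J n) :=
  (Measure.pi fun _ : Fin n => multivariateGaussian (WithLp.toLp 2 ν.mean) ν.cov).prod
    (Measure.pi fun W : J => Measure.pi fun _ : Fin n => Measure.pi fun _ : Fin n =>
      gaussianReal 0 (ν.std W ^ 2))

/-! ### Neural networks, backpropagation and the neural tangent kernel -/

/-- The forward computation of a network: a program all of whose nonlinearities come with weak
derivatives. -/
inductive Net (I J : Type*)
  | vec (i : I) : Net I J
  | mul (W : J) (h : Net I J) : Net I J
  | mulT (W : J) (h : Net I J) : Net I J
  | act {m : ℕ} (φ : Activation m) (args : Fin m → Net I J) : Net I J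

/-- A (feedforward, or unrolled recurrent) network on an input space `X`, all inputs sharing the
parameters: on the input `ξ` it computes the vector `x = body ξ` and outputs `vᵀ x / √n`, where `v`
is the input vector with index `readout ξ`. Input weights are among the input vectors:
the columns of an input weight matrix enter `body ξ` through a linear nonlinearity whose
coefficients are given by `ξ`. -/
structure Network (X I J : Type*) where
  readout : X → I
  body : X → Net I J

section

variable {X I J : Type*}

def Net.toTerm : Net I J → Term I J
  | .vec i => .vec i
  | .mul W h => .mul W h.toTerm
  | .mulT W h => .mulT W h.toTerm
  | .act φ args => .nonlin φ.toNonlin fun k => (args k).toTerm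

/-- The adjoint of the `k`-th argument of an activation whose result has the adjoint `d`. -/
def backArg {m : ℕ} (φ : Activation m) (args : Fin m → Net I J) (d : Term I J) (k : Fin m) :
    Term I J :=
  .nonlin (φ.back k) (Fin.cons d fun j => (args j).toTerm)

/-- Backpropagation started with the adjoint `d` at the root: the adjoints at all occurrences of
the input vector `i`. -/
def Net.vecAdj [DecidableEq I] (i : I) : Net I J → Term I J → List (Term I J)
  | .vec j, d => if j = i then [d] else []
  | .mul W h, d => h.vecAdj i (.mulT W d)
  | .mulT W h, d => h.vecAdj i (.mul W d)
  | .act φ args, d => (List.ofFn fun k => (args k).vecAdj i (backArg φ args d k)).flatten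

/-- Backpropagation started with the adjoint `d` at the root: for every occurrence of the matrix
`W`, the pair of vectors whose outer product is the contribution to the gradient in `W`
(`(d', h)` at an occurrence `W h` with adjoint `d'`, and `(h, d')` at `Wᵀ h`). -/
def Net.matAdj [DecidableEq J] (W : J) : Net I J → Term I J → List (Term I J × Term I J)
  | .vec _, _ => []
  | .mul W' h, d => (if W' = W then [(d, h.toTerm)] else []) ++ h.matAdj W (.mulT W' d)
  | .mulT W' h, d => (if W' = W then [(h.toTerm, d)] else []) ++ h.matAdj W (.mul W' d)
  | .act φ args, d => (List.ofFn fun k => (args k).matAdj W (backArg φ args d k)).flatten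

/-- Every activation of the network is differentiable at the values it is applied to, with the
gradient that backpropagation uses. -/
def Net.RegularAt {n : ℕ} (θ : Params I J n) : Net I J → Prop
  | .vec _ => True
  | .mul _ h => h.RegularAt θ
  | .mulT _ h => h.RegularAt θ
  | .act (m := m) φ args => (∀ k, (args k).RegularAt θ) ∧ ∀ α : Fin n,
      let x : Fin m → ℝ := fun k => (args k).toTerm.eval θ α
      HasFDerivAt φ.toFun
        (∑ k, φ.deriv k x • ContinuousLinearMap.proj (R := ℝ) (φ := fun _ : Fin m => ℝ) k) x

namespace Network

/-- The network function at width `n`. -/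
def output (N : Network X I J) (n : ℕ) (ξ : X) (θ : Params I J n) : ℝ :=
  (√(n : ℝ))⁻¹ * ∑ α, θ.1 α (N.readout ξ) * (N.body ξ).toTerm.eval θ α

variable [DecidableEq I] [DecidableEq J]

/-- Vectors whose sum is `√n` times the gradient of the output in the input vector `i`. -/
def vecAdj (N : Network X I J) (ξ : X) (i : I) : List (Term I J) :=
  (if N.readout ξ = i then [(N.body ξ).toTerm] else []) ++
    (N.body ξ).vecAdj i (.vec (N.readout ξ))

/-- Pairs of vectors whose outer products sum up to `n` times the gradient of the output in the
matrix `ω_W`. -/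
def matAdj (N : Network X I J) (ξ : X) (W : J) : List (Term I J × Term I J) :=
  (N.body ξ).matAdj W (.vec (N.readout ξ))

/-- The gradient of the output in the `α`-th coordinate of the input vector `i`. -/
def gradVec (N : Network X I J) (n : ℕ) (ξ : X) (θ : Params I J n) (α : Fin n) (i : I) : ℝ :=
  (√(n : ℝ))⁻¹ * ((N.vecAdj ξ i).map fun d => d.eval θ α).sum

/-- The gradient of the output in the entry `(α, β)` of the matrix `ω_W`. -/
def gradMat (N : Network X I J) (n : ℕ) (ξ : X) (θ : Params I J n) (W : J) (α β : Fin n) : ℝ :=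
  (n : ℝ)⁻¹ * ((N.matAdj ξ W).map fun p => p.1.eval θ α * p.2.eval θ β).sum

/-- The pairing of the gradient of the output with a direction `δ` in parameter space. -/
def gradPairing [Fintype I] [Fintype J] (N : Network X I J) (n : ℕ) (ξ : X) (θ δ : Params I J n) :
    ℝ :=
  (∑ α, ∑ i, N.gradVec n ξ θ α i * δ.1 α i) +
    ∑ W, ∑ α, ∑ β, N.gradMat n ξ θ W α β * δ.2 W α β

/-- The neural tangent kernel at width `n`: the inner product of the parameter gradients. -/
def ntk [Fintype I] [Fintype J] (N : Network X I J) (n : ℕ) (ξ ξ' : X) (θ : Params I J n) : ℝ :=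
  (∑ α, ∑ i, N.gradVec n ξ θ α i * N.gradVec n ξ' θ α i) +
    ∑ W, ∑ α, ∑ β, N.gradMat n ξ θ W α β * N.gradMat n ξ' θ W α β

/-- The program that expresses the forward and backward computations of the network. -/
def program (N : Network X I J) : Set (Term I J) :=
  {s | ∃ (ξ : X) (t : Term I J), Subterm s t ∧
    (t = .vec (N.readout ξ) ∨ t = (N.body ξ).toTerm ∨ (∃ i, t ∈ N.vecAdj ξ i) ∨
      ∃ W, ∃ p ∈ N.matAdj ξ W, t = p.1 ∨ t = p.2)}

/-- The limit kernel, in terms of the second moments of `Z ~ N(μ, Σ)`. -/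
def limitKernel [Fintype I] [Fintype J] (N : Network X I J) (ν : Init I J) (ξ ξ' : X) : ℝ :=
  (∑ i, ((N.vecAdj ξ i).map fun d =>
      ((N.vecAdj ξ' i).map fun d' => limitMoment ν d d').sum).sum) +
    ∑ W, ((N.matAdj ξ W).map fun p =>
      ((N.matAdj ξ' W).map fun p' => limitMoment ν p.1 p'.1 * limitMoment ν p.2 p'.2).sum).sum

end Network

end

end TensorProgram

end

/-! The kernel is a finite sum of products of normalized inner products of vectors of the program,
because ⟨d hᵀ, d' h'ᵀ⟩ = ⟨d, d'⟩⟨h, h'⟩ (`Network.ntk_eq`). The second claim thus reduces to a law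
of large numbers: for vectors a, b of a BP-like program, n⁻¹⟨a, b⟩ tends to E[Z^a Z^b]
(`BPLike.tendsto_avg_mul`). Nothing is assumed about the joint law across widths, so convergence is
proved in the complete sense, with summable failure probabilities, and Borel–Cantelli turns it into
almost sure convergence (`ae_tendsto_of_tendsto_complete`).

The law of large numbers is proved by induction on the matrix products of the program, listed so
that the argument of each is a coordinatewise function of earlier vectors. The invariant concerns
the rows, that is, the α-th coordinates of all G-variables so far: their empirical distribution
converges to a Gaussian law Λ when tested against bounded measurable functions, all rows eventually
avoid any given Λ-null set, and all empirical moments stay bounded (`LLN`, `IsLimitLaw`,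
`BddMoments`). Since nonlinearities are merely measurable, weak convergence would not suffice; the
moment bounds extend the convergence to polynomially bounded functions.

The inductive step is Gaussian conditioning. Given the rows, the earlier products A hᵢ and Aᵀ h'ⱼ
fix a part of the matrix A, and the rest is distributed as R A' Q with an independent copy A' of A
and the projections Q, R away from the hᵢ and the h'ⱼ (`law_map_rows_unknown`). Hence a new product
A h is conditionally Gaussian with covariance a multiple of R. Its mean is the combination of
earlier results given by the regression of h on the hᵢ, plus a combination of the h'ⱼ
(`law_map_rows_eval`, `condMean_eq`). The coefficients of the latter are built from averages of a
result on one side times an argument on the other side. Here the BP-like condition enters: negating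
the inputs in V preserves the law and changes the sign of these averages, so their limits vanish
(`Converges.tendsto_cross`). In the limit, the new coordinate is a regression on earlier ones plus
independent Gaussian noise, which reproduces the covariance Σ (`Converges.isLimitLaw_adjoin`).

Two difficulties remain. First, the noise R v has dependent coordinates and a degenerate law, and
test functions need not be continuous. However, off boundedly many coordinates its law is dominated
by a polynomial in n times a standard normal law (`exists_stdNormal_residual_le`), and Hoeffding's
exponential bound absorbs the polynomial. Second, ranks may drop in the limit. A linear relation
among arguments that holds Λ-almost everywhere holds exactly in all rows eventually, by the clause
on null sets. So a basis in L²(Λ) also serves at finite width (`Converges.exists_side_basis`), and a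
product with vanishing limit variance is eventually an exact combination of earlier ones
(`Converges.eventually_eq_of_limVar_eq_zero`).

The first claim is the chain rule, by structural induction on the network with an arbitrary adjoint
at the root (`Net.hasFDerivAt_eval`). -/

noncomputable section

namespace TensorProgram

/-! ### Complete convergence -/

section Complete

variable {Ω : ℕ → Type*} [∀ n, MeasurableSpace (Ω n)]

/-- The filter of events whose complements have summable probabilities. Convergence along it is
complete convergence. -/
def complete (μ : ∀ n, Measure (Ω n)) : Filter (Σ n, Ω n) where
  sets := {S | ∑' n, μ n {x | (⟨n, x⟩ : Σ n, Ω n) ∉ S} ≠ ⊤}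
  univ_sets := by simp
  sets_of_superset := by
    intro S T hS hST
    refine ne_top_of_le_ne_top hS (ENNReal.tsum_le_tsum fun n => ?_)
    exact measure_mono fun x hx h => hx (hST h)
  inter_sets := by
    intro S T hS hT
    refine ne_top_of_le_ne_top (ENNReal.add_ne_top.2 ⟨hS, hT⟩) ?_
    rw [← ENNReal.tsum_add]
    refine ENNReal.tsum_le_tsum fun n => (measure_mono ?_).trans (measure_union_le _ _)
    intro x hx
    by_cases h : (⟨n, x⟩ : Σ n, Ω n) ∈ S
    · exact Or.inr fun h' => hx ⟨h, h'⟩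
    · exact Or.inl h

variable {μ : ∀ n, Measure (Ω n)}

theorem eventually_complete_iff {p : (Σ n, Ω n) → Prop} :
    (∀ᶠ x in complete μ, p x) ↔ ∑' n, μ n {x | ¬ p ⟨n, x⟩} ≠ ⊤ := Iff.rfl

/-- Lets a good event `q` be assumed while bounding the failure probability of `p`. Conditional
estimates given the rows enter the argument through this form. -/
theorem eventually_complete_of_le {p q : (Σ n, Ω n) → Prop} {b : ℕ → ENNReal}
    (hb : ∑' n, b n ≠ ⊤) (hq : ∀ᶠ x in complete μ, q x)
    (h : ∀ n, μ n {x | q ⟨n, x⟩ ∧ ¬ p ⟨n, x⟩} ≤ b n) : ∀ᶠ x in complete μ, p x := by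
  have : ∀ᶠ x in complete μ, q x → p x := by
    rw [eventually_complete_iff]
    refine ne_top_of_le_ne_top hb (ENNReal.tsum_le_tsum fun n => ?_)
    simpa only [Classical.not_imp] using h n
  filter_upwards [hq, this] with x h1 h2 using h2 h1

theorem eventually_complete_of_ae {p q : (Σ n, Ω n) → Prop} (hq : ∀ᶠ x in complete μ, q x)
    (h : ∀ n, μ n {x | q ⟨n, x⟩ ∧ ¬ p ⟨n, x⟩} = 0) : ∀ᶠ x in complete μ, p x :=
  eventually_complete_of_le (b := 0) (by simp) hq fun n => (h n).le

theorem tendsto_fst_complete [∀ n, IsProbabilityMeasure (μ n)] :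
    Tendsto Sigma.fst (complete μ) atTop := by
  refine tendsto_atTop.2 fun N => ?_
  rw [eventually_complete_iff, tsum_eq_sum (s := Finset.range N)]
  · exact ENNReal.sum_ne_top.2 fun n _ => measure_ne_top _ _
  · intro n hn
    have : N ≤ n := by simpa using hn
    simp [this]

theorem eventually_fst_complete [∀ n, IsProbabilityMeasure (μ n)] {p : ℕ → Prop}
    (h : ∀ᶠ n in atTop, p n) : ∀ᶠ x in complete μ, p x.1 :=
  tendsto_fst_complete.eventually h

/-- The impossible event fails with probability one at every `n`, and these probabilities are not
summable. Limits along `complete` are therefore unique. -/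
instance complete_neBot [∀ n, IsProbabilityMeasure (μ n)] : (complete μ).NeBot := by
  refine ⟨fun h => ?_⟩
  have : ∀ᶠ _ in complete μ, False := by rw [h]; trivial
  rw [eventually_complete_iff] at this
  simp at this

theorem tendsto_complete_map {Ω' : ℕ → Type*} [∀ n, MeasurableSpace (Ω' n)]
    {μ' : ∀ n, Measure (Ω' n)} {T : ∀ n, Ω n → Ω' n}
    (hT : ∀ n, MeasurePreserving (T n) (μ n) (μ' n)) :
    Tendsto (fun x : Σ n, Ω n => (⟨x.1, T x.1 x.2⟩ : Σ n, Ω' n)) (complete μ) (complete μ') := by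
  intro S hS
  refine ne_top_of_le_ne_top hS (ENNReal.tsum_le_tsum fun n => ?_)
  set A := {x | (⟨n, x⟩ : Σ n, Ω' n) ∉ S}
  -- Members of the filter need not be measurable, so the image measure is evaluated on a measurable
  -- hull of equal measure.
  calc μ n (T n ⁻¹' A) ≤ μ n (T n ⁻¹' toMeasurable (μ' n) A) :=
        measure_mono (Set.preimage_mono (subset_toMeasurable _ _))
    _ = μ' n A := by
        rw [(hT n).measure_preimage (measurableSet_toMeasurable _ _).nullMeasurableSet,
          measure_toMeasurable]

/-- A completely convergent sequence of symmetric random variables tends to `0`. -/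
theorem eq_zero_of_tendsto_complete_of_neg [∀ n, IsProbabilityMeasure (μ n)] {T : ∀ n, Ω n → Ω n}
    (hT : ∀ n, MeasurePreserving (T n) (μ n) (μ n)) {X : (Σ n, Ω n) → ℝ}
    (hX : ∀ n x, X ⟨n, T n x⟩ = - X ⟨n, x⟩) {c : ℝ} (h : Tendsto X (complete μ) (𝓝 c)) : c = 0 := by
  have h1 := h.comp (tendsto_complete_map hT)
  have h2 : Tendsto (fun x => - X x) (complete μ) (𝓝 c) := h1.congr fun x => hX x.1 x.2
  have := tendsto_nhds_unique h2 h.neg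
  linarith

/-- The first Borel–Cantelli lemma, applied to the tolerances 1/(k+1). Only the marginal law at each
`n` enters, which is why the joint law across widths is arbitrary. -/
theorem ae_tendsto_of_tendsto_complete {Ω' : Type*} [MeasurableSpace Ω'] {P : Measure Ω'}
    {θ : ∀ n, Ω' → Ω n} (hθ : ∀ n, HasLaw (θ n) (μ n) P) {X : (Σ n, Ω n) → ℝ} {c : ℝ}
    (h : Tendsto X (complete μ) (𝓝 c)) :
    ∀ᵐ ω ∂P, Tendsto (fun n => X ⟨n, θ n ω⟩) atTop (𝓝 c) := by
  have key : ∀ k : ℕ, ∀ᵐ ω ∂P, ∀ᶠ n in atTop, dist (X ⟨n, θ n ω⟩) c < 1 / ((k : ℝ) + 1) := by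
    intro k
    have hk : ∀ᶠ x in complete μ, dist (X x) c < 1 / ((k : ℝ) + 1) :=
      (Metric.tendsto_nhds.1 h) _ (by positivity)
    rw [eventually_complete_iff] at hk
    refine ae_eventually_notMem (s := fun n => {ω | ¬ dist (X ⟨n, θ n ω⟩) c < 1 / ((k : ℝ) + 1)})
      (ne_top_of_le_ne_top hk (ENNReal.tsum_le_tsum fun n => ?_)) |>.mono ?_
    · set A := {x | ¬ dist (X ⟨n, x⟩) c < 1 / ((k : ℝ) + 1)}
      calc P (θ n ⁻¹' A) ≤ P (θ n ⁻¹' toMeasurable (μ n) A) :=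
            measure_mono (Set.preimage_mono (subset_toMeasurable _ _))
        _ = μ n A := by
            rw [← Measure.map_apply_of_aemeasurable (hθ n).aemeasurable
              (measurableSet_toMeasurable _ _), (hθ n).map_eq, measure_toMeasurable]
    · intro ω hω
      filter_upwards [hω] with n hn
      simpa using hn
  filter_upwards [ae_all_iff.2 key] with ω hω
  refine Metric.tendsto_nhds.2 fun ε hε => ?_
  obtain ⟨k, hk⟩ := exists_nat_one_div_lt hε
  filter_upwards [hω k] with n hn using hn.trans hk

end Complete

/-! ### Averages and moment bounds -/

/-- The average of the coordinates of a vector. -/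
def avg {n : ℕ} (v : Fin n → ℝ) : ℝ := (n : ℝ)⁻¹ * ∑ α, v α

section Avg

variable {n : ℕ} {u v : Fin n → ℝ}

theorem avg_mono (h : ∀ α, u α ≤ v α) : avg u ≤ avg v :=
  mul_le_mul_of_nonneg_left (Finset.sum_le_sum fun α _ => h α) (by positivity)

theorem avg_nonneg (h : ∀ α, 0 ≤ u α) : 0 ≤ avg u :=
  mul_nonneg (by positivity) (Finset.sum_nonneg fun α _ => h α)

theorem avg_add : avg (fun α => u α + v α) = avg u + avg v := by
  simp [avg, Finset.sum_add_distrib, mul_add]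

theorem avg_sub : avg (fun α => u α - v α) = avg u - avg v := by
  simp [avg, Finset.sum_sub_distrib, mul_sub]

theorem avg_neg : avg (fun α => - u α) = - avg u := by simp [avg]

theorem avg_const_mul (c : ℝ) : avg (fun α => c * u α) = c * avg u := by
  simp only [avg, ← Finset.mul_sum]; ring

theorem avg_sum {ι : Type*} (s : Finset ι) (f : ι → Fin n → ℝ) :
    avg (fun α => ∑ i ∈ s, f i α) = ∑ i ∈ s, avg (f i) := by
  simp only [avg, ← Finset.mul_sum]
  rw [Finset.sum_comm]

/-- Only an inequality, since an average over `Fin 0` is `0`. -/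
theorem avg_const_le {c : ℝ} (hc : 0 ≤ c) : avg (fun _ : Fin n => c) ≤ c := by
  rcases Nat.eq_zero_or_pos n with rfl | hn
  · simpa [avg] using hc
  · have : (n : ℝ) ≠ 0 := by positivity
    simp [avg, this]

theorem abs_avg_le : |avg u| ≤ avg fun α => |u α| := by
  rw [avg, abs_mul, abs_of_nonneg (by positivity : (0 : ℝ) ≤ (n : ℝ)⁻¹)]
  exact mul_le_mul_of_nonneg_left (Finset.abs_sum_le_sum_abs _ _) (by positivity)

theorem avg_mul_sq_le :
    (avg fun α => u α * v α) ^ 2 ≤ (avg fun α => u α ^ 2) * avg fun α => v α ^ 2 := by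
  have := Finset.sum_mul_sq_le_sq_mul_sq Finset.univ u v
  simp only [avg]
  calc _ = ((n : ℝ)⁻¹) ^ 2 * (∑ α, u α * v α) ^ 2 := by ring
    _ ≤ ((n : ℝ)⁻¹) ^ 2 * ((∑ α, u α ^ 2) * ∑ α, v α ^ 2) := by gcongr
    _ = _ := by ring

end Avg

/-! ### Vectors with bounded empirical moments. -/

section BddMoments

variable {Ω : ℕ → Type*} [∀ n, MeasurableSpace (Ω n)] {μ : ∀ n, Measure (Ω n)}

variable (μ) in
/-- All empirical moments of the vectors `v` are completely bounded. -/
def BddMoments (v : ∀ x : Σ n, Ω n, Fin x.1 → ℝ) : Prop :=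
  ∀ k : ℕ, ∃ C, ∀ᶠ x in complete μ, avg (fun α => |v x α| ^ k) ≤ C

variable {u v : ∀ x : Σ n, Ω n, Fin x.1 → ℝ}

theorem BddMoments.mono (hv : BddMoments μ v) (h : ∀ᶠ x in complete μ, ∀ α, |u x α| ≤ |v x α|) :
    BddMoments μ u := by
  intro k
  obtain ⟨C, hC⟩ := hv k
  refine ⟨C, ?_⟩
  filter_upwards [hC, h] with x h1 h2
  exact (avg_mono fun α => pow_le_pow_left₀ (abs_nonneg _) (h2 α) k).trans h1

theorem BddMoments.of_bdd {C : ℝ} (h : ∀ᶠ x in complete μ, ∀ α, |v x α| ≤ C) :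
    BddMoments μ v := by
  intro k
  refine ⟨|C| ^ k, ?_⟩
  filter_upwards [h] with x h2
  exact (avg_mono fun α => pow_le_pow_left₀ (abs_nonneg _) ((h2 α).trans (le_abs_self C)) k).trans
    (avg_const_le (by positivity))

theorem bddMoments_const (c : ℝ) : BddMoments μ fun _ _ => c :=
  .of_bdd (C := |c|) (Eventually.of_forall fun _ _ => le_rfl)

theorem BddMoments.add (hu : BddMoments μ u) (hv : BddMoments μ v) :
    BddMoments μ fun x α => u x α + v x α := by
  intro k
  obtain ⟨C, hC⟩ := hu k
  obtain ⟨D, hD⟩ := hv k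
  refine ⟨2 ^ (k - 1) * (C + D), ?_⟩
  filter_upwards [hC, hD] with x h1 h2
  calc avg (fun α => |u x α + v x α| ^ k)
      ≤ avg (fun α => 2 ^ (k - 1) * (|u x α| ^ k + |v x α| ^ k)) := by
        refine avg_mono fun α => (pow_le_pow_left₀ (abs_nonneg _) (abs_add_le _ _) k).trans ?_
        exact add_pow_le (abs_nonneg _) (abs_nonneg _) k
    _ = 2 ^ (k - 1) * (avg (fun α => |u x α| ^ k) + avg fun α => |v x α| ^ k) := by
        rw [avg_const_mul, avg_add]
    _ ≤ _ := by gcongr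

/-- The `k`-th moment of a product is bounded by the `2k`-th moments of the factors, so the class is
closed under products only because all moments are controlled together. -/
theorem BddMoments.mul (hu : BddMoments μ u) (hv : BddMoments μ v) :
    BddMoments μ fun x α => u x α * v x α := by
  intro k
  obtain ⟨C, hC⟩ := hu (k * 2)
  obtain ⟨D, hD⟩ := hv (k * 2)
  refine ⟨C + D, ?_⟩
  filter_upwards [hC, hD] with x h1 h2
  calc avg (fun α => |u x α * v x α| ^ k)
      ≤ avg (fun α => |u x α| ^ (k * 2) + |v x α| ^ (k * 2)) := by
        refine avg_mono fun α => ?_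
        rw [abs_mul, mul_pow, pow_mul, pow_mul]
        nlinarith [sq_nonneg (|u x α| ^ k - |v x α| ^ k), sq_nonneg (|u x α| ^ k),
          sq_nonneg (|v x α| ^ k), sq_nonneg (|u x α| ^ k + |v x α| ^ k)]
    _ = avg (fun α => |u x α| ^ (k * 2)) + avg fun α => |v x α| ^ (k * 2) := avg_add
    _ ≤ _ := by gcongr

theorem BddMoments.abs (hv : BddMoments μ v) : BddMoments μ fun x α => |v x α| :=
  hv.mono (Eventually.of_forall fun _ _ => (abs_abs _).le)

theorem BddMoments.pow (hv : BddMoments μ v) (m : ℕ) : BddMoments μ fun x α => v x α ^ m := by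
  intro k
  obtain ⟨C, hC⟩ := hv (m * k)
  exact ⟨C, hC.mono fun x hx => by simpa only [abs_pow, ← pow_mul] using hx⟩

theorem BddMoments.sum {ι : Type*} (s : Finset ι) {w : ι → ∀ x : Σ n, Ω n, Fin x.1 → ℝ}
    (hw : ∀ i ∈ s, BddMoments μ (w i)) : BddMoments μ fun x α => ∑ i ∈ s, w i x α := by
  classical
  induction s using Finset.induction_on with
  | empty => simpa using bddMoments_const (μ := μ) 0
  | insert i s hi ih =>
    simp only [Finset.sum_insert hi]
    exact (hw i (Finset.mem_insert_self _ _)).add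
      (ih fun j hj => hw j (Finset.mem_insert_of_mem hj))

theorem BddMoments.smul_tendsto (hv : BddMoments μ v) {c : (Σ n, Ω n) → ℝ} {c₀ : ℝ}
    (hc : Tendsto c (complete μ) (𝓝 c₀)) : BddMoments μ fun x α => c x * v x α := by
  refine BddMoments.mul (u := fun x _ => c x) (.of_bdd (C := |c₀| + 1) ?_) hv
  filter_upwards [(hc.abs).eventually (gt_mem_nhds (lt_add_one |c₀|))] with x hx α using hx.le

theorem BddMoments.polyBounded {m : ℕ} {φ : (Fin m → ℝ) → ℝ} (hφ : PolyBounded φ)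
    {w : Fin m → ∀ x : Σ n, Ω n, Fin x.1 → ℝ} (hw : ∀ k, BddMoments μ (w k)) :
    BddMoments μ fun x α => φ fun k => w k x α := by
  obtain ⟨C, p, h⟩ := hφ
  refine BddMoments.mono (v := fun x α => |C| * (1 + (∑ k, |w k x α|) ^ p)) ?_ ?_
  · exact (bddMoments_const |C|).mul ((bddMoments_const 1).add
      ((BddMoments.sum _ fun k _ => (hw k).abs).pow p))
  · refine Eventually.of_forall fun x α => ?_
    have h1 : ‖fun k => w k x α‖ ≤ ∑ k, |w k x α| := by
      refine (pi_norm_le_iff_of_nonneg (Finset.sum_nonneg fun k _ => abs_nonneg _)).2 fun k => ?_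
      exact Finset.single_le_sum (f := fun k => |w k x α|) (fun k _ => abs_nonneg _)
        (Finset.mem_univ k)
    have h0 : (0 : ℝ) ≤ 1 + (∑ k, |w k x α|) ^ p :=
      add_nonneg zero_le_one (pow_nonneg (Finset.sum_nonneg fun k _ => abs_nonneg _) p)
    rw [abs_mul, abs_abs, abs_of_nonneg h0]
    calc _ ≤ C * (1 + ‖fun k => w k x α‖ ^ p) := h _
      _ ≤ |C| * (1 + ‖fun k => w k x α‖ ^ p) := by gcongr; exact le_abs_self C
      _ ≤ _ := by gcongr

end BddMoments

/-! ### Laws of large numbers -/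

section LLN

variable {Ω : ℕ → Type*} [∀ n, MeasurableSpace (Ω n)] {μ : ∀ n, Measure (Ω n)}
  {𝓧 : Type*} [MeasurableSpace 𝓧]

/-- The empirical distributions of the rows `X n ω α`, `α : Fin n`, converge completely to `Λ` when
tested against bounded measurable functions, and no row falls into a given `Λ`-null set. -/
structure LLN (μ : ∀ n, Measure (Ω n)) (X : ∀ n, Ω n → Fin n → 𝓧) (Λ : Measure 𝓧) : Prop where
  conv : ∀ ψ : 𝓧 → ℝ, Measurable ψ → (∃ C, ∀ z, |ψ z| ≤ C) →
    Tendsto (fun x : Σ n, Ω n => avg fun α => ψ (X x.1 x.2 α)) (complete μ) (𝓝 (∫ z, ψ z ∂Λ))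
  null : ∀ N : Set 𝓧, MeasurableSet N → Λ N = 0 →
    ∀ᶠ x : Σ n, Ω n in complete μ, ∀ α, X x.1 x.2 α ∉ N

variable {X : ∀ n, Ω n → Fin n → 𝓧} {Λ : Measure 𝓧}

/-- The purpose of the field `null`: a relation that holds almost everywhere in the limit becomes an
exact relation in every row at finite width. Convergence of averages alone would leave a vanishing
fraction of exceptional rows. -/
theorem LLN.eventually_of_ae (h : LLN μ X Λ) {p : 𝓧 → Prop} (hp : ∀ᵐ z ∂Λ, p z) :
    ∀ᶠ x : Σ n, Ω n in complete μ, ∀ α, p (X x.1 x.2 α) := by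
  have h0 : Λ (toMeasurable Λ {z | ¬ p z}) = 0 := by rw [measure_toMeasurable]; exact hp
  filter_upwards [h.null _ (measurableSet_toMeasurable _ _) h0] with x hx α
  by_contra hc
  exact hx α (subset_toMeasurable _ _ hc)

variable [∀ n, IsProbabilityMeasure (μ n)] [IsProbabilityMeasure Λ]

/-- A Fatou argument: the bounded truncations `min |f| k` have limit integrals below the bound on
the empirical first moment, and monotone convergence removes the truncation. -/
theorem LLN.integrable (h : LLN μ X Λ) {f : 𝓧 → ℝ} (hf : Measurable f)
    (hm : BddMoments μ fun x α => f (X x.1 x.2 α)) : Integrable f Λ := by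
  obtain ⟨C, hC⟩ := hm 1
  refine ⟨hf.aestronglyMeasurable, ?_⟩
  have hb : ∀ k : ℕ, ∫⁻ z, ENNReal.ofReal (min |f z| k) ∂Λ ≤ ENNReal.ofReal C := by
    intro k
    have hmeas : Measurable fun z => min |f z| (k : ℝ) := by fun_prop
    have hbd : ∀ z, |min |f z| (k : ℝ)| ≤ k := fun z => by
      rw [abs_of_nonneg (le_min (abs_nonneg _) (by positivity))]; exact min_le_right _ _
    rw [← ofReal_integral_eq_lintegral_ofReal
      (Integrable.of_bound hmeas.aestronglyMeasurable k (ae_of_all _ fun z => hbd z))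
      (ae_of_all _ fun z => le_min (abs_nonneg _) (by positivity))]
    refine ENNReal.ofReal_le_ofReal (le_of_tendsto (h.conv _ hmeas ⟨k, hbd⟩) ?_)
    filter_upwards [hC] with x hx
    refine le_trans (avg_mono fun α => ?_) hx
    simp
  have hsup : ∀ z, ‖f z‖ₑ = ⨆ k : ℕ, ENNReal.ofReal (min |f z| k) := by
    intro z
    refine le_antisymm ?_ (iSup_le fun k => ?_)
    · obtain ⟨k, hk⟩ := exists_nat_ge |f z|
      refine le_trans ?_ (le_iSup _ k)
      rw [min_eq_left hk, ← Real.norm_eq_abs, ofReal_norm]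
    · rw [← ofReal_norm]
      exact ENNReal.ofReal_le_ofReal (min_le_left _ _)
  rw [HasFiniteIntegral]
  simp_rw [hsup]
  rw [lintegral_iSup (fun k => by fun_prop)]
  · exact (iSup_le hb).trans_lt ENNReal.ofReal_lt_top
  · intro i j hij z
    exact ENNReal.ofReal_le_ofReal (min_le_min_left _ (by exact_mod_cast hij))

/-- Truncating `f` at height `k` changes its empirical average by at most the empirical second
moment divided by `k`, uniformly in the width. The truncated function is covered by `conv`. -/
theorem LLN.tendsto_avg (h : LLN μ X Λ) {f : 𝓧 → ℝ} (hf : Measurable f)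
    (hm : BddMoments μ fun x α => f (X x.1 x.2 α)) :
    Tendsto (fun x : Σ n, Ω n => avg fun α => f (X x.1 x.2 α)) (complete μ) (𝓝 (∫ z, f z ∂Λ)) := by
  have hint := h.integrable hf hm
  obtain ⟨C, hC⟩ := hm 2
  have hC1 : ∀ᶠ x : Σ n, Ω n in complete μ, avg (fun α => |f (X x.1 x.2 α)| ^ 2) ≤ |C| + 1 :=
    hC.mono fun x hx => hx.trans ((le_abs_self C).trans (by linarith))
  let t : ℕ → 𝓧 → ℝ := fun k z => max (-(k : ℝ)) (min (f z) k)
  have ht_meas : ∀ k, Measurable (t k) := fun k => by fun_prop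
  have ht_bd : ∀ k z, |t k z| ≤ k := fun k z =>
    abs_le.2 ⟨le_max_left _ _, max_le (by linarith [(Nat.cast_nonneg k : (0 : ℝ) ≤ k)])
      (min_le_right _ _)⟩
  have ht_le : ∀ k z, |t k z| ≤ |f z| := by
    intro k z
    have hk : (0 : ℝ) ≤ k := by positivity
    simp only [t]
    rcases max_cases (-(k : ℝ)) (min (f z) k) with h1 | h1 <;>
      rcases min_cases (f z) (k : ℝ) with h2 | h2 <;> rw [h1.1] <;> try rw [h2.1]
    all_goals
      rw [abs_le]
      constructor <;> cases abs_cases (f z) <;> linarith [h1.2, h2.2]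
  -- The difference vanishes where |f| ≤ k, and elsewhere it is at most |f| ≤ |f|²/k.
  have ht_sub : ∀ k : ℕ, 0 < k → ∀ z, |f z - t k z| ≤ |f z| ^ 2 / k := by
    intro k hk z
    have hk : (0 : ℝ) < k := by exact_mod_cast hk
    rw [le_div_iff₀ hk, sq_abs]
    simp only [t]
    rcases max_cases (-(k : ℝ)) (min (f z) k) with h1 | h1 <;>
      rcases min_cases (f z) (k : ℝ) with h2 | h2 <;> rw [h1.1] <;> (try rw [h2.1])
    · rw [abs_of_nonpos (by linarith [h1.2, h2.1])]; nlinarith [h1.2, h2.1]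
    · exfalso; linarith
    · simp; positivity
    · rw [abs_of_nonneg (by linarith)]; nlinarith
  have hlim : Tendsto (fun k => ∫ z, t k z ∂Λ) atTop (𝓝 (∫ z, f z ∂Λ)) := by
    refine tendsto_integral_of_dominated_convergence (fun z => |f z|)
      (fun k => (ht_meas k).aestronglyMeasurable) hint.abs (fun k => ae_of_all _ fun z => ht_le k z)
      (ae_of_all _ fun z => ?_)
    refine tendsto_const_nhds.congr' ?_
    obtain ⟨K, hK⟩ := exists_nat_ge |f z|
    filter_upwards [eventually_ge_atTop K] with k hk
    have : |f z| ≤ k := hK.trans (by exact_mod_cast hk)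
    rw [abs_le] at this
    simp only [t]
    rw [min_eq_left this.2, max_eq_right this.1]
  refine Metric.tendsto_nhds.2 fun ε hε => ?_
  have e1 : ∀ᶠ k in atTop, dist (∫ z, t k z ∂Λ) (∫ z, f z ∂Λ) < ε / 3 :=
    Metric.tendsto_nhds.1 hlim _ (by positivity)
  have e2 : ∀ᶠ k : ℕ in atTop, (|C| + 1) / k < ε / 3 :=
    (tendsto_const_div_atTop_nhds_zero_nat (|C| + 1)).eventually (gt_mem_nhds (by positivity))
  obtain ⟨k, ⟨hk1, hk2⟩, hk3⟩ := ((e1.and e2).and (eventually_gt_atTop 0)).exists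
  have e3 := Metric.tendsto_nhds.1 (h.conv (t k) (ht_meas k) ⟨k, ht_bd k⟩) (ε / 3) (by positivity)
  filter_upwards [e3, hC1] with x h1 h2
  have h3 : |avg (fun α => f (X x.1 x.2 α)) - avg fun α => t k (X x.1 x.2 α)| ≤ (|C| + 1) / k := by
    rw [← avg_sub]
    refine abs_avg_le.trans ((avg_mono fun α => ht_sub k hk3 _).trans ?_)
    simp only [div_eq_inv_mul]
    rw [avg_const_mul]
    gcongr
  rw [Real.dist_eq] at *
  have := abs_add_three (avg (fun α => f (X x.1 x.2 α)) - avg fun α => t k (X x.1 x.2 α))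
    ((avg fun α => t k (X x.1 x.2 α)) - ∫ z, t k z ∂Λ) (∫ z, t k z ∂Λ - ∫ z, f z ∂Λ)
  refine lt_of_le_of_lt ?_ (lt_of_le_of_lt this (by linarith))
  apply le_of_eq; congr 1; ring

end LLN

/-! ### Concentration of averages of independent random variables -/

section Concentration

/-- A centred variable with values in an interval of length 2B is sub-Gaussian with parameter B².
The two tails are bounded separately, whence the factor 2. -/
theorem hoeffding_pi {ι : Type*} [Fintype ι] {𝓨 : Type*} [MeasurableSpace 𝓨] (ρ : ι → Measure 𝓨)
    [∀ i, IsProbabilityMeasure (ρ i)] {f : ι → 𝓨 → ℝ} (hf : ∀ i, Measurable (f i)) {B : ℝ}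
    (hB : ∀ i y, |f i y| ≤ B) {ε : ℝ} (hε : 0 ≤ ε) :
    Measure.pi ρ {y | ε ≤ |∑ i, (f i (y i) - ∫ t, f i t ∂ρ i)|} ≤
      ENNReal.ofReal (2 * Real.exp (-ε ^ 2 / (2 * Fintype.card ι * B ^ 2))) := by
  set P := Measure.pi ρ
  let X : ι → (ι → 𝓨) → ℝ := fun i y => f i (y i) - ∫ t, f i t ∂ρ i
  have hmean : ∀ i, ∫ y, f i (y i) ∂P = ∫ t, f i t ∂ρ i := fun i =>
    integral_comp_eval (hf i).aestronglyMeasurable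
  have hind : iIndepFun X P :=
    iIndepFun_pi (X := fun i t => f i t - ∫ t, f i t ∂ρ i) fun i => ((hf i).sub_const _).aemeasurable
  have hsub : ∀ i, HasSubgaussianMGF (X i) (Real.toNNReal (B ^ 2)) P := by
    intro i
    have := hasSubgaussianMGF_of_mem_Icc (μ := P) (X := fun y => f i (y i)) (a := -B) (b := B)
      ((hf i).comp (measurable_pi_apply i)).aemeasurable
      (ae_of_all _ fun y => abs_le.1 (hB i (y i)))
    rw [hmean] at this
    convert this using 1
    rw [← NNReal.coe_inj, Real.coe_toNNReal _ (sq_nonneg B)]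
    push_cast
    rw [Real.norm_eq_abs, div_pow, sq_abs]
    ring
  have hsum : (∑ _i : ι, (Real.toNNReal (B ^ 2) : ℝ≥0) : ℝ≥0) = (Fintype.card ι : ℝ) * B ^ 2 := by
    push_cast
    rw [Real.coe_toNNReal _ (sq_nonneg B)]
    simp
  have h1 := HasSubgaussianMGF.measure_sum_ge_le_of_iIndepFun hind (s := Finset.univ)
    (fun i _ => hsub i) hε
  have h2 := HasSubgaussianMGF.measure_sum_ge_le_of_iIndepFun (X := fun i => - X i)
    (hind.comp (fun _ t => -t) fun _ => measurable_neg) (s := Finset.univ)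
    (fun i _ => (hsub i).neg) hε
  have hE : -ε ^ 2 / (2 * ((∑ _i : ι, (Real.toNNReal (B ^ 2) : ℝ≥0) : ℝ≥0) : ℝ)) =
      -ε ^ 2 / (2 * Fintype.card ι * B ^ 2) := by rw [hsum]; ring
  rw [hE] at h1 h2
  rw [← ofReal_measureReal, two_mul]
  refine ENNReal.ofReal_le_ofReal ?_
  refine le_trans (measureReal_mono ?_) ((measureReal_union_le _ _).trans (add_le_add h1 h2))
  intro y hy
  rcases le_abs.1 (show ε ≤ |∑ i, X i y| from hy) with h | h
  · exact Or.inl h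
  · refine Or.inr ?_
    simpa using h

/-- Induction on the index set. When a centred independent X is added to S, the terms of (S + X)⁴
that are linear in X or in S integrate to zero, leaving S⁴ + 6S²X² + X⁴. With E S² ≤ |s|v and v² ≤
K, the increment is at most 6|s|K + K, which is covered by that of 3K|s|². -/
theorem integral_sum_pow_four_le {Ω ι : Type*} [MeasurableSpace Ω] {P : Measure Ω}
    [IsProbabilityMeasure P] {X : ι → Ω → ℝ} (hX : ∀ i, Measurable (X i)) (hind : iIndepFun X P)
    (hL : ∀ i, MemLp (X i) 4 P) (h0 : ∀ i, ∫ ω, X i ω ∂P = 0) {v K : ℝ}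
    (hv : ∀ i, ∫ ω, X i ω ^ 2 ∂P ≤ v) (hv0 : 0 ≤ v) (hK : ∀ i, ∫ ω, X i ω ^ 4 ∂P ≤ K)
    (hvK : v ^ 2 ≤ K) (s : Finset ι) :
    ∫ ω, (∑ i ∈ s, X i ω) ^ 4 ∂P ≤ 3 * K * (s.card : ℝ) ^ 2 := by
  classical
  have hSL : ∀ s : Finset ι, MemLp (fun ω => ∑ i ∈ s, X i ω) 4 P := fun s =>
    memLp_finsetSum s fun i _ => hL i
  have hpow : ∀ (Y : Ω → ℝ), MemLp Y 4 P → ∀ k : ℕ, k ≤ 4 → Integrable (fun ω => Y ω ^ k) P := by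
    intro Y hY k hk
    have h1 : MemLp Y k P := hY.mono_exponent (by exact_mod_cast hk)
    refine (integrable_norm_iff (h1.1.pow k)).1 ?_
    simpa only [Pi.pow_apply, norm_pow] using h1.integrable_norm_pow'
  have hmul : ∀ (i : ι) (s : Finset ι), i ∉ s → ∀ a b : ℕ, a ≤ 4 → b ≤ 4 →
      Integrable (fun ω => (∑ j ∈ s, X j ω) ^ a * X i ω ^ b) P ∧
      ∫ ω, (∑ j ∈ s, X j ω) ^ a * X i ω ^ b ∂P =
        (∫ ω, (∑ j ∈ s, X j ω) ^ a ∂P) * ∫ ω, X i ω ^ b ∂P := by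
    intro i s hi a b ha hb
    have hI : IndepFun (fun ω => ∑ j ∈ s, X j ω) (X i) P := by
      have := hind.indepFun_finsetSum_of_notMem hX hi
      convert this using 1
      ext ω; simp
    have hI2 := hI.comp (measurable_id.pow_const a) (measurable_id.pow_const b)
    exact ⟨hI2.integrable_mul (hpow _ (hSL s) a ha) (hpow _ (hL i) b hb),
      hI.integral_fun_comp_mul_comp (f := fun t => t ^ a) (g := fun t => t ^ b)
        (Finset.measurable_sum s fun j _ => hX j).aemeasurable (hX i).aemeasurable
        (by fun_prop) (by fun_prop)⟩
  have hmean : ∀ s : Finset ι, ∫ ω, ∑ j ∈ s, X j ω ∂P = 0 := fun s => by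
    rw [integral_finsetSum _ fun i _ => (hL i).integrable (by norm_num)]
    simp [h0]
  have hsq : ∀ s : Finset ι, ∫ ω, (∑ j ∈ s, X j ω) ^ 2 ∂P ≤ s.card * v := by
    intro s
    induction s using Finset.induction_on with
    | empty => simp
    | insert i s hi ih =>
      have e : ∀ ω, (∑ j ∈ insert i s, X j ω) ^ 2 =
          (∑ j ∈ s, X j ω) ^ 2 + (2 * ((∑ j ∈ s, X j ω) ^ 1 * X i ω ^ 1) + X i ω ^ 2) := by
        intro ω; rw [Finset.sum_insert hi]; ring
      obtain ⟨i1, e1⟩ := hmul i s hi 1 1 (by norm_num) (by norm_num)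
      simp only [e]
      rw [integral_add (hpow _ (hSL s) 2 (by norm_num))
        ((i1.const_mul 2).fun_add (hpow _ (hL i) 2 (by norm_num))),
        integral_add (i1.const_mul 2) (hpow _ (hL i) 2 (by norm_num)), integral_const_mul, e1]
      simp only [pow_one, hmean, h0, Finset.card_insert_of_notMem hi]
      push_cast
      linarith [hv i]
  induction s using Finset.induction_on with
  | empty => simp
  | insert i s hi ih =>
    have e : ∀ ω, (∑ j ∈ insert i s, X j ω) ^ 4 =
        (∑ j ∈ s, X j ω) ^ 4 + (4 * ((∑ j ∈ s, X j ω) ^ 3 * X i ω ^ 1) +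
          (6 * ((∑ j ∈ s, X j ω) ^ 2 * X i ω ^ 2) +
          (4 * ((∑ j ∈ s, X j ω) ^ 1 * X i ω ^ 3) + X i ω ^ 4))) := by
      intro ω; rw [Finset.sum_insert hi]; ring
    obtain ⟨i1, e1⟩ := hmul i s hi 3 1 (by norm_num) (by norm_num)
    obtain ⟨i2, e2⟩ := hmul i s hi 2 2 (by norm_num) (by norm_num)
    obtain ⟨i3, e3⟩ := hmul i s hi 1 3 (by norm_num) (by norm_num)
    have i0 := hpow _ (hSL s) 4 le_rfl
    have i4 := hpow _ (hL i) 4 le_rfl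
    have j3 := (i3.const_mul 4).fun_add i4
    have j2 := (i2.const_mul 6).fun_add j3
    have j1 := (i1.const_mul 4).fun_add j2
    simp only [e]
    rw [integral_add i0 j1, integral_add (i1.const_mul 4) j2, integral_add (i2.const_mul 6) j3,
      integral_add (i3.const_mul 4) i4]
    simp only [integral_const_mul, e1, e2, e3]
    simp only [pow_one, hmean, h0, Finset.card_insert_of_notMem hi]
    push_cast
    have hm : (∫ ω, (∑ j ∈ s, X j ω) ^ 2 ∂P) * ∫ ω, X i ω ^ 2 ∂P ≤ (s.card * v) * v :=
      mul_le_mul (hsq s) (hv i) (integral_nonneg fun ω => sq_nonneg _) (by positivity)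
    have hc : (0 : ℝ) ≤ s.card := by positivity
    nlinarith [hK i, mul_le_mul_of_nonneg_left hvK hc, sq_nonneg v]

theorem memLp_abs_pow {𝓨 : Type*} [MeasurableSpace 𝓨] {ρ : Measure 𝓨} [IsProbabilityMeasure ρ]
    {f : 𝓨 → ℝ} (hf : ∀ p : ℕ, MemLp f p ρ) (j : ℕ) : MemLp (fun y => |f y| ^ j) 4 ρ := by
  rcases Nat.eq_zero_or_pos j with rfl | hj
  · simpa using memLp_const (1 : ℝ)
  · have h2 := (hf (4 * j)).norm_rpow_div (j : ENNReal)
    have h3 : ((4 * j : ℕ) : ENNReal) / (j : ENNReal) = 4 := by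
      push_cast
      rw [mul_div_assoc, ENNReal.div_self (by exact_mod_cast hj.ne') (ENNReal.natCast_ne_top _),
        mul_one]
    rw [h3] at h2
    simpa using h2

/-- The empirical mean of independent copies of a random variable with finite fourth moment exceeds
the mean by `1` with probability `O(n⁻²)`. -/
theorem exists_measure_pi_avg_gt_le {𝓨 : Type*} [MeasurableSpace 𝓨] (ρ : Measure 𝓨)
    [IsProbabilityMeasure ρ] {f : 𝓨 → ℝ} (hf : Measurable f) (hL : MemLp f 4 ρ) :
    ∃ K : ℝ, ∀ n : ℕ, 0 < n →
      Measure.pi (fun _ : Fin n => ρ) {y | ∫ t, f t ∂ρ + 1 < avg fun α => f (y α)} ≤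
        ENNReal.ofReal (K / (n : ℝ) ^ 2) := by
  let g : 𝓨 → ℝ := fun t => f t - ∫ t, f t ∂ρ
  have hg : Measurable g := hf.sub_const _
  have hgL : MemLp g 4 ρ := hL.sub (memLp_const _)
  have hg0 : ∫ t, g t ∂ρ = 0 := by
    simp only [g]
    rw [integral_sub (hL.integrable (by norm_num)) (integrable_const _)]
    simp
  set v := ∫ t, g t ^ 2 ∂ρ
  set K := max (∫ t, g t ^ 4 ∂ρ) (v ^ 2)
  have hK0 : 0 ≤ K := le_max_of_le_right (sq_nonneg v)
  refine ⟨3 * K, fun n hn => ?_⟩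
  set P := Measure.pi fun _ : Fin n => ρ
  let X : Fin n → (Fin n → 𝓨) → ℝ := fun i y => g (y i)
  have hmean : ∀ k : ℕ, ∀ i, ∫ y, X i y ^ k ∂P = ∫ t, g t ^ k ∂ρ := fun k i =>
    integral_comp_eval (μ := fun _ : Fin n => ρ) (i := i) (f := fun t => g t ^ k)
      (hg.pow_const k).aestronglyMeasurable
  have hXL : ∀ i, MemLp (X i) 4 P := fun i =>
    hgL.comp_measurePreserving (measurePreserving_eval (fun _ : Fin n => ρ) i)
  have h4 := integral_sum_pow_four_le (P := P) (X := X) (fun i => hg.comp (measurable_pi_apply i))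
    (iIndepFun_pi (X := fun _ => g) fun _ => hg.aemeasurable) hXL
    (fun i => by simpa [hg0] using hmean 1 i) (v := v) (K := K) (fun i => (hmean 2 i).le)
    (integral_nonneg fun t => sq_nonneg _) (fun i => (hmean 4 i).trans_le (le_max_left _ _))
    (le_max_right _ _) Finset.univ
  have hn' : (0 : ℝ) < n := by exact_mod_cast hn
  have hint : Integrable (fun y => (∑ i, X i y) ^ 4) P := by
    have h1 : MemLp (fun y => ∑ i, X i y) 4 P := memLp_finsetSum _ fun i _ => hXL i
    refine (integrable_norm_iff (h1.1.pow 4)).1 ?_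
    simpa only [Pi.pow_apply, norm_pow] using MemLp.integrable_norm_pow' (p := 4) h1
  -- An excess of 1 in the mean forces the centred sum to be at least `n`, so Markov's inequality
  -- for fourth powers gives 3Kn²/n⁴. Second moments would give only 1/n, which is not summable.
  have hM := mul_meas_ge_le_integral_of_nonneg (μ := P) (f := fun y => (∑ i, X i y) ^ 4)
    (ae_of_all _ fun y => by positivity) hint ((n : ℝ) ^ 4)
  rw [← ofReal_measureReal]
  refine ENNReal.ofReal_le_ofReal ?_
  have hsub : {y : Fin n → 𝓨 | ∫ t, f t ∂ρ + 1 < avg fun α => f (y α)} ⊆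
      {y | (n : ℝ) ^ 4 ≤ (∑ i, X i y) ^ 4} := by
    intro y hy
    simp only [Set.mem_ofPred_eq, avg] at hy ⊢
    refine pow_le_pow_left₀ hn'.le ?_ 4
    simp only [X, g, Finset.sum_sub_distrib, Finset.sum_const, Finset.card_univ, Fintype.card_fin,
      nsmul_eq_mul]
    rw [inv_mul_eq_div, lt_div_iff₀ hn'] at hy
    nlinarith
  have h5 : (n : ℝ) ^ 4 * P.real {y | (n : ℝ) ^ 4 ≤ (∑ i, X i y) ^ 4} ≤ 3 * K * (n : ℝ) ^ 2 := by
    refine hM.trans (h4.trans ?_)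
    simp
  refine (measureReal_mono hsub).trans ?_
  rw [le_div_iff₀ (by positivity)]
  have : (0 : ℝ) < (n : ℝ) ^ 2 := by positivity
  nlinarith

end Concentration

/-! ### Linear images of standard Gaussian vectors -/

section StdNormal

open Matrix

/-- The law of a vector of independent standard normal variables. -/
def stdNormal (ι : Type*) [Fintype ι] : Measure (ι → ℝ) := Measure.pi fun _ => gaussianReal 0 1

variable {ι κ m : Type*} [Fintype ι] [Fintype κ]

instance : IsProbabilityMeasure (stdNormal ι) := by unfold stdNormal; infer_instance

theorem measurable_mulVec (M : Matrix m ι ℝ) : Measurable fun v : ι → ℝ => M *ᵥ v :=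
  measurable_pi_lambda _ fun _ => Finset.measurable_sum _ fun _ _ => by fun_prop

variable [Fintype m]

theorem charFun_stdNormal_map_mulVec (M : Matrix m ι ℝ) (t : EuclideanSpace ℝ m) :
    charFun (((stdNormal ι).map (M *ᵥ ·)).map (WithLp.toLp 2)) t =
      Complex.exp (-(t.ofLp ⬝ᵥ (M * Mᵀ) *ᵥ t.ofLp : ℝ) / 2) := by
  have h1 : ((stdNormal ι).map (M *ᵥ ·)).map (WithLp.toLp 2) =
      (stdNormal ι).map fun v => WithLp.toLp 2 (M *ᵥ v) :=
    Measure.map_map (by fun_prop) (measurable_mulVec M)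
  have hmeas : Measurable fun v : ι → ℝ => WithLp.toLp 2 (M *ᵥ v) :=
    (show Measurable (WithLp.toLp 2 : (m → ℝ) → EuclideanSpace ℝ m) by fun_prop).comp
      (measurable_mulVec M)
  rw [h1, charFun_apply, integral_map hmeas.aemeasurable (by fun_prop)]
  have h2 := charFun_stdGaussian (WithLp.toLp 2 (Mᵀ *ᵥ t.ofLp) : EuclideanSpace ℝ ι)
  rw [← map_pi_eq_stdGaussian, charFun_apply, integral_map (by fun_prop) (by fun_prop)] at h2
  have hn : ‖(WithLp.toLp 2 (Mᵀ *ᵥ t.ofLp) : EuclideanSpace ℝ ι)‖ ^ 2 =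
      t.ofLp ⬝ᵥ (M * Mᵀ) *ᵥ t.ofLp := by
    rw [EuclideanSpace.real_norm_sq_eq, ← mulVec_mulVec, dotProduct_mulVec, ← mulVec_transpose]
    simp [dotProduct, sq]
  rw [← Complex.ofReal_pow, hn] at h2
  rw [← h2]
  refine integral_congr_ae (ae_of_all _ fun v => ?_)
  have : inner ℝ (WithLp.toLp 2 (M *ᵥ v)) t =
      inner ℝ (WithLp.toLp 2 v) (WithLp.toLp 2 (Mᵀ *ᵥ t.ofLp) : EuclideanSpace ℝ ι) := by
    simp only [EuclideanSpace.inner_eq_star_dotProduct, star_trivial]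
    rw [dotProduct_mulVec, mulVec_transpose]
  simp only [this]

/-- The law of `M ζ`, for `ζ` a standard normal vector, is determined by `M * Mᵀ`. -/
theorem stdNormal_map_mulVec_eq {M : Matrix m ι ℝ} {N : Matrix m κ ℝ} (h : M * Mᵀ = N * Nᵀ) :
    (stdNormal ι).map (M *ᵥ ·) = (stdNormal κ).map (N *ᵥ ·) := by
  have hM := Measure.isProbabilityMeasure_map (μ := stdNormal ι) (measurable_mulVec M).aemeasurable
  have hN := Measure.isProbabilityMeasure_map (μ := stdNormal κ) (measurable_mulVec N).aemeasurable
  refine (MeasurableEquiv.toLp 2 (m → ℝ)).map_measurableEquiv_injective ?_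
  have e : ⇑(MeasurableEquiv.toLp 2 (m → ℝ)) = WithLp.toLp 2 := rfl
  rw [e]
  have := Measure.isProbabilityMeasure_map (μ := (stdNormal ι).map (M *ᵥ ·))
    (f := (WithLp.toLp 2 : (m → ℝ) → EuclideanSpace ℝ m)) (by fun_prop)
  have := Measure.isProbabilityMeasure_map (μ := (stdNormal κ).map (N *ᵥ ·))
    (f := (WithLp.toLp 2 : (m → ℝ) → EuclideanSpace ℝ m)) (by fun_prop)
  refine Measure.ext_of_charFun (E := EuclideanSpace ℝ m) ?_
  ext t
  rw [charFun_stdNormal_map_mulVec, charFun_stdNormal_map_mulVec, h]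

theorem stdNormal_map_const_mul (c : ι → ℝ) :
    (stdNormal ι).map (fun v i => c i * v i) =
      Measure.pi fun i => gaussianReal 0 (Real.toNNReal (c i ^ 2)) := by
  have h : ∀ i, (gaussianReal 0 1).map (fun t => c i * t) =
      gaussianReal 0 (Real.toNNReal (c i ^ 2)) := fun i => by
    rw [gaussianReal_map_const_mul]
    congr 1
    · simp
    · rw [← NNReal.coe_inj]; simp [Real.coe_toNNReal _ (sq_nonneg (c i))]
  have : ∀ i, SigmaFinite ((gaussianReal 0 1).map fun t => c i * t) := fun i => by
    rw [h]; infer_instance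
  rw [stdNormal, Measure.pi_map_pi (f := fun i t => c i * t) (fun i => by fun_prop)]
  simp_rw [h]

theorem stdNormal_map_dotProduct (a : ι → ℝ) :
    (stdNormal ι).map (fun v => ∑ i, a i * v i) =
      gaussianReal 0 (Real.toNNReal (∑ i, a i ^ 2)) := by
  have h := stdNormal_map_mulVec_eq (m := Unit) (M := Matrix.of fun _ i => a i)
    (N := Matrix.of fun _ (_ : Unit) => √(∑ i, a i ^ 2)) (by
      ext i j
      simp [Matrix.mul_apply, ← sq, Real.sq_sqrt (Finset.sum_nonneg fun i _ => sq_nonneg (a i))])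
  have h' := congrArg (fun ρ => ρ.map fun v : Unit → ℝ => v ()) h
  rw [Measure.map_map (by fun_prop) (measurable_mulVec _),
    Measure.map_map (by fun_prop) (measurable_mulVec _)] at h'
  have e1 : (fun v : Unit → ℝ => v ()) ∘ (fun v => (Matrix.of fun (_ : Unit) i => a i) *ᵥ v) =
      fun v => ∑ i, a i * v i := by
    ext v; simp [Matrix.mulVec, dotProduct]
  have e2 : (fun v : Unit → ℝ => v ()) ∘
      (fun v => (Matrix.of fun (_ : Unit) (_ : Unit) => √(∑ i, a i ^ 2)) *ᵥ v) =
      (fun v : Unit → ℝ => v ()) ∘ fun v _ => √(∑ i, a i ^ 2) * v () := by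
    ext v; simp [Matrix.mulVec, dotProduct]
  have := stdNormal_map_const_mul fun _ : Unit => √(∑ i, a i ^ 2)
  rw [e1, e2, ← Measure.map_map (by fun_prop) (by fun_prop)] at h'
  rw [h']
  have h3 : (fun (v : Unit → ℝ) (_ : Unit) => √(∑ i, a i ^ 2) * v ()) =
    fun (v : Unit → ℝ) (i : Unit) => √(∑ i, a i ^ 2) * v i := rfl
  rw [h3, this, (measurePreserving_eval _ ()).map_eq]
  rw [Real.sq_sqrt (Finset.sum_nonneg fun i _ => sq_nonneg (a i))]

/-! ### Domination -/

theorem pi_le_smul_pi {𝓨 : Type*} [MeasurableSpace 𝓨] {μ ν : ι → Measure 𝓨} [∀ i, SigmaFinite (μ i)]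
    [∀ i, SigmaFinite (ν i)] {c : ι → ℝ≥0} (h : ∀ i, μ i ≤ c i • ν i) :
    Measure.pi μ ≤ (∏ i, c i) • Measure.pi ν := by
  have h1 : Measure.pi (fun i => c i • ν i) = (∏ i, c i) • Measure.pi ν := by
    refine Measure.pi_eq fun s _ => ?_
    rw [Measure.smul_apply, Measure.pi_pi]
    simp only [Measure.smul_apply, ENNReal.smul_def, smul_eq_mul, Finset.prod_mul_distrib]
    push_cast
    rfl
  rw [← h1]
  refine Measure.le_iff.2 fun s hs => ?_
  -- The comparison is made between the outer measures that generate the products, for which it is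
  -- enough to bound boxes.
  rw [Measure.pi, toMeasure_apply _ _ hs, Measure.pi, toMeasure_apply _ _ hs]
  have : OuterMeasure.pi (fun i => (μ i).toOuterMeasure) ≤
      OuterMeasure.pi fun i => (c i • ν i).toOuterMeasure := by
    refine OuterMeasure.le_pi.2 fun t _ => (OuterMeasure.pi_pi_le _ t).trans ?_
    exact Finset.prod_le_prod' fun i _ => h i _
  exact this s

/-- For variance at most 1 the exponential factor of the density is below the standard one, so the
ratio of densities is at most the ratio of the normalizing constants. -/
theorem gaussianReal_le_smul {v : ℝ≥0} (hv : v ≠ 0) (hv1 : v ≤ 1) :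
    gaussianReal 0 v ≤ (NNReal.sqrt v)⁻¹ • gaussianReal 0 1 := by
  rw [gaussianReal_of_var_ne_zero 0 hv, gaussianReal_of_var_ne_zero 0 one_ne_zero]
  have hv0 : (0 : ℝ) < v := by positivity
  have : (NNReal.sqrt v)⁻¹ • volume.withDensity (gaussianPDF 0 1) =
      volume.withDensity (((NNReal.sqrt v)⁻¹ : ℝ≥0) • gaussianPDF 0 1) := by
    rw [ENNReal.smul_def, ← withDensity_smul _ (measurable_gaussianPDF 0 1)]
    rfl
  rw [this]
  refine withDensity_mono (ae_of_all _ fun x => ?_)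
  simp only [Pi.smul_apply, gaussianPDF, ENNReal.smul_def, smul_eq_mul]
  rw [← ENNReal.ofReal_coe_nnreal, ← ENNReal.ofReal_mul (by positivity)]
  refine ENNReal.ofReal_le_ofReal ?_
  simp only [gaussianPDFReal, NNReal.coe_inv, Real.coe_sqrt, NNReal.coe_one, mul_one, sub_zero]
  rw [Real.sqrt_mul (by positivity), mul_inv, mul_comm (√(2 * Real.pi))⁻¹, mul_assoc]
  refine mul_le_mul_of_nonneg_left (mul_le_mul_of_nonneg_left (Real.exp_le_exp.2 ?_) (by positivity))
    (by positivity)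
  rw [neg_div, neg_div]
  refine neg_le_neg (div_le_div_of_nonneg_left (sq_nonneg x) (by positivity) ?_)
  have : (v : ℝ) ≤ 1 := by exact_mod_cast hv1
  linarith

variable [DecidableEq m]

/-- In an orthonormal eigenbasis of the covariance the law is a product of centred normal laws with
variances in (0, 1]. The one-dimensional dominations multiply to det^(-1/2), and the standard normal
law is rotation invariant. -/
theorem stdNormal_map_mulVec_le (M : Matrix m ι ℝ) (hdet : (M * Mᵀ).det ≠ 0)
    (hle : ∀ t, t ⬝ᵥ (M * Mᵀ) *ᵥ t ≤ t ⬝ᵥ t) :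
    (stdNormal ι).map (M *ᵥ ·) ≤ (Real.toNNReal (√(M * Mᵀ).det)⁻¹) • stdNormal m := by
  set A := M * Mᵀ with hA
  have hpsd : A.PosSemidef := by
    simpa [conjTranspose_eq_transpose_of_trivial] using posSemidef_self_mul_conjTranspose M
  have hpd : A.PosDef := hpsd.posDef_iff_det_ne_zero.2 hdet
  have hH := hpd.1
  set l := hH.eigenvalues
  have hl0 : ∀ i, 0 < l i := hpd.eigenvalues_pos
  -- The bound on the quadratic form is tested on a unit eigenvector.
  have hl1 : ∀ i, l i ≤ 1 := by
    intro i
    have h1 := hle (hH.eigenvectorBasis i).ofLp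
    rw [hH.mulVec_eigenvectorBasis] at h1
    have h2 : (hH.eigenvectorBasis i).ofLp ⬝ᵥ (hH.eigenvectorBasis i).ofLp = 1 := by
      have := hH.eigenvectorBasis.orthonormal.1 i
      have h3 := EuclideanSpace.real_norm_sq_eq (hH.eigenvectorBasis i)
      rw [this] at h3
      simp only [dotProduct, ← sq]
      linarith
    rw [dotProduct_smul, h2] at h1
    simpa using h1
  set U : Matrix m m ℝ := (hH.eigenvectorUnitary : Matrix m m ℝ)
  have hUU : U * Uᵀ = 1 := by
    have := (Unitary.mem_iff.1 hH.eigenvectorUnitary.2).2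
    simpa [star_eq_conjTranspose, conjTranspose_eq_transpose_of_trivial] using this
  have hspec : A = U * diagonal l * Uᵀ := by
    have := hH.spectral_theorem
    rw [Unitary.conjStarAlgAut_apply] at this
    simpa [star_eq_conjTranspose, conjTranspose_eq_transpose_of_trivial] using this
  have hN : A = (U * diagonal fun i => √(l i)) * (U * diagonal fun i => √(l i))ᵀ := by
    rw [transpose_mul, diagonal_transpose, Matrix.mul_assoc,
      ← Matrix.mul_assoc (diagonal _) (diagonal _), diagonal_mul_diagonal, ← Matrix.mul_assoc]
    simp only [Real.mul_self_sqrt (hl0 _).le]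
    exact hspec
  rw [stdNormal_map_mulVec_eq (hA.symm.trans hN)]
  have e : (fun v : m → ℝ => (U * diagonal fun i => √(l i)) *ᵥ v) =
      (U *ᵥ ·) ∘ fun v i => √(l i) * v i := by
    ext v i
    simp only [Function.comp, ← mulVec_mulVec]
    congr 2
    ext j
    rw [mulVec_diagonal]
  rw [e, ← Measure.map_map (measurable_mulVec U) (by fun_prop), stdNormal_map_const_mul]
  have hdom : Measure.pi (fun i => gaussianReal 0 (Real.toNNReal (√(l i) ^ 2))) ≤
      (∏ i, (NNReal.sqrt (Real.toNNReal (√(l i) ^ 2)))⁻¹) • stdNormal m := by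
    refine pi_le_smul_pi fun i => gaussianReal_le_smul ?_ ?_
    · rw [Real.sq_sqrt (hl0 i).le]
      simpa using hl0 i
    · rw [Real.sq_sqrt (hl0 i).le]
      simpa using hl1 i
  refine (Measure.map_mono hdom (measurable_mulVec U)).trans ?_
  rw [Measure.map_smul, stdNormal_map_mulVec_eq (M := U) (N := (1 : Matrix m m ℝ)) (by simpa)]
  simp only [one_mulVec, Measure.map_id']
  apply le_of_eq
  congr 1
  have hd : A.det = ∏ i, l i := by simpa using hH.det_eq_prod_eigenvalues
  rw [hd, ← NNReal.coe_inj, Real.coe_toNNReal _ (by positivity),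
    Real.sqrt_prod _ fun i _ => (hl0 i).le]
  push_cast
  rw [Finset.prod_inv_distrib]
  congr 1
  refine Finset.prod_congr rfl fun i _ => ?_
  rw [Real.sq_sqrt (hl0 i).le, Real.coe_toNNReal _ (hl0 i).le]

/-! ### Large minors and domination of projected normal vectors. -/

section Minor

variable {ι r : Type*} [Fintype ι] [Fintype r] [DecidableEq r]

/-- Some maximal minor of `H` is large compared with the Gram determinant. -/
theorem exists_det_submatrix_ge (H : Matrix ι r ℝ) (hK : 0 < (Hᵀ * H).det) :
    ∃ f : r → ι, (Hᵀ * H).det ≤ (∏ j, ∑ α, |H α j|) * |(H.submatrix f id).det| := by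
  set T := ∏ j, ∑ α, |H α j|
  have hT : T = ∑ f : r → ι, ∏ j, |H (f j) j| := by
    simp only [T]
    rw [Finset.prod_univ_sum, Fintype.piFinset_univ]
  -- Each row of HᵀH is a combination of rows of H, and the determinant is expanded multilinearly.
  -- The absolute values of the weights sum to `T`, so not all minors can be smaller than the Gram
  -- determinant divided by `T`.
  have hdet : (Hᵀ * H).det = ∑ f : r → ι, (∏ j, H (f j) j) * (H.submatrix f id).det := by
    have h1 : (Hᵀ * H) = fun j => ∑ α, H α j • H α := by
      ext i j
      simp [Matrix.mul_apply]
    rw [h1]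
    change (detRowAlternating (R := ℝ) (n := r)).toMultilinearMap (fun j => ∑ α, H α j • H α) = _
    rw [MultilinearMap.map_sum]
    refine Finset.sum_congr rfl fun f _ => ?_
    rw [MultilinearMap.map_smul_univ, smul_eq_mul]
    rfl
  have hT0 : 0 < T := by
    by_contra h
    have h0 : T = 0 := le_antisymm (not_lt.1 h)
      (Finset.prod_nonneg fun j _ => Finset.sum_nonneg fun α _ => abs_nonneg _)
    rw [hT, Finset.sum_eq_zero_iff_of_nonneg fun f _ => Finset.prod_nonneg fun j _ => abs_nonneg _] at h0
    have : (Hᵀ * H).det = 0 := by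
      rw [hdet]
      refine Finset.sum_eq_zero fun f hf => ?_
      have := h0 f hf
      rw [← Finset.abs_prod, abs_eq_zero] at this
      rw [this, zero_mul]
    exact hK.ne' this
  by_contra! hcon
  have h1 : T * (Hᵀ * H).det ≤ ∑ f : r → ι, (∏ j, |H (f j) j|) * (T * |(H.submatrix f id).det|) := by
    calc T * (Hᵀ * H).det ≤ T * ∑ f : r → ι, |(∏ j, H (f j) j) * (H.submatrix f id).det| := by
          rw [hdet]
          exact mul_le_mul_of_nonneg_left (Finset.sum_le_sum fun f _ => le_abs_self _) hT0.le
      _ = _ := by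
          rw [Finset.mul_sum]
          refine Finset.sum_congr rfl fun f _ => ?_
          rw [abs_mul, Finset.abs_prod]
          ring
  have h2 : ∑ f : r → ι, (∏ j, |H (f j) j|) * (T * |(H.submatrix f id).det|) <
      ∑ f : r → ι, (∏ j, |H (f j) j|) * (Hᵀ * H).det := by
    refine Finset.sum_lt_sum (fun f _ => mul_le_mul_of_nonneg_left (hcon f).le
      (Finset.prod_nonneg fun j _ => abs_nonneg _)) ?_
    obtain ⟨f, hf, hf0⟩ := Finset.exists_ne_zero_of_sum_ne_zero (hT ▸ hT0.ne')
    exact ⟨f, hf, mul_lt_mul_of_pos_left (hcon f)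
      (lt_of_le_of_ne (Finset.prod_nonneg fun j _ => abs_nonneg _) hf0.symm)⟩
  rw [← Finset.sum_mul, ← hT] at h2
  exact absurd (h1.trans_lt h2) (lt_irrefl _)

variable [DecidableEq ι]

/-- Off a few coordinates, the projection of a standard normal vector away from the columns of `H`
is dominated by a standard normal vector. -/
theorem exists_stdNormal_residual_le (H : Matrix ι r ℝ) (hK : 0 < (Hᵀ * H).det) :
    ∃ S : Finset ι, S.card ≤ Fintype.card r ∧
      (stdNormal ι).map (fun v (α : {α // α ∉ S}) =>
          (((1 : Matrix ι ι ℝ) - H * (Hᵀ * H)⁻¹ * Hᵀ) *ᵥ v) (α : ι)) ≤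
        Real.toNNReal ((∏ j, ∑ α, |H α j|) / √(Hᵀ * H).det) • stdNormal {α // α ∉ S} := by
  obtain ⟨f, hf⟩ := exists_det_submatrix_ge H hK
  set K := Hᵀ * H with hKdef
  set T := ∏ j, ∑ α, |H α j|
  have hT0 : 0 ≤ T := Finset.prod_nonneg fun j _ => Finset.sum_nonneg fun α _ => abs_nonneg _
  have hf0 : (H.submatrix f id).det ≠ 0 := by
    intro h
    rw [h, abs_zero, mul_zero] at hf
    exact absurd hf (not_le.2 hK)
  have hinj : Function.Injective f := by
    intro i j hij
    by_contra hne
    exact hf0 (det_zero_of_row_eq hne (by ext k; simp [hij]))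
  have hKT : Kᵀ = K := by rw [hKdef, transpose_mul, transpose_transpose]
  have hKu : IsUnit K.det := hK.ne'.isUnit
  have hKpsd : K.PosSemidef := by
    simpa [conjTranspose_eq_transpose_of_trivial] using posSemidef_conjTranspose_mul_self H
  set Q := H * K⁻¹ * Hᵀ with hQ
  have hQT : Qᵀ = Q := by
    rw [hQ, transpose_mul, transpose_mul, transpose_transpose, transpose_nonsing_inv, hKT,
      Matrix.mul_assoc]
  have hQQ : Q * Q = Q := by
    calc Q * Q = H * (K⁻¹ * K) * K⁻¹ * Hᵀ := by simp only [hQ, hKdef, Matrix.mul_assoc]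
      _ = Q := by rw [nonsing_inv_mul _ hKu, Matrix.mul_one]
  have hR : (1 - Q) * (1 - Q)ᵀ = 1 - Q := by
    rw [transpose_sub, transpose_one, hQT, Matrix.sub_mul, Matrix.one_mul, Matrix.mul_sub, hQQ,
      Matrix.mul_one, sub_self, sub_zero]
  -- The coordinates discarded are the rows of a large minor. What remains has covariance 1 -
  -- H'K⁻¹H'ᵀ, where H' consists of the other rows of H.
  refine ⟨Finset.univ.image f, Finset.card_image_le, ?_⟩
  set S := Finset.univ.image f
  let M : Matrix {α // α ∉ S} ι ℝ := ((1 : Matrix ι ι ℝ) - Q).submatrix Subtype.val id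
  let H' : Matrix {α // α ∉ S} r ℝ := H.submatrix Subtype.val id
  have hMM : M * Mᵀ = 1 - H' * (K⁻¹ * H'ᵀ) := by
    have h1 : M * Mᵀ = ((1 - Q) * (1 - Q)ᵀ).submatrix Subtype.val Subtype.val := by
      ext i j; simp [M, Matrix.mul_apply]
    rw [h1, hR]
    ext i j
    simp [hQ, H', Matrix.mul_apply, Matrix.one_apply, Subtype.ext_iff, Finset.mul_sum,
      Finset.sum_mul, mul_assoc]
    exact Finset.sum_comm
  have hsplit : K - H'ᵀ * H' = (H.submatrix f id)ᵀ * H.submatrix f id := by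
    ext i j
    simp only [hKdef, H', Matrix.sub_apply, Matrix.mul_apply, transpose_apply, submatrix_apply, id]
    rw [← Finset.sum_image (s := Finset.univ) (g := f) (f := fun α => H α i * H α j)
      (fun a _ b _ h => hinj h)]
    have h2 : ∑ x : {α // α ∉ S}, H x i * H x j = ∑ α ∈ Sᶜ, H α i * H α j := by
      rw [← Finset.sum_subtype (Sᶜ) (fun x => by simp) fun α => H α i * H α j]
    rw [h2, ← Finset.sum_add_sum_compl S fun α => H α i * H α j]
    ring
  -- Sylvester's identity moves the determinant to the small side, where K - H'ᵀH' is the Gram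
  -- matrix of the discarded rows. A large minor thus bounds the covariance determinant from below.
  have hdetA : (M * Mᵀ).det = (H.submatrix f id).det ^ 2 / K.det := by
    rw [hMM, det_one_sub_mul_comm, Matrix.mul_assoc]
    have : (1 : Matrix r r ℝ) - K⁻¹ * (H'ᵀ * H') = K⁻¹ * ((H.submatrix f id)ᵀ * H.submatrix f id) := by
      rw [← hsplit, Matrix.mul_sub, nonsing_inv_mul _ hKu]
    rw [this, det_mul, det_mul, det_transpose, det_nonsing_inv, Ring.inverse_eq_inv']
    field_simp
  have hle := stdNormal_map_mulVec_le M (by rw [hdetA]; positivity) (by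
    intro t
    rw [hMM, Matrix.sub_mulVec, Matrix.one_mulVec, dotProduct_sub, sub_le_self_iff,
      ← Matrix.mul_assoc, ← mulVec_mulVec, ← mulVec_mulVec, dotProduct_mulVec, ← mulVec_transpose]
    have := hKpsd.inv.dotProduct_mulVec_nonneg (H'ᵀ *ᵥ t)
    simpa using this)
  have hc : Real.toNNReal (√(M * Mᵀ).det)⁻¹ ≤ Real.toNNReal (T / √K.det) := by
    refine Real.toNNReal_le_toNNReal ?_
    rw [hdetA, Real.sqrt_div (sq_nonneg _), Real.sqrt_sq_eq_abs, inv_div,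
      div_le_div_iff₀ (abs_pos.2 hf0) (Real.sqrt_pos.2 hK), Real.mul_self_sqrt hK.le]
    exact hf
  refine hle.trans (Measure.le_iff.2 fun s _ => ?_)
  simp only [Measure.smul_apply, ENNReal.smul_def, smul_eq_mul]
  gcongr

end Minor

end StdNormal

/-! ### Continuity of Gaussian laws in total variation -/

section GaussianTV

/-- The density of the normal law with mean `δ` and standard deviation `s`. -/
def normalDensity (p : ℝ × ℝ) (t : ℝ) : ℝ :=
  (√(2 * Real.pi * p.2 ^ 2))⁻¹ * Real.exp (-(t - p.1) ^ 2 / (2 * p.2 ^ 2))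

theorem measurable_normalDensity (p : ℝ × ℝ) : Measurable (normalDensity p) := by
  unfold normalDensity; fun_prop

theorem normalDensity_nonneg (p : ℝ × ℝ) (t : ℝ) : 0 ≤ normalDensity p t := by
  unfold normalDensity; positivity

theorem normalDensity_eq (δ s : ℝ) :
    normalDensity (δ, s) = gaussianPDFReal δ (Real.toNNReal (s ^ 2)) := by
  ext t
  simp [normalDensity, gaussianPDFReal, Real.coe_toNNReal _ (sq_nonneg s)]

theorem integrable_normalDensity (δ s : ℝ) : Integrable (normalDensity (δ, s)) := by
  rw [normalDensity_eq]; exact integrable_gaussianPDFReal _ _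

theorem continuousAt_normalDensity {s₀ : ℝ} (hs : 0 < s₀) (t : ℝ) :
    ContinuousAt (fun p => normalDensity p t) (0, s₀) := by
  unfold normalDensity
  refine ContinuousAt.mul (ContinuousAt.inv₀ (by fun_prop) ?_) (ContinuousAt.rexp ?_)
  · have : 0 < 2 * Real.pi * s₀ ^ 2 := by positivity
    exact (Real.sqrt_pos.2 this).ne'
  · refine ContinuousAt.div (by fun_prop) (by fun_prop) ?_
    simp only
    positivity

/-- Dominated convergence: near (0, s₀) the densities converge pointwise and share one Gaussian
majorant. -/
theorem tendsto_integral_abs_normalDensity_sub {s₀ : ℝ} (hs : 0 < s₀) :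
    Tendsto (fun p => ∫ t, |normalDensity p t - normalDensity (0, s₀) t|) (𝓝 (0, s₀)) (𝓝 0) := by
  have h0 : (0 : ℝ) = ∫ _ : ℝ, (0 : ℝ) := by simp
  conv => rhs; rw [h0]
  set c := (√(2 * Real.pi * (s₀ / 2) ^ 2))⁻¹ * Real.exp 1
  -- The majorant comes from (t - δ)² ≥ t²/2 - δ² and p.2 ∈ (s₀/2, 2s₀). The factor `exp 1`
  -- generously absorbs the error 1/8 in the exponent.
  have hbound : ∀ p : ℝ × ℝ, |p.1| < s₀ → s₀ / 2 < p.2 → p.2 < 2 * s₀ → ∀ t,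
      normalDensity p t ≤ c * Real.exp (-(1 / (16 * s₀ ^ 2)) * t ^ 2) := by
    intro p h1 h2 h3 t
    have hp : 0 < p.2 := by linarith
    rw [mul_assoc, ← Real.exp_add]
    unfold normalDensity
    refine mul_le_mul (inv_anti₀ (by positivity) (Real.sqrt_le_sqrt ?_)) (Real.exp_le_exp.2 ?_)
      (by positivity) (by positivity)
    · gcongr
    · have h4 : p.2 ^ 2 ≤ 4 * s₀ ^ 2 := by nlinarith
      have h5 : p.1 ^ 2 ≤ s₀ ^ 2 := by
        rw [← sq_abs p.1]; exact pow_le_pow_left₀ (abs_nonneg _) h1.le 2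
      have h6 : (t - p.1) ^ 2 / (8 * s₀ ^ 2) ≤ (t - p.1) ^ 2 / (2 * p.2 ^ 2) :=
        div_le_div_of_nonneg_left (sq_nonneg _) (by positivity) (by linarith)
      have h7 : t ^ 2 / 2 - s₀ ^ 2 ≤ (t - p.1) ^ 2 := by nlinarith [sq_nonneg (t - 2 * p.1)]
      have h8 : (t ^ 2 / 2 - s₀ ^ 2) / (8 * s₀ ^ 2) ≤ (t - p.1) ^ 2 / (8 * s₀ ^ 2) := by gcongr
      have h9 : (t ^ 2 / 2 - s₀ ^ 2) / (8 * s₀ ^ 2) = 1 / (16 * s₀ ^ 2) * t ^ 2 - 1 / 8 := by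
        field_simp; ring
      rw [neg_div]
      linarith
  refine tendsto_integral_filter_of_dominated_convergence
    (fun t => 2 * (c * Real.exp (-(1 / (16 * s₀ ^ 2)) * t ^ 2))) ?_ ?_ ?_ ?_
  · refine Eventually.of_forall fun p => ?_
    exact (((measurable_normalDensity p).sub (measurable_normalDensity _)).norm).aestronglyMeasurable
  · have e1 : ∀ᶠ p : ℝ × ℝ in 𝓝 (0, s₀), |p.1| < s₀ ∧ s₀ / 2 < p.2 ∧ p.2 < 2 * s₀ := by
      have t1 : Tendsto (fun p : ℝ × ℝ => |p.1|) (𝓝 (0, s₀)) (𝓝 0) := by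
        simpa using (continuous_fst.abs.tendsto ((0 : ℝ), s₀))
      have t2 : Tendsto (fun p : ℝ × ℝ => p.2) (𝓝 (0, s₀)) (𝓝 s₀) := continuous_snd.tendsto _
      exact (t1.eventually (gt_mem_nhds hs)).and ((t2.eventually (lt_mem_nhds (by linarith))).and
        (t2.eventually (gt_mem_nhds (by linarith))))
    filter_upwards [e1] with p hp
    refine ae_of_all _ fun t => ?_
    rw [Real.norm_eq_abs, abs_abs]
    have h1 := hbound p hp.1 hp.2.1 hp.2.2 t
    have h2 := hbound (0, s₀) (by simpa using hs) (by simp only; linarith) (by simp only; linarith) t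
    have h3 := normalDensity_nonneg p t
    have h4 := normalDensity_nonneg (0, s₀) t
    rw [abs_le]
    constructor <;> linarith
  · exact ((integrable_exp_neg_mul_sq (by positivity)).const_mul _).const_mul _
  · refine ae_of_all _ fun t => ?_
    have := ((continuousAt_normalDensity hs t).sub
      (continuousAt_const (y := normalDensity (0, s₀) t))).abs.tendsto
    simpa using this

theorem integral_comp_add_mul_gaussianReal {s : ℝ} (hs : 0 < s) (m : ℝ) {f : ℝ → ℝ}
    (hf : Measurable f) :
    ∫ t, f (m + s * t) ∂(gaussianReal 0 1) = ∫ t, normalDensity (m, s) t * f t := by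
  have h1 : (gaussianReal 0 1).map (fun t => m + s * t) = gaussianReal m (Real.toNNReal (s ^ 2)) := by
    have : (fun t => m + s * t) = (fun t => m + t) ∘ fun t => s * t := rfl
    rw [this, ← Measure.map_map (by fun_prop) (by fun_prop), gaussianReal_map_const_mul,
      gaussianReal_map_const_add]
    congr 1
    · simp
    · rw [← NNReal.coe_inj]; simp [Real.coe_toNNReal _ (sq_nonneg s)]
  rw [← integral_map (f := f) (φ := fun t => m + s * t) (by fun_prop) hf.aestronglyMeasurable, h1,
    integral_gaussianReal_eq_integral_smul (by simpa using hs.ne'), normalDensity_eq]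
  rfl

/-- Normal laws with nearby means and nearby standard deviations, bounded away from zero, are close
in total variation. -/
theorem exists_gaussianReal_integral_sub_le {s₀ : ℝ} (hs : 0 < s₀) {ε : ℝ} (hε : 0 < ε) :
    ∃ η > 0, ∀ m m' s : ℝ, |m - m'| < η → |s - s₀| < η → ∀ f : ℝ → ℝ, Measurable f → ∀ B,
      (∀ t, |f t| ≤ B) →
      |∫ t, f (m + s * t) ∂(gaussianReal 0 1) - ∫ t, f (m' + s₀ * t) ∂(gaussianReal 0 1)| ≤ B * ε := by
  have h := (Metric.tendsto_nhds.1 (tendsto_integral_abs_normalDensity_sub hs)) ε hε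
  obtain ⟨η, hη, hball⟩ := Metric.eventually_nhds_iff.1 h
  -- The bound by `s₀` keeps the nearby standard deviation positive.
  refine ⟨min η s₀, lt_min hη hs, fun m m' s h1 h2 f hf B hB => ?_⟩
  have hs' : 0 < s := by
    have := (abs_lt.1 (h2.trans_le (min_le_right _ _))).1
    linarith
  have hB0 : 0 ≤ B := (abs_nonneg _).trans (hB 0)
  have hd := hball (y := (m - m', s)) (by
    rw [Prod.dist_eq, Real.dist_eq, Real.dist_eq, sub_zero]
    exact max_lt (h1.trans_le (min_le_left _ _)) (h2.trans_le (min_le_left _ _)))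
  rw [Real.dist_eq, sub_zero, abs_of_nonneg (integral_nonneg fun t => abs_nonneg _)] at hd
  rw [integral_comp_add_mul_gaussianReal hs' m hf, integral_comp_add_mul_gaussianReal hs m' hf]
  have hi : ∀ m s : ℝ, Integrable (fun t => normalDensity (m, s) t * f t) := fun m s =>
    (integrable_normalDensity m s).mul_bdd (c := B) hf.aestronglyMeasurable (ae_of_all _ hB)
  rw [← integral_sub (hi _ _) (hi _ _)]
  -- Translation by m' reduces to the means m - m' and 0. This makes `η` uniform in the means, as is
  -- needed for rows with unbounded conditional means.
  have htrans : ∫ t, |normalDensity (m, s) t - normalDensity (m', s₀) t| =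
      ∫ t, |normalDensity (m - m', s) t - normalDensity (0, s₀) t| := by
    rw [← integral_sub_right_eq_self (fun t => |normalDensity (m - m', s) t - normalDensity (0, s₀) t|) m']
    refine integral_congr_ae (ae_of_all _ fun t => ?_)
    simp only [normalDensity, sub_zero]
    rw [show t - m' - (m - m') = t - m by ring]
  calc |∫ t, (normalDensity (m, s) t * f t - normalDensity (m', s₀) t * f t)|
      ≤ ∫ t, |normalDensity (m, s) t * f t - normalDensity (m', s₀) t * f t| :=
        abs_integral_le_integral_abs
    _ ≤ ∫ t, B * |normalDensity (m, s) t - normalDensity (m', s₀) t| := by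
        refine integral_mono ((hi _ _).sub (hi _ _)).abs
          (((integrable_normalDensity _ _).sub (integrable_normalDensity _ _)).abs.const_mul B)
          fun t => ?_
        simp only
        rw [← sub_mul, abs_mul, mul_comm]
        exact mul_le_mul_of_nonneg_right (hB t) (abs_nonneg _)
    _ = B * ∫ t, |normalDensity (m - m', s) t - normalDensity (0, s₀) t| := by
        rw [integral_const_mul, htrans]
    _ ≤ B * ε := mul_le_mul_of_nonneg_left hd.le hB0

end GaussianTV

/-! ### Adjoining a conditionally Gaussian coordinate -/

section GaussianStep

open Matrix

variable {Ω : ℕ → Type*} [∀ n, MeasurableSpace (Ω n)] {μ : ∀ n, Measure (Ω n)}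
  {𝓧 : Type*} [MeasurableSpace 𝓧]

/-- The matrix with columns `(h j (x α))_α`. -/
def design {n : ℕ} {r : Type*} (h : r → 𝓧 → ℝ) (x : Fin n → 𝓧) : Matrix (Fin n) r ℝ :=
  Matrix.of fun α j => h j (x α)

/-- The empirical Gram matrix of the functions `h j`. -/
def empGram {n : ℕ} {r : Type*} (h : r → 𝓧 → ℝ) (x : Fin n → 𝓧) : Matrix r r ℝ :=
  Matrix.of fun i j => avg fun α => h i (x α) * h j (x α)

/-- The Gram matrix of the functions `h j` under `Λ`. -/
def limGram {r : Type*} (Λ : Measure 𝓧) (h : r → 𝓧 → ℝ) : Matrix r r ℝ :=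
  Matrix.of fun i j => ∫ z, h i z * h j z ∂Λ

/-- Given the rows `X`, the vector `G` is Gaussian with mean `m` and with covariance `s²` times the
projection `R` away from the vectors `h j (X ·)`; moreover `m` is asymptotically the function `m₀` of
the rows, and `s` converges to `s₀`. -/
structure GaussianStep {r : Type*} [Fintype r] [DecidableEq r] (μ : ∀ n, Measure (Ω n))
    (X : ∀ n, Ω n → Fin n → 𝓧) (Λ : Measure 𝓧) (G : ∀ n, Ω n → Fin n → ℝ)
    (m : ∀ n, (Fin n → 𝓧) → Fin n → ℝ) (s : ∀ n, (Fin n → 𝓧) → ℝ)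
    (R : ∀ n, (Fin n → 𝓧) → Matrix (Fin n) (Fin n) ℝ) (h : r → 𝓧 → ℝ) (m₀ : 𝓧 → ℝ) (s₀ : ℝ) :
    Prop where
  lln : LLN μ X Λ
  X_meas : ∀ n, Measurable (X n)
  G_meas : ∀ n, Measurable (G n)
  m_meas : ∀ n, Measurable (m n)
  s_meas : ∀ n, Measurable (s n)
  R_meas : ∀ n α β, Measurable fun x => R n x α β
  h_meas : ∀ j, Measurable (h j)
  m₀_meas : Measurable m₀
  law : ∀ n, (μ n).map (fun ω => (X n ω, G n ω)) =
    ((μ n).prod (stdNormal (Fin n))).map fun p =>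
      (X n p.1, fun α => m n (X n p.1) α + s n (X n p.1) * (R n (X n p.1) *ᵥ p.2) α)
  m_bdd : BddMoments μ fun p => m p.1 (X p.1 p.2)
  m_lim : Tendsto (fun p : Σ n, Ω n => avg fun α => |m p.1 (X p.1 p.2) α - m₀ (X p.1 p.2 α)|)
    (complete μ) (𝓝 0)
  s_lim : Tendsto (fun p : Σ n, Ω n => s p.1 (X p.1 p.2)) (complete μ) (𝓝 s₀)
  s_pos : 0 < s₀
  h_bdd : ∀ j, BddMoments μ fun p α => h j (X p.1 p.2 α)
  gram_det : (limGram Λ h).det ≠ 0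
  R_eq : ∀ᶠ p : Σ n, Ω n in complete μ, R p.1 (X p.1 p.2) =
    1 - design h (X p.1 p.2) * ((design h (X p.1 p.2))ᵀ * design h (X p.1 p.2))⁻¹ *
      (design h (X p.1 p.2))ᵀ

/-! ### Convergence of empirical Gram matrices. -/

section Gram

variable {r : Type*} {X : ∀ n, Ω n → Fin n → 𝓧} {Λ : Measure 𝓧} {h : r → 𝓧 → ℝ}

omit [MeasurableSpace 𝓧] in
theorem design_transpose_mul {n : ℕ} (hn : 0 < n) (x : Fin n → 𝓧) :
    (design h x)ᵀ * design h x = (n : ℝ) • empGram h x := by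
  have : (n : ℝ) ≠ 0 := by positivity
  ext i j
  simp [design, empGram, Matrix.mul_apply, avg, this]

omit [MeasurableSpace 𝓧] in
theorem empGram_posSemidef [Fintype r] {n : ℕ} (x : Fin n → 𝓧) : (empGram h x).PosSemidef := by
  have h1 : empGram h x = (n : ℝ)⁻¹ • ((design h x)ᵀ * design h x) := by
    ext i j
    simp [design, empGram, Matrix.mul_apply, avg]
  rw [h1]
  have := posSemidef_conjTranspose_mul_self (design h x)
  rw [conjTranspose_eq_transpose_of_trivial] at this
  exact this.smul (by positivity)

variable [∀ n, IsProbabilityMeasure (μ n)] [IsProbabilityMeasure Λ]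

theorem tendsto_empGram (hl : LLN μ X Λ) (hm : ∀ j, Measurable (h j))
    (hb : ∀ j, BddMoments μ fun p α => h j (X p.1 p.2 α)) :
    Tendsto (fun p : Σ n, Ω n => empGram h (X p.1 p.2)) (complete μ) (𝓝 (limGram Λ h)) := by
  refine tendsto_pi_nhds.2 fun i => tendsto_pi_nhds.2 fun j => ?_
  exact hl.tendsto_avg ((hm i).mul (hm j)) ((hb i).mul (hb j))

variable [Fintype r] [DecidableEq r]

/-- The determinant is a limit of nonnegative determinants of empirical Gram matrices. -/
theorem limGram_det_pos (hl : LLN μ X Λ) (hm : ∀ j, Measurable (h j))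
    (hb : ∀ j, BddMoments μ fun p α => h j (X p.1 p.2 α)) (hd : (limGram Λ h).det ≠ 0) :
    0 < (limGram Λ h).det := by
  refine lt_of_le_of_ne ?_ hd.symm
  have h1 : Tendsto (fun p : Σ n, Ω n => (empGram h (X p.1 p.2)).det) (complete μ)
      (𝓝 (limGram Λ h).det) :=
    ((continuous_id.matrix_det).tendsto _).comp (tendsto_empGram hl hm hb)
  exact ge_of_tendsto h1 (Eventually.of_forall fun p => (empGram_posSemidef _).det_nonneg)

theorem tendsto_empGram_inv (hl : LLN μ X Λ) (hm : ∀ j, Measurable (h j))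
    (hb : ∀ j, BddMoments μ fun p α => h j (X p.1 p.2 α)) (hd : (limGram Λ h).det ≠ 0) :
    Tendsto (fun p : Σ n, Ω n => (empGram h (X p.1 p.2))⁻¹) (complete μ)
      (𝓝 (limGram Λ h)⁻¹) := by
  have hg := tendsto_empGram hl hm hb
  have h1 : Tendsto (fun p : Σ n, Ω n => (empGram h (X p.1 p.2)).det) (complete μ)
      (𝓝 (limGram Λ h).det) := ((continuous_id.matrix_det).tendsto _).comp hg
  have h2 : Tendsto (fun p : Σ n, Ω n => (empGram h (X p.1 p.2)).adjugate) (complete μ)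
      (𝓝 (limGram Λ h).adjugate) := ((continuous_id.matrix_adjugate).tendsto _).comp hg
  simp only [Matrix.inv_def, Ring.inverse_eq_inv']
  exact (h1.inv₀ hd).smul h2

end Gram

namespace GaussianStep

variable {r : Type*} [Fintype r] [DecidableEq r]
  {X : ∀ n, Ω n → Fin n → 𝓧} {Λ : Measure 𝓧} {G : ∀ n, Ω n → Fin n → ℝ}
  {m : ∀ n, (Fin n → 𝓧) → Fin n → ℝ} {s : ∀ n, (Fin n → 𝓧) → ℝ}
  {R : ∀ n, (Fin n → 𝓧) → Matrix (Fin n) (Fin n) ℝ} {h : r → 𝓧 → ℝ} {m₀ : 𝓧 → ℝ} {s₀ : ℝ}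

/-- The Gaussian vector with the conditional law of `G` given the rows `x`. -/
def sample (m : ∀ n, (Fin n → 𝓧) → Fin n → ℝ) (s : ∀ n, (Fin n → 𝓧) → ℝ)
    (R : ∀ n, (Fin n → 𝓧) → Matrix (Fin n) (Fin n) ℝ) {n : ℕ} (x : Fin n → 𝓧) (v : Fin n → ℝ) :
    Fin n → ℝ := fun α => m n x α + s n x * (R n x *ᵥ v) α

theorem measurable_sample (H : GaussianStep μ X Λ G m s R h m₀ s₀) (n : ℕ) :
    Measurable fun p : (Fin n → 𝓧) × (Fin n → ℝ) => sample m s R p.1 p.2 := by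
  refine measurable_pi_lambda _ fun α => ?_
  refine (((measurable_pi_apply α).comp (H.m_meas n)).comp measurable_fst).add
    (((H.s_meas n).comp measurable_fst).mul ?_)
  change Measurable fun c : (Fin n → 𝓧) × (Fin n → ℝ) => ∑ β, R n c.1 α β * c.2 β
  refine Finset.measurable_sum _ fun β _ => ((H.R_meas n α β).comp measurable_fst).mul ?_
  exact (measurable_pi_apply β).comp measurable_snd

variable [∀ n, IsProbabilityMeasure (μ n)] [IsProbabilityMeasure Λ]

omit [IsProbabilityMeasure Λ] in
-- Fubini for the conditional law in `law`: if, for rows in the good set `Q n`, the conditional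
-- probability of a bad event is at most a summable `b n`, then the bad event eventually does not
-- occur. All three conclusions about the new coordinate (averages, null sets, moments) are obtained
-- in this way.
theorem eventually_notMem (H : GaussianStep μ X Λ G m s R h m₀ s₀)
    {B : ∀ n, Set ((Fin n → 𝓧) × (Fin n → ℝ))} (hB : ∀ n, MeasurableSet (B n))
    {Q : ∀ n, Set (Fin n → 𝓧)} (hQ : ∀ᶠ p : Σ n, Ω n in complete μ, X p.1 p.2 ∈ Q p.1)
    {b : ℕ → ENNReal} (hb : ∑' n, b n ≠ ⊤)
    (hle : ∀ n, ∀ x ∈ Q n, stdNormal (Fin n) {v | (x, sample m s R x v) ∈ B n} ≤ b n) :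
    ∀ᶠ p : Σ n, Ω n in complete μ, (X p.1 p.2, G p.1 p.2) ∉ B p.1 := by
  refine eventually_complete_of_le hb hQ fun n => ?_
  have hS : Measurable fun p : (Fin n → 𝓧) × (Fin n → ℝ) => (p.1, sample m s R p.1 p.2) :=
    measurable_fst.prodMk (H.measurable_sample n)
  -- `Q n` need not be measurable. It is replaced by the measurable set of all rows for which the
  -- conditional bound holds.
  let Q' : Set (Fin n → 𝓧) := {x | stdNormal (Fin n) {v | (x, sample m s R x v) ∈ B n} ≤ b n}
  have hQ' : MeasurableSet Q' :=
    measurableSet_le (measurable_measure_prodMk_left (hS (hB n))) measurable_const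
  have hE : MeasurableSet ((Prod.fst ⁻¹' Q') ∩ B n) := (measurable_fst hQ').inter (hB n)
  have hXm := H.X_meas n
  have hpm : Measurable fun p : Ω n × (Fin n → ℝ) => (X n p.1, sample m s R (X n p.1) p.2) :=
    hS.comp ((hXm.comp measurable_fst).prodMk measurable_snd)
  calc μ n {ω | X n ω ∈ Q n ∧ ¬ (X n ω, G n ω) ∉ B n}
      ≤ μ n ((fun ω => (X n ω, G n ω)) ⁻¹' ((Prod.fst ⁻¹' Q') ∩ B n)) :=
        measure_mono fun ω hω => ⟨hle n _ hω.1, not_not.1 hω.2⟩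
    _ = ((μ n).prod (stdNormal (Fin n)))
        ((fun p => (X n p.1, sample m s R (X n p.1) p.2)) ⁻¹' ((Prod.fst ⁻¹' Q') ∩ B n)) := by
        rw [← Measure.map_apply (hXm.prodMk (H.G_meas n)) hE, H.law n, ← Measure.map_apply hpm hE]
        rfl
    _ ≤ b n := by
        rw [Measure.prod_apply (hpm hE)]
        calc _ ≤ ∫⁻ _, b n ∂μ n := by
              refine lintegral_mono fun ω => ?_
              by_cases hω : X n ω ∈ Q'
              · refine le_trans (measure_mono fun v hv => ?_) hω
                exact hv.2
              · have : Prod.mk ω ⁻¹' ((fun p : Ω n × (Fin n → ℝ) =>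
                    (X n p.1, sample m s R (X n p.1) p.2)) ⁻¹' (Prod.fst ⁻¹' Q' ∩ B n)) = ∅ := by
                  ext v
                  simp only [Set.mem_preimage, Set.mem_inter_iff, Set.mem_empty_iff_false, iff_false,
                    not_and]
                  exact fun h => absurd h hω
                rw [this]; simp
          _ = b n := by simp

/-- The limit law of the rows together with the new coordinate. -/
def limit (Λ : Measure 𝓧) (m₀ : 𝓧 → ℝ) (s₀ : ℝ) : Measure (𝓧 × ℝ) :=
  (Λ.prod (gaussianReal 0 1)).map fun p => (p.1, m₀ p.1 + s₀ * p.2)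

theorem measurable_limit_map (hm₀ : Measurable m₀) :
    Measurable fun p : 𝓧 × ℝ => (p.1, m₀ p.1 + s₀ * p.2) := by fun_prop

/-! #### Null sets -/

/-- The diagonal entries of the projection onto the span of the `h j` are n⁻¹ ∑ hᵢ(x_α) (G⁻¹)ᵢⱼ
hⱼ(x_α), with G the empirical Gram matrix. Bounding one summand of the fourth empirical moment by
the whole sum gives hⱼ(x_α)² = O(√n), so these entries are O(n^(-1/2)) uniformly in α. Hence no
coordinate of R v degenerates. -/
theorem eventually_R_diag_ne (H : GaussianStep μ X Λ G m s R h m₀ s₀) :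
    ∀ᶠ p : Σ n, Ω n in complete μ, ∀ α, R p.1 (X p.1 p.2) α α ≠ 0 := by
  have hinv := tendsto_empGram_inv H.lln H.h_meas H.h_bdd H.gram_det
  have hent : ∀ i j, ∀ᶠ p : Σ n, Ω n in complete μ,
      |(empGram h (X p.1 p.2))⁻¹ i j| ≤ |(limGram Λ h)⁻¹ i j| + 1 := fun i j =>
    ((((tendsto_pi_nhds.1 (tendsto_pi_nhds.1 hinv i) j)).abs).eventually
      (gt_mem_nhds (lt_add_one _))).mono fun p hp => hp.le
  choose C hC using fun j => H.h_bdd j 4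
  set A := ∑ i, ∑ j, (|(limGram Λ h)⁻¹ i j| + 1)
  set D := ∑ j, |C j|
  have hA : 0 ≤ A := Finset.sum_nonneg fun i _ => Finset.sum_nonneg fun j _ => by positivity
  have hD : 0 ≤ D := Finset.sum_nonneg fun j _ => abs_nonneg _
  have hlarge : ∀ᶠ p : Σ n, Ω n in complete μ, A * √D < √(p.1 : ℝ) ∧ 0 < p.1 := by
    refine eventually_fst_complete (p := fun n => A * √D < √(n : ℝ) ∧ 0 < n) ?_
    exact ((Real.tendsto_sqrt_atTop.comp tendsto_natCast_atTop_atTop).eventually_gt_atTop _).and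
      (eventually_gt_atTop 0)
  filter_upwards [H.R_eq, eventually_all.2 fun i => eventually_all.2 (hent i), eventually_all.2 hC,
    hlarge] with p hR hE hM hn
  set n := p.1
  set x := X p.1 p.2
  intro α
  have hn0 : (0 : ℝ) < n := by exact_mod_cast hn.2
  have hsq : ∀ j, |h j (x α)| ^ 2 ≤ √(n * D) := by
    intro j
    refine Real.le_sqrt_of_sq_le ?_
    rw [← pow_mul]
    have h1 := hM j
    have h2 : |h j (x α)| ^ 4 ≤ ∑ α, |h j (x α)| ^ 4 :=
      Finset.single_le_sum (f := fun α => |h j (x α)| ^ 4) (fun _ _ => by positivity)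
        (Finset.mem_univ α)
    have h3 : C j ≤ D := (le_abs_self _).trans
      (Finset.single_le_sum (f := fun j => |C j|) (fun _ _ => abs_nonneg _) (Finset.mem_univ j))
    rw [avg, inv_mul_le_iff₀ hn0] at h1
    calc _ ≤ _ := h2
      _ ≤ n * C j := h1
      _ ≤ n * D := by gcongr
  have hP : (design h x * ((design h x)ᵀ * design h x)⁻¹ * (design h x)ᵀ) α α =
      (n : ℝ)⁻¹ * ∑ i, ∑ j, h i (x α) * (empGram h x)⁻¹ i j * h j (x α) := by
    have hinv : ((n : ℝ) • empGram h x)⁻¹ = (n : ℝ)⁻¹ • (empGram h x)⁻¹ := by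
      by_cases hu : IsUnit (empGram h x).det
      · let _ := invertibleOfNonzero hn0.ne'
        rw [Matrix.inv_smul _ _ hu]
        simp
      · have hu' : ¬ IsUnit ((n : ℝ) • empGram h x).det := by
          rw [det_smul]
          intro h
          exact hu (isUnit_of_mul_isUnit_right h)
        rw [nonsing_inv_apply_not_isUnit _ hu, nonsing_inv_apply_not_isUnit _ hu']
        simp
    rw [design_transpose_mul hn.2, hinv]
    simp only [Matrix.mul_apply, design, Matrix.smul_apply, Matrix.transpose_apply, Matrix.of_apply,
      smul_eq_mul, Finset.mul_sum, Finset.sum_mul]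
    rw [Finset.sum_comm]
    refine Finset.sum_congr rfl fun i _ => Finset.sum_congr rfl fun j _ => by ring
  have hlt : |(design h x * ((design h x)ᵀ * design h x)⁻¹ * (design h x)ᵀ) α α| < 1 := by
    rw [hP, abs_mul, abs_of_pos (inv_pos.2 hn0)]
    calc (n : ℝ)⁻¹ * |∑ i, ∑ j, h i (x α) * (empGram h x)⁻¹ i j * h j (x α)|
        ≤ (n : ℝ)⁻¹ * ∑ i, ∑ j, (|(limGram Λ h)⁻¹ i j| + 1) * √(n * D) := by
          refine mul_le_mul_of_nonneg_left ?_ (by positivity)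
          refine (Finset.abs_sum_le_sum_abs _ _).trans (Finset.sum_le_sum fun i _ => ?_)
          refine (Finset.abs_sum_le_sum_abs _ _).trans (Finset.sum_le_sum fun j _ => ?_)
          rw [abs_mul, abs_mul]
          have h1 : |h i (x α)| * |h j (x α)| ≤ √(n * D) := by
            nlinarith [hsq i, hsq j, sq_nonneg (|h i (x α)| - |h j (x α)|)]
          calc _ = |(empGram h x)⁻¹ i j| * (|h i (x α)| * |h j (x α)|) := by ring
            _ ≤ _ := mul_le_mul (hE i j) h1 (by positivity) (by positivity)
      _ = (n : ℝ)⁻¹ * (A * √D * √n) := by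
          simp only [← Finset.sum_mul, A]
          rw [Real.sqrt_mul hn0.le]; ring
      _ < (n : ℝ)⁻¹ * (√n * √n) := by
          have : 0 < √(n : ℝ) := Real.sqrt_pos.2 hn0
          refine mul_lt_mul_of_pos_left (mul_lt_mul_of_pos_right hn.1 this) (inv_pos.2 hn0)
      _ = 1 := by rw [Real.mul_self_sqrt hn0.le, inv_mul_cancel₀ hn0.ne']
  rw [hR, Matrix.sub_apply, Matrix.one_apply_eq]
  have := (abs_lt.1 hlt).2
  exact (sub_pos.2 this).ne'

/-- By Fubini, Λ-almost every section of `N` is Lebesgue null, and the rows avoid the exceptional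
set by the hypothesis on `X`. Each coordinate of `G` is conditionally a nondegenerate normal
variable and misses a null section almost surely. The conditional probabilities are exactly zero, so
the summable bound is `0`. -/
theorem null (H : GaussianStep μ X Λ G m s R h m₀ s₀) {N : Set (𝓧 × ℝ)} (hN : MeasurableSet N)
    (h0 : limit Λ m₀ s₀ N = 0) :
    ∀ᶠ p : Σ n, Ω n in complete μ, ∀ α, (X p.1 p.2 α, G p.1 p.2 α) ∉ N := by
  -- A nondegenerate normal law is equivalent to Lebesgue measure. Negligibility of a section
  -- therefore does not depend on the mean and the variance, which differ between finite width and
  -- the limit.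
  have hlin : ∀ c d : ℝ, ∀ v : ℝ≥0, d ≠ 0 → v ≠ 0 → (gaussianReal 0 v).map (fun t => c + d * t) ≪
      volume ∧ volume ≪ (gaussianReal 0 v).map (fun t => c + d * t) := by
    intro c d v hd hv
    have : (fun t : ℝ => c + d * t) = (fun t => c + t) ∘ fun t => d * t := rfl
    have hv' : NNReal.mk (d ^ 2) (sq_nonneg d) * v ≠ 0 := by
      refine mul_ne_zero (fun h => ?_) hv
      have := congrArg NNReal.toReal h
      exact hd (by simpa using this)
    rw [this, ← Measure.map_map (by fun_prop) (by fun_prop), gaussianReal_map_const_mul,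
      gaussianReal_map_const_add]
    exact ⟨gaussianReal_absolutelyContinuous _ hv', gaussianReal_absolutelyContinuous' _ hv'⟩
  let N' : Set 𝓧 := {z | volume (Prod.mk z ⁻¹' N) ≠ 0}
  have hN'm : MeasurableSet N' :=
    (measurable_measure_prodMk_left hN) (measurableSet_singleton (0 : ENNReal)).compl
  have hN'0 : Λ N' = 0 := by
    rw [limit, Measure.map_apply (measurable_limit_map H.m₀_meas) hN,
      Measure.measure_prod_null (measurable_limit_map H.m₀_meas hN)] at h0
    refine measure_mono_null (fun z hz => ?_) h0
    intro hz0
    refine hz ((hlin (m₀ z) s₀ 1 H.s_pos.ne' one_ne_zero).2 ?_)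
    rw [Measure.map_apply (by fun_prop) (measurable_prodMk_left hN)]
    exact hz0
  let B : ∀ n, Set ((Fin n → 𝓧) × (Fin n → ℝ)) := fun n => {p | ∃ α, (p.1 α, p.2 α) ∈ N}
  have hB : ∀ n, MeasurableSet (B n) := by
    intro n
    have : B n = ⋃ α, (fun p : (Fin n → 𝓧) × (Fin n → ℝ) => (p.1 α, p.2 α)) ⁻¹' N := by
      ext p; simp [B]
    rw [this]
    exact MeasurableSet.iUnion fun α => (by fun_prop : Measurable fun p :
      (Fin n → 𝓧) × (Fin n → ℝ) => (p.1 α, p.2 α)) hN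
  let Q : ∀ n, Set (Fin n → 𝓧) := fun n =>
    {x | (∀ α, x α ∉ N') ∧ s n x ≠ 0 ∧ ∀ α, R n x α α ≠ 0}
  have hQ : ∀ᶠ p : Σ n, Ω n in complete μ, X p.1 p.2 ∈ Q p.1 := by
    filter_upwards [H.lln.null N' hN'm hN'0, H.s_lim.eventually (lt_mem_nhds H.s_pos),
      H.eventually_R_diag_ne] with p h1 h2 h3
    exact ⟨h1, h2.ne', h3⟩
  have := H.eventually_notMem hB hQ (b := 0) (by simp) (by
    rintro n x ⟨h1, h2, h3⟩
    refine le_of_eq ?_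
    have : {v | (x, sample m s R x v) ∈ B n} = ⋃ α, {v | (x α, sample m s R x v α) ∈ N} := by
      ext v; simp [B]
    rw [this]
    refine (measure_iUnion_null_iff).2 fun α => ?_
    have hx : volume (Prod.mk (x α) ⁻¹' N) = 0 := not_not.1 (h1 α)
    have hv : Real.toNNReal (∑ β, R n x α β ^ 2) ≠ 0 := by
      have : R n x α α ^ 2 ≤ ∑ β, R n x α β ^ 2 :=
        Finset.single_le_sum (f := fun β => R n x α β ^ 2) (fun _ _ => sq_nonneg _)
          (Finset.mem_univ α)
      have h4 := h3 α
      simp only [ne_eq, Real.toNNReal_eq_zero, not_le]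
      exact lt_of_lt_of_le (by positivity) this
    have hac := (hlin (m n x α) (s n x) _ h2 hv).1 hx
    rw [← stdNormal_map_dotProduct, Measure.map_map (by fun_prop) (by fun_prop),
      Measure.map_apply (by fun_prop) (measurable_prodMk_left hN)] at hac
    exact hac)
  filter_upwards [this] with p hp α hα
  exact hp ⟨α, hα⟩

end GaussianStep

end GaussianStep

/-! ### Averages and moments of a conditionally Gaussian coordinate. -/

section GaussianStep

open Matrix

variable {Ω : ℕ → Type*} [∀ n, MeasurableSpace (Ω n)] {μ : ∀ n, Measure (Ω n)}
  {𝓧 : Type*} [MeasurableSpace 𝓧]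

namespace GaussianStep

variable {r : Type*} [Fintype r] [DecidableEq r]
  {X : ∀ n, Ω n → Fin n → 𝓧} {Λ : Measure 𝓧} {G : ∀ n, Ω n → Fin n → ℝ}
  {m : ∀ n, (Fin n → 𝓧) → Fin n → ℝ} {s : ∀ n, (Fin n → 𝓧) → ℝ}
  {R : ∀ n, (Fin n → 𝓧) → Matrix (Fin n) (Fin n) ℝ} {h : r → 𝓧 → ℝ} {m₀ : 𝓧 → ℝ} {s₀ : ℝ}
  [∀ n, IsProbabilityMeasure (μ n)] [IsProbabilityMeasure Λ]

/-! #### Bounded test functions -/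

omit [∀ n, IsProbabilityMeasure (μ n)] [IsProbabilityMeasure Λ] in
theorem measurable_condMean (H : GaussianStep μ X Λ G m s R h m₀ s₀) {ψ : 𝓧 × ℝ → ℝ}
    (hψ : Measurable ψ) (n : ℕ) (α : Fin n) :
    Measurable fun x : Fin n → 𝓧 => ∫ t, ψ (x α, m n x α + s n x * t) ∂(gaussianReal 0 1) := by
  have hm : Measurable fun x => m n x α := (measurable_pi_apply α).comp (H.m_meas n)
  have hs := H.s_meas n
  have : Measurable fun p : (Fin n → 𝓧) × ℝ => ψ (p.1 α, m n p.1 α + s n p.1 * p.2) := by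
    refine hψ.comp (Measurable.prodMk (by fun_prop) ?_)
    exact (hm.comp measurable_fst).add ((hs.comp measurable_fst).mul measurable_snd)
  exact this.stronglyMeasurable.integral_prod_right'.measurable

omit [MeasurableSpace 𝓧] in
/-- The Gram determinant bounds the constant by which the projected normal vector is dominated. -/
theorem domination_const_le {n : ℕ} (hn : 0 < n) {x : Fin n → 𝓧} {c C : ℝ} (hc : 0 < c)
    (hdet : c ≤ (empGram h x).det) (hC : ∀ j, avg (fun α => |h j (x α)|) ≤ C) :
    (∏ j, ∑ α, |design h x α j|) / √((design h x)ᵀ * design h x).det ≤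
      (n : ℝ) ^ Fintype.card r * (C ^ Fintype.card r / √c) := by
  have hn0 : (0 : ℝ) < n := by exact_mod_cast hn
  have h1 : (∏ j, ∑ α, |design h x α j|) ≤ (n : ℝ) ^ Fintype.card r * C ^ Fintype.card r := by
    rw [← mul_pow]
    refine (Finset.prod_le_prod (fun j _ => Finset.sum_nonneg fun α _ => abs_nonneg _)
      fun j _ => ?_).trans_eq (by rw [Finset.prod_const, Finset.card_univ])
    have := hC j
    rw [avg, inv_mul_le_iff₀ hn0] at this
    exact this
  have h2 : c ≤ ((design h x)ᵀ * design h x).det := by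
    rw [design_transpose_mul hn, det_smul]
    have : (1 : ℝ) ≤ (n : ℝ) ^ Fintype.card r := one_le_pow₀ (by exact_mod_cast hn)
    nlinarith
  have h3 : 0 ≤ ∏ j, ∑ α, |design h x α j| :=
    Finset.prod_nonneg fun j _ => Finset.sum_nonneg fun α _ => abs_nonneg _
  rw [← mul_div_assoc]
  exact div_le_div₀ (h3.trans h1) h1 (Real.sqrt_pos.2 hc) (Real.sqrt_le_sqrt h2)

omit [MeasurableSpace 𝓧] in
-- Hoeffding's inequality on the coordinates outside the exceptional set, at the price of the
-- domination constant, which is polynomial in n. The exceptional coordinates, at most `Fintype.card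
-- r` many, contribute at most 2B·card r to the sum; the lower bound on n makes this at most half of
-- εn.
theorem stdNormal_avg_sub_gt_le {n : ℕ} {x : Fin n → 𝓧} {A : Matrix (Fin n) (Fin n) ℝ}
    (hA : A = 1 - design h x * ((design h x)ᵀ * design h x)⁻¹ * (design h x)ᵀ)
    {c C : ℝ} (hc : 0 < c) (hdet : c ≤ (empGram h x).det)
    (hC : ∀ j, avg (fun α => |h j (x α)|) ≤ C)
    {f : Fin n → ℝ → ℝ} (hf : ∀ α, Measurable (f α)) {B : ℝ} (hB0 : 0 < B) (hB : ∀ α t, |f α t| ≤ B)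
    {ε : ℝ} (hε : 0 < ε) (hn : 4 * B * Fintype.card r ≤ ε * n) (hnr : Fintype.card r < n) :
    stdNormal (Fin n) {v | ε < |avg (fun α => f α ((A *ᵥ v) α)) -
        avg fun α => ∫ t, f α t ∂(gaussianReal 0 1)|} ≤
      ENNReal.ofReal ((C ^ Fintype.card r / √c * 2) *
        ((n : ℝ) ^ Fintype.card r * Real.exp (-(ε ^ 2 / (8 * B ^ 2)) * n))) := by
  have hn' : 0 < n := by omega
  have hn0 : (0 : ℝ) < n := by exact_mod_cast hn'
  have hdetpos : 0 < ((design h x)ᵀ * design h x).det := by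
    rw [design_transpose_mul hn', det_smul]
    exact mul_pos (by positivity) (hc.trans_le hdet)
  obtain ⟨S, hS, hdom⟩ := exists_stdNormal_residual_le (design h x) hdetpos
  rw [← hA] at hdom
  let e : Fin n → ℝ := fun α => ∫ t, f α t ∂(gaussianReal 0 1)
  have he : ∀ α, |e α| ≤ B := fun α => by
    have := norm_integral_le_of_norm_le_const (μ := gaussianReal 0 1) (f := f α) (C := B)
      (ae_of_all _ fun t => hB α t)
    simpa using this
  let E : Set ({α // α ∉ S} → ℝ) := {w | ε * n / 2 ≤ |∑ α : {α // α ∉ S}, (f α (w α) - e α)|}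
  have hE : MeasurableSet E := by
    refine measurableSet_le measurable_const ?_
    refine (Finset.measurable_sum _ fun α _ => ?_).abs
    exact ((hf α).comp (measurable_pi_apply α)).sub_const _
  have hsub : {v : Fin n → ℝ | ε < |avg (fun α => f α ((A *ᵥ v) α)) - avg e|} ⊆
      (fun v (α : {α // α ∉ S}) => (A *ᵥ v) (α : Fin n)) ⁻¹' E := by
    intro v hv
    simp only [Set.mem_ofPred_eq, ← avg_sub] at hv
    simp only [Set.mem_preimage, E, Set.mem_ofPred_eq]
    set g : Fin n → ℝ := fun α => f α ((A *ᵥ v) α) - e α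
    have hg : ∀ α, |g α| ≤ 2 * B := fun α => by
      have := abs_sub (f α ((A *ᵥ v) α)) (e α)
      linarith [hB α ((A *ᵥ v) α), he α]
    have h1 : ∑ α : {α // α ∉ S}, g α = ∑ α ∈ Sᶜ, g α := by
      rw [← Finset.sum_subtype (Sᶜ) (fun x => by simp) g]
    rw [avg, abs_mul, abs_of_pos (inv_pos.2 hn0), lt_inv_mul_iff₀ hn0] at hv
    have h2 : |∑ α, g α| ≤ |∑ α ∈ S, g α| + |∑ α ∈ Sᶜ, g α| := by
      rw [← Finset.sum_add_sum_compl S g]; exact abs_add_le _ _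
    have h3 : |∑ α ∈ S, g α| ≤ Fintype.card r * (2 * B) := by
      refine (Finset.abs_sum_le_sum_abs _ _).trans ?_
      refine (Finset.sum_le_card_nsmul S _ (2 * B) fun α _ => hg α).trans ?_
      rw [nsmul_eq_mul]
      have : (S.card : ℝ) ≤ Fintype.card r := by exact_mod_cast hS
      gcongr
    rw [h1]
    nlinarith
  have hmeas : Measurable fun (v : Fin n → ℝ) (α : {α // α ∉ S}) => (A *ᵥ v) (α : Fin n) :=
    measurable_pi_lambda _ fun α => (measurable_pi_apply _).comp (measurable_mulVec A)
  have hcard : Fintype.card {α // α ∉ S} = n - S.card := by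
    rw [Fintype.card_subtype_compl, Fintype.card_fin, Fintype.card_coe]
  have hcard0 : 0 < Fintype.card {α // α ∉ S} := by omega
  have hcardn : Fintype.card {α // α ∉ S} ≤ n := by omega
  calc stdNormal (Fin n) {v | ε < |avg (fun α => f α ((A *ᵥ v) α)) - avg e|}
      ≤ (stdNormal (Fin n)).map (fun v (α : {α // α ∉ S}) => (A *ᵥ v) (α : Fin n)) E := by
        rw [Measure.map_apply hmeas hE]; exact measure_mono hsub
    _ ≤ (Real.toNNReal ((∏ j, ∑ α, |design h x α j|) / √((design h x)ᵀ * design h x).det) •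
          stdNormal {α // α ∉ S}) E := hdom E
    _ ≤ ENNReal.ofReal ((n : ℝ) ^ Fintype.card r * (C ^ Fintype.card r / √c)) *
          ENNReal.ofReal (2 * Real.exp (-(ε ^ 2 / (8 * B ^ 2)) * n)) := by
        rw [Measure.smul_apply, ENNReal.smul_def, smul_eq_mul]
        refine mul_le_mul' ?_ ?_
        · exact ENNReal.ofReal_le_ofReal (domination_const_le hn' hc hdet hC)
        · refine (hoeffding_pi (fun _ : {α // α ∉ S} => gaussianReal 0 1)
            (f := fun α t => f α t) (ε := ε * n / 2) (fun α => hf α) (fun α t => hB α t)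
            (by positivity)).trans ?_
          refine ENNReal.ofReal_le_ofReal ?_
          refine mul_le_mul_of_nonneg_left (Real.exp_le_exp.2 ?_) (by norm_num)
          have h5 : (0 : ℝ) < Fintype.card {α // α ∉ S} := by exact_mod_cast hcard0
          have h6 : (Fintype.card {α // α ∉ S} : ℝ) ≤ n := by exact_mod_cast hcardn
          rw [neg_div, neg_mul, neg_le_neg_iff]
          calc ε ^ 2 / (8 * B ^ 2) * n = (ε * n / 2) ^ 2 / (2 * n * B ^ 2) := by field_simp; ring
            _ ≤ _ := by gcongr
    _ = _ := by
        have hC0 : 0 ≤ (n : ℝ) ^ Fintype.card r * (C ^ Fintype.card r / √c) := by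
          refine le_trans ?_ (domination_const_le hn' hc hdet hC)
          exact div_nonneg (Finset.prod_nonneg fun j _ => Finset.sum_nonneg fun α _ => abs_nonneg _)
            (Real.sqrt_nonneg _)
        rw [← ENNReal.ofReal_mul hC0]
        congr 1
        ring

/-- Three comparisons: the empirical average is close to its conditional mean by concentration;
replacing the conditional mean and standard deviation by `m₀` and `s₀` costs little in total
variation; the resulting function of the rows is bounded and measurable, so the law of large numbers
for `X` applies. -/
theorem conv (H : GaussianStep μ X Λ G m s R h m₀ s₀) {ψ : 𝓧 × ℝ → ℝ} (hψ : Measurable ψ)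
    {B : ℝ} (hB0 : 0 < B) (hB : ∀ z, |ψ z| ≤ B) :
    Tendsto (fun p : Σ n, Ω n => avg fun α => ψ (X p.1 p.2 α, G p.1 p.2 α)) (complete μ)
      (𝓝 (∫ z, ψ z ∂(limit Λ m₀ s₀))) := by
  let γ := gaussianReal 0 1
  let Ψ : 𝓧 → ℝ := fun z => ∫ t, ψ (z, m₀ z + s₀ * t) ∂γ
  have hm₀ := H.m₀_meas
  have hφ : Measurable fun p : 𝓧 × ℝ => ψ (p.1, m₀ p.1 + s₀ * p.2) :=
    hψ.comp (measurable_limit_map hm₀)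
  have hΨ : Measurable Ψ := hφ.stronglyMeasurable.integral_prod_right'.measurable
  have hint : ∀ (f : ℝ → ℝ), (∀ t, |f t| ≤ B) → |∫ t, f t ∂γ| ≤ B := fun f hf => by
    have := norm_integral_le_of_norm_le_const (μ := γ) (f := f) (C := B) (ae_of_all _ hf)
    simpa using this
  have hlim : ∫ z, ψ z ∂(limit Λ m₀ s₀) = ∫ z, Ψ z ∂Λ := by
    rw [limit, integral_map (measurable_limit_map hm₀).aemeasurable hψ.aestronglyMeasurable,
      integral_prod]
    exact Integrable.of_bound hφ.aestronglyMeasurable B (ae_of_all _ fun p => hB _)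
  rw [hlim]
  have h1 := H.lln.conv Ψ hΨ ⟨B, fun z => hint _ fun t => hB _⟩
  -- the conditional mean given the rows
  let M : (Σ n, Ω n) → ℝ := fun p => avg fun α =>
    ∫ t, ψ (X p.1 p.2 α, m p.1 (X p.1 p.2) α + s p.1 (X p.1 p.2) * t) ∂γ
  have h2 : Tendsto (fun p => M p - avg fun α => Ψ (X p.1 p.2 α)) (complete μ) (𝓝 0) := by
    refine Metric.tendsto_nhds.2 fun ε hε => ?_
    obtain ⟨η, hη, htv⟩ := exists_gaussianReal_integral_sub_le H.s_pos
      (ε := ε / (4 * B)) (by positivity)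
    have e1 := Metric.tendsto_nhds.1 H.s_lim η hη
    have e2 := H.m_lim.eventually (gt_mem_nhds (show 0 < η * ε / (8 * B) by positivity))
    filter_upwards [e1, e2] with p hp1 hp2
    rw [Real.dist_eq] at hp1
    rw [Real.dist_eq, sub_zero, ← avg_sub]
    -- Where the means differ by less than η, total variation continuity gives ε/4. Elsewhere the
    -- trivial bound 2B is at most (2B/η)|m - m₀|, whose average is small by `m_lim`.
    have key : ∀ α, |(∫ t, ψ (X p.1 p.2 α, m p.1 (X p.1 p.2) α + s p.1 (X p.1 p.2) * t) ∂γ) -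
        Ψ (X p.1 p.2 α)| ≤ ε / 4 + 2 * B / η *
          |m p.1 (X p.1 p.2) α - m₀ (X p.1 p.2 α)| := by
      intro α
      by_cases hα : |m p.1 (X p.1 p.2) α - m₀ (X p.1 p.2 α)| < η
      · have := htv _ _ _ hα hp1 (fun t => ψ (X p.1 p.2 α, t)) (hψ.comp measurable_prodMk_left) B
          (fun t => hB _)
        have h3 : B * (ε / (4 * B)) = ε / 4 := by field_simp
        rw [h3] at this
        refine this.trans (le_add_of_nonneg_right (by positivity))
      · have h4 : 2 * B ≤ 2 * B / η * |m p.1 (X p.1 p.2) α - m₀ (X p.1 p.2 α)| := by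
          rw [div_mul_eq_mul_div, le_div_iff₀ hη]
          gcongr
          exact not_lt.1 hα
        have h5 := abs_sub (∫ t, ψ (X p.1 p.2 α, m p.1 (X p.1 p.2) α + s p.1 (X p.1 p.2) * t) ∂γ)
          (Ψ (X p.1 p.2 α))
        have h6 := hint (fun t => ψ (X p.1 p.2 α, m p.1 (X p.1 p.2) α + s p.1 (X p.1 p.2) * t))
          fun t => hB _
        have h7 : |Ψ (X p.1 p.2 α)| ≤ B := hint _ fun t => hB _
        linarith
    refine lt_of_le_of_lt (abs_avg_le.trans (avg_mono key)) ?_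
    rw [avg_add, avg_const_mul]
    have h8 := avg_const_le (n := p.1) (c := ε / 4) (by positivity)
    have h9 : 2 * B / η * avg (fun α => |m p.1 (X p.1 p.2) α - m₀ (X p.1 p.2 α)|) <
        2 * B / η * (η * ε / (8 * B)) := mul_lt_mul_of_pos_left hp2 (by positivity)
    have h10 : 2 * B / η * (η * ε / (8 * B)) = ε / 4 := by field_simp; ring
    linarith
  have h3 : Tendsto (fun p : Σ n, Ω n => (avg fun α => ψ (X p.1 p.2 α, G p.1 p.2 α)) - M p)
      (complete μ) (𝓝 0) := by
    refine Metric.tendsto_nhds.2 fun ε hε => ?_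
    set δ := ε / 2
    have hδ : 0 < δ := by positivity
    have hdpos := limGram_det_pos H.lln H.h_meas H.h_bdd H.gram_det
    -- Half of the limit determinant eventually bounds the empirical determinants from below, which
    -- keeps the domination constant polynomial in n.
    set c := (limGram Λ h).det / 2
    have hc : 0 < c := by positivity
    choose C hC using fun j => H.h_bdd j 1
    set D := ∑ j, |C j|
    let Q : ∀ n, Set (Fin n → 𝓧) := fun n => {x | R n x = 1 - design h x *
      ((design h x)ᵀ * design h x)⁻¹ * (design h x)ᵀ ∧ c ≤ (empGram h x).det ∧
      (∀ j, avg (fun α => |h j (x α)|) ≤ D) ∧ 4 * B * Fintype.card r ≤ δ * n ∧ Fintype.card r < n}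
    have hQ : ∀ᶠ p : Σ n, Ω n in complete μ, X p.1 p.2 ∈ Q p.1 := by
      have e1 : ∀ᶠ p : Σ n, Ω n in complete μ, c ≤ (empGram h (X p.1 p.2)).det := by
        have ht : Tendsto (fun p : Σ n, Ω n => (empGram h (X p.1 p.2)).det) (complete μ)
            (𝓝 (limGram Λ h).det) :=
          ((continuous_id.matrix_det).tendsto _).comp (tendsto_empGram H.lln H.h_meas H.h_bdd)
        exact (ht.eventually (lt_mem_nhds (half_lt_self hdpos))).mono fun p hp => hp.le
      have e2 : ∀ᶠ p : Σ n, Ω n in complete μ, 4 * B * Fintype.card r ≤ δ * p.1 ∧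
          Fintype.card r < p.1 := by
        refine eventually_fst_complete (p := fun n => 4 * B * Fintype.card r ≤ δ * (n : ℝ) ∧
          Fintype.card r < n) ?_
        exact ((tendsto_natCast_atTop_atTop.const_mul_atTop hδ).eventually_ge_atTop _).and
          (eventually_gt_atTop _)
      filter_upwards [H.R_eq, e1, eventually_all.2 hC, e2] with p hp1 hp2 hp3 hp4
      refine ⟨hp1, hp2, fun j => ?_, hp4⟩
      have := hp3 j
      simp only [pow_one] at this
      refine this.trans ((le_abs_self _).trans ?_)
      exact Finset.single_le_sum (f := fun j => |C j|) (fun _ _ => abs_nonneg _) (Finset.mem_univ j)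
    let Bad : ∀ n, Set ((Fin n → 𝓧) × (Fin n → ℝ)) := fun n => {p | δ <
      |avg (fun α => ψ (p.1 α, p.2 α)) -
        avg fun α => ∫ t, ψ (p.1 α, m n p.1 α + s n p.1 * t) ∂γ|}
    have hBad : ∀ n, MeasurableSet (Bad n) := by
      intro n
      refine measurableSet_lt measurable_const (Measurable.abs (Measurable.sub ?_ ?_))
      · refine (Finset.measurable_sum _ fun α _ => ?_).const_mul _
        exact hψ.comp (by fun_prop)
      · refine (Finset.measurable_sum _ fun α _ => ?_).const_mul _
        exact (H.measurable_condMean hψ n α).comp measurable_fst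
    have hsum : Summable fun n : ℕ => (D ^ Fintype.card r / √c * 2) *
        ((n : ℝ) ^ Fintype.card r * Real.exp (-(δ ^ 2 / (8 * B ^ 2)) * n)) :=
      (Real.summable_pow_mul_exp_neg_nat_mul _ (by positivity)).mul_left _
    have := H.eventually_notMem hBad hQ hsum.tsum_ofReal_ne_top (by
      rintro n x ⟨hR, hdet, hD, hn, hnr⟩
      exact stdNormal_avg_sub_gt_le (f := fun α t => ψ (x α, m n x α + s n x * t)) hR hc hdet hD
        (fun α => hψ.comp (by fun_prop)) hB0 (fun α t => hB _) hδ hn hnr)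
    filter_upwards [this] with p hp
    rw [Real.dist_eq, sub_zero]
    refine lt_of_le_of_lt (not_lt.1 hp) (half_lt_self hε)
  have := (h3.add h2).add h1
  simp only [zero_add] at this
  refine this.congr fun p => ?_
  ring

/-! #### Moments -/

/-- Write R v as v minus a combination of the columns of the design matrix. The coefficients are
bounded once the second empirical moments of v and of the `h j` are, so only the empirical moments
of v of order 2 and k must be controlled, each up to a probability O(n⁻²). -/
theorem bddMoments (H : GaussianStep μ X Λ G m s R h m₀ s₀) : BddMoments μ fun p => G p.1 p.2 := by
  intro k
  have hL : ∀ j : ℕ, MemLp (fun t : ℝ => |t| ^ j) 4 (gaussianReal 0 1) :=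
    memLp_abs_pow fun p => memLp_id_gaussianReal' _ (ENNReal.natCast_ne_top _)
  obtain ⟨K₂, hK₂⟩ := exists_measure_pi_avg_gt_le (gaussianReal 0 1) (f := fun t => |t| ^ 2)
    (by fun_prop) (hL 2)
  obtain ⟨K, hK⟩ := exists_measure_pi_avg_gt_le (gaussianReal 0 1) (f := fun t => |t| ^ k)
    (by fun_prop) (hL k)
  set a₂ := ∫ t, |t| ^ 2 ∂(gaussianReal 0 1) + 1
  set a := ∫ t, |t| ^ k ∂(gaussianReal 0 1) + 1
  have ha₂ : 0 ≤ a₂ := by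
    have : 0 ≤ ∫ t, |t| ^ 2 ∂(gaussianReal 0 1) := integral_nonneg fun t => by positivity
    positivity
  have hinv := tendsto_empGram_inv H.lln H.h_meas H.h_bdd H.gram_det
  have hent : ∀ i j, ∀ᶠ p : Σ n, Ω n in complete μ,
      |(empGram h (X p.1 p.2))⁻¹ i j| ≤ |(limGram Λ h)⁻¹ i j| + 1 := fun i j =>
    ((((tendsto_pi_nhds.1 (tendsto_pi_nhds.1 hinv i) j)).abs).eventually
      (gt_mem_nhds (lt_add_one _))).mono fun p hp => hp.le
  have hdpos := limGram_det_pos H.lln H.h_meas H.h_bdd H.gram_det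
  have hdet : ∀ᶠ p : Σ n, Ω n in complete μ, 0 < (empGram h (X p.1 p.2)).det := by
    have ht : Tendsto (fun p : Σ n, Ω n => (empGram h (X p.1 p.2)).det) (complete μ)
        (𝓝 (limGram Λ h).det) :=
      ((continuous_id.matrix_det).tendsto _).comp (tendsto_empGram H.lln H.h_meas H.h_bdd)
    exact ht.eventually (lt_mem_nhds hdpos)
  choose C hC using fun j => H.h_bdd j 2
  set D := ∑ j, |C j|
  -- `A i` bounds the i-th regression coefficient of v on the `h j`: the entries of the inverse Gram
  -- matrix exceed their limits by at most 1, and Cauchy–Schwarz bounds the averages of h j times v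
  -- by √(D a₂).
  set A : r → ℝ := fun i => ∑ j, (|(limGram Λ h)⁻¹ i j| + 1) * √(D * a₂)
  have hA : ∀ i, 0 ≤ A i := fun i => Finset.sum_nonneg fun j _ => by positivity
  -- a majorant of the part of the new vector that is a function of the rows
  let w : ∀ n, (Fin n → 𝓧) → Fin n → ℝ := fun n x α =>
    |m n x α| + (s₀ + 1) * ∑ i, A i * |h i (x α)|
  have hw : BddMoments μ fun p => w p.1 (X p.1 p.2) :=
    H.m_bdd.abs.add ((bddMoments_const (s₀ + 1)).mul
      (BddMoments.sum _ fun i _ => (bddMoments_const (A i)).mul (H.h_bdd i).abs))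
  obtain ⟨W, hW⟩ := hw k
  set C' := 2 ^ (k - 1) * (W + (s₀ + 1) ^ k * a)
  refine ⟨C', ?_⟩
  let Q : ∀ n, Set (Fin n → 𝓧) := fun n => {x | R n x = 1 - design h x *
      ((design h x)ᵀ * design h x)⁻¹ * (design h x)ᵀ ∧ 0 < (empGram h x).det ∧
      (∀ i j, |(empGram h x)⁻¹ i j| ≤ |(limGram Λ h)⁻¹ i j| + 1) ∧
      (∀ j, avg (fun α => |h j (x α)| ^ 2) ≤ D) ∧ |s n x| ≤ s₀ + 1 ∧
      avg (fun α => |w n x α| ^ k) ≤ W ∧ 0 < n}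
  have hQ : ∀ᶠ p : Σ n, Ω n in complete μ, X p.1 p.2 ∈ Q p.1 := by
    have es : ∀ᶠ p : Σ n, Ω n in complete μ, |s p.1 (X p.1 p.2)| ≤ s₀ + 1 := by
      have := H.s_lim.abs
      rw [abs_of_pos H.s_pos] at this
      exact (this.eventually (gt_mem_nhds (lt_add_one s₀))).mono fun p hp => hp.le
    filter_upwards [H.R_eq, hdet, eventually_all.2 fun i => eventually_all.2 (hent i),
      eventually_all.2 hC, es, hW,
      eventually_fst_complete (p := fun n => 0 < n) (eventually_gt_atTop 0)]
      with p h1 h2 h3 h4 h5 h6 h7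
    refine ⟨h1, h2, h3, fun j => (h4 j).trans ((le_abs_self _).trans ?_), h5, h6, h7⟩
    exact Finset.single_le_sum (f := fun j => |C j|) (fun _ _ => abs_nonneg _) (Finset.mem_univ j)
  let Bad : ∀ n, Set ((Fin n → 𝓧) × (Fin n → ℝ)) := fun n => {p | C' < avg fun α => |p.2 α| ^ k}
  have hBad : ∀ n, MeasurableSet (Bad n) := by
    intro n
    refine measurableSet_lt measurable_const
      ((Finset.measurable_sum _ fun α _ => ?_).const_mul _)
    fun_prop
  have hsum : ∑' n : ℕ, ENNReal.ofReal ((|K₂| + |K|) * (1 / (n : ℝ) ^ 2)) ≠ ⊤ :=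
    ((Real.summable_one_div_nat_pow.2 one_lt_two).mul_left _).tsum_ofReal_ne_top
  have := H.eventually_notMem hBad hQ hsum (by
    rintro n x ⟨hR, hdet, hinv, hD, hs, hw, hn⟩
    have hn0 : (0 : ℝ) < n := by exact_mod_cast hn
    -- On good rows a large k-th moment of the sample can come only from v itself, through an
    -- atypical second or k-th empirical moment.
    have hsub : {v | (x, sample m s R x v) ∈ Bad n} ⊆
        {v | a₂ < avg fun α => |v α| ^ 2} ∪ {v | a < avg fun α => |v α| ^ k} := by
      intro v hv
      by_contra hcon
      simp only [Set.mem_union, Set.mem_ofPred_eq, not_or, not_lt] at hcon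
      have hv' : C' < avg fun α => |sample m s R x v α| ^ k := hv
      refine absurd hv' (not_lt.2 ?_)
      have hproj : ∀ α, |(R n x *ᵥ v) α| ≤ |v α| + ∑ i, A i * |h i (x α)| := by
        intro α
        have hu : IsUnit (empGram h x).det := hdet.ne'.isUnit
        have hv2 : ((design h x)ᵀ *ᵥ v) = (n : ℝ) • fun j => avg fun α => h j (x α) * v α := by
          ext j
          simp [Matrix.mulVec, dotProduct, design, avg, hn0.ne']
        have hb : ∀ j, |avg fun α => h j (x α) * v α| ≤ √(D * a₂) := by
          intro j
          rw [← Real.sqrt_sq_eq_abs]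
          refine Real.sqrt_le_sqrt (avg_mul_sq_le.trans ?_)
          have h1 := hD j
          have h2 := hcon.1
          simp only [sq_abs] at h1 h2
          exact mul_le_mul h1 h2 (avg_nonneg fun α => sq_nonneg _)
            (Finset.sum_nonneg fun j _ => abs_nonneg _)
        have hRv : R n x *ᵥ v = v - design h x *ᵥ
            ((empGram h x)⁻¹ *ᵥ fun j => avg fun α => h j (x α) * v α) := by
          rw [hR, sub_mulVec, one_mulVec, ← mulVec_mulVec, ← mulVec_mulVec, hv2,
            design_transpose_mul hn]
          let _ := invertibleOfNonzero hn0.ne'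
          rw [Matrix.inv_smul _ _ hu, mulVec_smul, smul_mulVec, smul_smul]
          simp [hn0.ne']
        rw [hRv, Pi.sub_apply]
        refine (abs_sub _ _).trans (add_le_add le_rfl ?_)
        simp only [Matrix.mulVec, dotProduct, design, Matrix.of_apply]
        refine (Finset.abs_sum_le_sum_abs _ _).trans (Finset.sum_le_sum fun i _ => ?_)
        rw [abs_mul, mul_comm]
        refine mul_le_mul_of_nonneg_right ?_ (abs_nonneg _)
        refine (Finset.abs_sum_le_sum_abs _ _).trans (Finset.sum_le_sum fun j _ => ?_)
        rw [abs_mul]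
        exact mul_le_mul (hinv i j) (hb j) (abs_nonneg _) (by positivity)
      have hpt : ∀ α, |sample m s R x v α| ^ k ≤
          2 ^ (k - 1) * (|w n x α| ^ k + (s₀ + 1) ^ k * |v α| ^ k) := by
        intro α
        have hs0 : 0 ≤ s₀ + 1 := by linarith [H.s_pos]
        have hsum0 : 0 ≤ ∑ i, A i * |h i (x α)| :=
          Finset.sum_nonneg fun i _ => mul_nonneg (hA i) (abs_nonneg _)
        have hw0 : 0 ≤ w n x α := add_nonneg (abs_nonneg _) (mul_nonneg hs0 hsum0)
        have h1 : |sample m s R x v α| ≤ |w n x α| + (s₀ + 1) * |v α| := by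
          rw [abs_of_nonneg hw0]
          calc |sample m s R x v α| ≤ |m n x α| + |s n x| * |(R n x *ᵥ v) α| := by
                rw [← abs_mul]; exact abs_add_le _ _
            _ ≤ |m n x α| + (s₀ + 1) * (|v α| + ∑ i, A i * |h i (x α)|) := by
                gcongr
                exact hproj α
            _ = _ := by simp only [w]; ring
        refine (pow_le_pow_left₀ (abs_nonneg _) h1 k).trans ?_
        rw [← mul_pow]
        exact add_pow_le (abs_nonneg _) (by positivity) k
      refine (avg_mono hpt).trans ?_
      rw [avg_const_mul, avg_add, avg_const_mul]
      have hs0 : 0 ≤ s₀ + 1 := by linarith [H.s_pos]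
      exact mul_le_mul_of_nonneg_left (add_le_add hw (mul_le_mul_of_nonneg_left hcon.2
        (pow_nonneg hs0 k))) (by positivity)
    calc _ ≤ _ := measure_mono hsub
      _ ≤ _ := measure_union_le _ _
      _ ≤ ENNReal.ofReal (K₂ / (n : ℝ) ^ 2) + ENNReal.ofReal (K / (n : ℝ) ^ 2) :=
          add_le_add (hK₂ n hn) (hK n hn)
      _ ≤ ENNReal.ofReal (|K₂| * (1 / (n : ℝ) ^ 2)) + ENNReal.ofReal (|K| * (1 / (n : ℝ) ^ 2)) := by
          rw [mul_one_div, mul_one_div]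
          gcongr <;> exact le_abs_self _
      _ = _ := by
          rw [← ENNReal.ofReal_add (by positivity) (by positivity)]
          congr 1
          ring)
  filter_upwards [this] with p hp
  exact not_lt.1 hp

/-- The law of large numbers persists when a conditionally Gaussian coordinate is adjoined. -/
theorem lln_prod (H : GaussianStep μ X Λ G m s R h m₀ s₀) :
    LLN μ (fun n ω α => (X n ω α, G n ω α)) (limit Λ m₀ s₀) where
  conv ψ hψ := fun ⟨C, hC⟩ =>
    H.conv hψ (B := |C| + 1) (by positivity) fun z => (hC z).trans ((le_abs_self C).trans (by simp))
  null _ hN h0 := H.null hN h0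

end GaussianStep

end GaussianStep

/-! ### Images and modifications of laws of large numbers. -/

section LLNMap

variable {Ω : ℕ → Type*} [∀ n, MeasurableSpace (Ω n)] {μ : ∀ n, Measure (Ω n)}
  {𝓧 𝓨 : Type*} [MeasurableSpace 𝓧] [MeasurableSpace 𝓨]
  {X : ∀ n, Ω n → Fin n → 𝓧} {Λ : Measure 𝓧}

theorem LLN.map (h : LLN μ X Λ) {g : 𝓧 → 𝓨} (hg : Measurable g) :
    LLN μ (fun n ω α => g (X n ω α)) (Λ.map g) where
  conv ψ hψ := fun ⟨C, hC⟩ => by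
    rw [integral_map hg.aemeasurable hψ.aestronglyMeasurable]
    exact h.conv (fun z => ψ (g z)) (hψ.comp hg) ⟨C, fun z => hC _⟩
  null N hN h0 := h.null _ (hg hN) (by rwa [Measure.map_apply hg hN] at h0)

theorem LLN.congr (h : LLN μ X Λ) {Y : ∀ n, Ω n → Fin n → 𝓧}
    (hXY : ∀ᶠ p : Σ n, Ω n in complete μ, ∀ α, X p.1 p.2 α = Y p.1 p.2 α) : LLN μ Y Λ where
  conv ψ hψ hb := (h.conv ψ hψ hb).congr' (hXY.mono fun p hp => by simp only [hp])
  null N hN h0 := by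
    filter_upwards [h.null N hN h0, hXY] with p hp1 hp2 α
    rw [← hp2]
    exact hp1 α

end LLNMap

/-! ### Gaussian matrices -/

section GaussianMatrix

open Matrix

/-- The law of a matrix with independent entries of law `N(0, σ²)`. -/
def gaussianMatrix (n : ℕ) (σ : ℝ≥0) : Measure (Fin n → Fin n → ℝ) :=
  Measure.pi fun _ => Measure.pi fun _ => gaussianReal 0 (σ ^ 2)

instance (n : ℕ) (σ : ℝ≥0) : IsProbabilityMeasure (gaussianMatrix n σ) := by
  unfold gaussianMatrix; infer_instance

theorem pi_gaussianReal_eq {ι : Type*} [Fintype ι] (σ : ℝ≥0) :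
    (Measure.pi fun _ : ι => gaussianReal 0 (σ ^ 2)) =
      (stdNormal ι).map fun z i => (σ : ℝ) * z i := by
  rw [stdNormal_map_const_mul]
  congr with i
  rw [← NNReal.coe_pow, Real.toNNReal_coe]

theorem pi_pi_map_uncurry {ι κ : Type*} [Fintype ι] [Fintype κ] {𝓨 : Type*} [MeasurableSpace 𝓨]
    (ρ : Measure 𝓨) [IsProbabilityMeasure ρ] :
    (Measure.pi fun _ : ι => Measure.pi fun _ : κ => ρ).map (fun A (p : ι × κ) => A p.1 p.2) =
      Measure.pi fun _ => ρ := by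
  refine (Measure.pi_eq fun s hs => ?_).symm
  rw [Measure.map_apply (by fun_prop) (MeasurableSet.univ_pi hs)]
  have : (fun (A : ι → κ → 𝓨) (p : ι × κ) => A p.1 p.2) ⁻¹' Set.univ.pi s =
      Set.univ.pi fun i => Set.univ.pi fun k => s (i, k) := by
    ext A
    simp [Set.mem_pi]
  rw [this, Measure.pi_pi]
  simp only [Measure.pi_pi]
  rw [Fintype.prod_prod_type]

theorem pi_pi_map_swap {ι κ : Type*} [Fintype ι] [Fintype κ] {𝓨 : Type*} [MeasurableSpace 𝓨]
    (ρ : Measure 𝓨) [IsProbabilityMeasure ρ] :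
    (Measure.pi fun _ : ι => Measure.pi fun _ : κ => ρ).map (fun A k i => A i k) =
      Measure.pi fun _ : κ => Measure.pi fun _ : ι => ρ := by
  have h1 : (Measure.pi fun _ : ι × κ => ρ).map (fun A (p : κ × ι) => A (p.2, p.1)) =
      Measure.pi fun _ => ρ :=
    (measurePreserving_piCongrLeft (fun _ : κ × ι => ρ) (Equiv.prodComm ι κ)).map_eq
  have h2 := pi_pi_map_uncurry (ι := κ) (κ := ι) ρ
  rw [← h1, ← pi_pi_map_uncurry, Measure.map_map (by fun_prop) (by fun_prop)] at h2
  have h3 := congrArg (Measure.map fun (A : κ × ι → 𝓨) k i => A (k, i)) h2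
  rw [Measure.map_map (by fun_prop) (by fun_prop), Measure.map_map (by fun_prop) (by fun_prop)] at h3
  have h4 : (Measure.pi fun _ : κ => Measure.pi fun _ : ι => ρ).map (fun A => A) = _ := Measure.map_id
  rw [← h4]
  exact h3.symm

theorem gaussianMatrix_map_swap (n : ℕ) (σ : ℝ≥0) :
    (gaussianMatrix n σ).map (fun A β α => A α β) = gaussianMatrix n σ :=
  pi_pi_map_swap _

variable {n : ℕ}

/-- The matrix `A` or its transpose. -/
def side (b : Bool) (A : Matrix (Fin n) (Fin n) ℝ) : Matrix (Fin n) (Fin n) ℝ := if b then A else Aᵀ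

@[simp] theorem side_side (b : Bool) (A : Matrix (Fin n) (Fin n) ℝ) : side b (side b A) = A := by
  cases b <;> simp [side]

theorem side_add (b : Bool) (A B : Matrix (Fin n) (Fin n) ℝ) :
    side b (A + B) = side b A + side b B := by
  cases b <;> simp [side]

/-- The matrix that acts on `v` like `B` and on vectors orthogonal to `v` like `A`. -/
def mix (v : Fin n → ℝ) (A B : Matrix (Fin n) (Fin n) ℝ) : Matrix (Fin n) (Fin n) ℝ :=
  A + vecMulVec ((B - A) *ᵥ v) ((v ⬝ᵥ v)⁻¹ • v)

theorem mix_mulVec (v : Fin n → ℝ) (A B : Matrix (Fin n) (Fin n) ℝ) :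
    mix v A B *ᵥ v = B *ᵥ v := by
  by_cases hv : v ⬝ᵥ v = 0
  · rw [dotProduct_self_eq_zero.1 hv]; simp
  · rw [mix, add_mulVec, vecMulVec_mulVec, smul_dotProduct, smul_eq_mul, inv_mul_cancel₀ hv, sub_mulVec]
    simp

theorem mix_mul {v : Fin n → ℝ} (A B : Matrix (Fin n) (Fin n) ℝ) {M : Matrix (Fin n) (Fin n) ℝ}
    (h : v ᵥ* M = 0) : mix v A B * M = A * M := by
  rw [mix, add_mul, vecMulVec_mul, smul_vecMul, h]; simp

/-- The map is (z, z') ↦ (1 - P)z + Pz' with P the orthogonal projection to the line of v, and (1 -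
P)(1 - P)ᵀ + PPᵀ = 1. For v = 0 the convention 0⁻¹ = 0 makes P = 0. -/
theorem stdNormal_map_mix (v : Fin n → ℝ) :
    ((stdNormal (Fin n)).prod (stdNormal (Fin n))).map
      (fun p => p.1 + ((p.2 - p.1) ⬝ᵥ v) • ((v ⬝ᵥ v)⁻¹ • v)) = stdNormal (Fin n) := by
  set P : Matrix (Fin n) (Fin n) ℝ := vecMulVec ((v ⬝ᵥ v)⁻¹ • v) v
  have hPt : Pᵀ = P := by
    ext i j
    simp only [P, transpose_apply, vecMulVec_apply, Pi.smul_apply, smul_eq_mul]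
    ring
  have hP2 : P * P = P := by
    by_cases hv : v ⬝ᵥ v = 0
    · simp [P, dotProduct_self_eq_zero.1 hv]
    · simp only [P]
      rw [vecMulVec_mul_vecMulVec, dotProduct_smul, smul_eq_mul, inv_mul_cancel₀ hv]
      simp
  have h1 := stdNormal_map_mulVec_eq (M := fromCols (1 - P) P)
    (N := (1 : Matrix (Fin n) (Fin n) ℝ)) (by
      rw [transpose_fromCols, fromCols_mul_fromRows, transpose_sub, hPt, hP2]
      simp [sub_mul, mul_sub, hP2])
  have h2 := (measurePreserving_sumPiEquivProdPi
    (fun _ : Fin n ⊕ Fin n => gaussianReal 0 1)).symm.map_eq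
  simp only [one_mulVec, Measure.map_id'] at h1
  refine Eq.trans ?_ h1
  change _ = Measure.map _ (Measure.pi _)
  rw [← h2, Measure.map_map (measurable_mulVec _) (MeasurableEquiv.measurable _)]
  congr 1
  ext p : 1
  have h3 : (MeasurableEquiv.sumPiEquivProdPi fun _ : Fin n ⊕ Fin n => ℝ).symm p =
      Sum.elim p.1 p.2 := by
    ext i; cases i <;> rfl
  simp only [Function.comp]
  rw [h3, fromCols_mulVec_sumElim, sub_mulVec, one_mulVec]
  simp only [P, vecMulVec_mulVec, sub_dotProduct, dotProduct_comm v]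
  ext i
  simp
  ring

/-- `mix` acts on each row separately, and the rows are independent. -/
theorem gaussianMatrix_map_mix (v : Fin n → ℝ) (σ : ℝ≥0) :
    ((gaussianMatrix n σ).prod (gaussianMatrix n σ)).map
      (fun p i j => mix v (of p.1) (of p.2) i j) = gaussianMatrix n σ := by
  set ρ : Measure (Fin n → ℝ) := Measure.pi fun _ => gaussianReal 0 (σ ^ 2)
  let f : (Fin n → ℝ) × (Fin n → ℝ) → Fin n → ℝ :=
    fun p => p.1 + ((p.2 - p.1) ⬝ᵥ v) • ((v ⬝ᵥ v)⁻¹ • v)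
  have hf : Measurable f := by
    simp only [f, dotProduct]; fun_prop
  have hrow : (ρ.prod ρ).map f = ρ := by
    have hs : Measurable fun (z : Fin n → ℝ) i => (σ : ℝ) * z i := by fun_prop
    simp only [ρ, pi_gaussianReal_eq]
    rw [Measure.map_prod_map _ _ hs hs, Measure.map_map hf (by fun_prop)]
    conv_rhs => rw [← stdNormal_map_mix v]
    rw [Measure.map_map hs hf]
    congr 1
    ext p i
    simp only [f, Function.comp, Prod.map, Pi.add_apply, Pi.smul_apply, smul_eq_mul, dotProduct,
      Pi.sub_apply, mul_add, Finset.mul_sum, Finset.sum_mul]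
    congr 1
    exact Finset.sum_congr rfl fun j _ => by ring
  have h1 := measurePreserving_pi (fun _ : Fin n => ρ.prod ρ) (fun _ : Fin n => ρ)
    (f := fun _ => f) fun _ => ⟨hf, hrow⟩
  have h2 := (measurePreserving_arrowProdEquivProdArrow (Fin n → ℝ) (Fin n → ℝ) (Fin n)
    (fun _ => ρ) fun _ => ρ).symm
  have h3 := (h1.comp h2).map_eq
  exact h3

theorem measurable_side (b : Bool) :
    Measurable fun (A : Fin n → Fin n → ℝ) i j => side b (of A) i j := by
  cases b
  · exact measurable_pi_lambda _ fun i => measurable_pi_lambda _ fun j =>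
      (measurable_pi_apply i).comp (measurable_pi_apply (X := fun _ => Fin n → ℝ) j)
  · exact measurable_id

theorem gaussianMatrix_map_side (b : Bool) (σ : ℝ≥0) :
    (gaussianMatrix n σ).map (fun A i j => side b (of A) i j) =
      gaussianMatrix n σ := by
  cases b
  · exact gaussianMatrix_map_swap n σ
  · exact Measure.map_id

theorem measurable_mix (v : Fin n → ℝ) :
    Measurable fun (p : (Fin n → Fin n → ℝ) × (Fin n → Fin n → ℝ)) i j =>
      mix v (of p.1) (of p.2) i j := by
  refine measurable_pi_lambda _ fun i => measurable_pi_lambda _ fun j => ?_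
  simp only [mix, Matrix.add_apply, vecMulVec_apply, mulVec, dotProduct, Matrix.sub_apply, of_apply]
  fun_prop

theorem gaussianMatrix_map_side_mix (b : Bool) (v : Fin n → ℝ) (σ : ℝ≥0) :
    ((gaussianMatrix n σ).prod (gaussianMatrix n σ)).map
      (fun p i j => side b (mix v (side b (of p.1)) (side b (of p.2))) i j) =
      gaussianMatrix n σ := by
  have hs := measurable_side (n := n) b
  conv_rhs => rw [← gaussianMatrix_map_side b, ← gaussianMatrix_map_mix v σ,
    Measure.map_map hs (measurable_mix v)]
  conv_rhs => rw [← gaussianMatrix_map_side b, Measure.map_prod_map _ _ hs hs,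
    Measure.map_map (hs.comp (measurable_mix v)) (by fun_prop)]
  rfl

/-- The law of independent matrices with independent normal entries. -/
def matLaw {J : Type*} [Fintype J] (n : ℕ) (σ : J → ℝ≥0) : Measure (J → Fin n → Fin n → ℝ) :=
  Measure.pi fun W => gaussianMatrix n (σ W)

variable {J : Type*} [Fintype J]

instance (n : ℕ) (σ : J → ℝ≥0) : IsProbabilityMeasure (matLaw n σ) := by
  unfold matLaw; infer_instance

open scoped Classical in
/-- `mix`, applied to one side of the matrix with index `W`. -/
def mixAt (b : Bool) (W : J) (v : Fin n → ℝ) (p : (J → Fin n → Fin n → ℝ) × (J → Fin n → Fin n → ℝ))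
    (W' : J) : Fin n → Fin n → ℝ :=
  if W' = W then fun i j => side b (mix v (side b (of (p.1 W'))) (side b (of (p.2 W')))) i j
  else p.1 W'

theorem matLaw_map_mixAt (σ : J → ℝ≥0) (b : Bool) (W : J) (v : Fin n → ℝ) :
    ((matLaw n σ).prod (matLaw n σ)).map (mixAt b W v) = matLaw n σ := by
  classical
  let f : J → (Fin n → Fin n → ℝ) × (Fin n → Fin n → ℝ) → (Fin n → Fin n → ℝ) := fun W' p =>
    if W' = W then fun i j => side b (mix v (side b (of p.1)) (side b (of p.2))) i j else p.1
  have hs := measurable_side (n := n) b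
  have hf : ∀ W', MeasurePreserving (f W')
      ((gaussianMatrix n (σ W')).prod (gaussianMatrix n (σ W'))) (gaussianMatrix n (σ W')) := by
    intro W'
    by_cases h : W' = W
    · simp only [f, h, if_true]
      refine ⟨?_, gaussianMatrix_map_side_mix b v (σ W)⟩
      exact hs.comp ((measurable_mix v).comp (Measurable.prodMk (hs.comp measurable_fst)
        (hs.comp measurable_snd)))
    · simp only [f, h, if_false]
      exact measurePreserving_fst
  have h1 := measurePreserving_pi _ _ hf
  have h2 := (measurePreserving_arrowProdEquivProdArrow (Fin n → Fin n → ℝ) (Fin n → Fin n → ℝ) J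
    (fun W => gaussianMatrix n (σ W)) fun W => gaussianMatrix n (σ W)).symm
  exact (h1.comp h2).map_eq

/-- A matrix with independent normal entries maps a vector to a normal vector. -/
theorem matLaw_map_mulVec (σ : J → ℝ≥0) (b : Bool) (W : J) (v : Fin n → ℝ) :
    (matLaw n σ).map (fun ω => side b (of (ω W)) *ᵥ v) =
      (stdNormal (Fin n)).map fun z α => (σ W * √(v ⬝ᵥ v)) * z α := by
  have hs := measurable_side (n := n) b
  have hv : Measurable fun A : Fin n → Fin n → ℝ => of A *ᵥ v := by
    refine measurable_pi_lambda _ fun i => ?_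
    simp only [mulVec, dotProduct, of_apply]
    fun_prop
  have h1 : (matLaw n σ).map (fun ω => ω W) = gaussianMatrix n (σ W) :=
    (measurePreserving_eval (fun W => gaussianMatrix n (σ W)) W).map_eq
  have h2 : (fun ω : J → Fin n → Fin n → ℝ => side b (of (ω W)) *ᵥ v) =
      (fun A : Fin n → Fin n → ℝ => of A *ᵥ v) ∘
        (fun (A : Fin n → Fin n → ℝ) i j => side b (of A) i j) ∘ fun ω => ω W := rfl
  rw [h2, ← Measure.map_map hv (hs.comp (measurable_pi_apply W)),
    ← Measure.map_map hs (measurable_pi_apply W), h1, gaussianMatrix_map_side,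
    stdNormal_map_const_mul]
  have hd : Measurable fun z : Fin n → ℝ => z ⬝ᵥ v := by simp only [dotProduct]; fun_prop
  have hrow : (Measure.pi fun _ : Fin n => gaussianReal 0 (σ W ^ 2)).map (fun z => z ⬝ᵥ v) =
      gaussianReal 0 (((σ W : ℝ) * √(v ⬝ᵥ v)) ^ 2).toNNReal := by
    rw [pi_gaussianReal_eq, Measure.map_map hd (by fun_prop)]
    have := stdNormal_map_dotProduct (fun i => (σ W : ℝ) * v i)
    rw [mul_pow, Real.sq_sqrt (by rw [dotProduct]; exact Finset.sum_nonneg fun i _ => mul_self_nonneg _)]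
    have h3 : ∑ i, ((σ W : ℝ) * v i) ^ 2 = (σ W : ℝ) ^ 2 * v ⬝ᵥ v := by
      simp only [dotProduct, Finset.mul_sum]
      exact Finset.sum_congr rfl fun i _ => by ring
    rw [← h3, ← this]
    congr 1
    ext z
    simp only [Function.comp, dotProduct]
    exact Finset.sum_congr rfl fun i _ => by ring
  rw [← hrow]
  have : SigmaFinite ((Measure.pi fun _ : Fin n => gaussianReal 0 (σ W ^ 2)).map
    (fun z => z ⬝ᵥ v)) := by rw [hrow]; infer_instance
  exact Measure.pi_map_pi (μ := fun _ : Fin n => Measure.pi fun _ : Fin n => gaussianReal 0 (σ W ^ 2))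
    (f := fun _ z => z ⬝ᵥ v) fun _ => hd.aemeasurable

end GaussianMatrix

/-- Two randomizations of `a` with the same conditional laws have the same joint law with `a`. -/
theorem prod_map_congr {𝓐 𝓑 𝓒 𝓓 : Type*} [MeasurableSpace 𝓐] [MeasurableSpace 𝓑]
    [MeasurableSpace 𝓒] [MeasurableSpace 𝓓] {μ : Measure 𝓐} {ν₁ : Measure 𝓑} {ν₂ : Measure 𝓒}
    [SFinite ν₁] [SFinite ν₂] {f : 𝓐 → 𝓑 → 𝓓} {g : 𝓐 → 𝓒 → 𝓓}
    (hf : Measurable fun p : 𝓐 × 𝓑 => f p.1 p.2) (hg : Measurable fun p : 𝓐 × 𝓒 => g p.1 p.2)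
    (h : ∀ a, ν₁.map (f a) = ν₂.map (g a)) :
    (μ.prod ν₁).map (fun p => (p.1, f p.1 p.2)) = (μ.prod ν₂).map fun p => (p.1, g p.1 p.2) := by
  have hf' : Measurable fun p : 𝓐 × 𝓑 => (p.1, f p.1 p.2) := measurable_fst.prodMk hf
  have hg' : Measurable fun p : 𝓐 × 𝓒 => (p.1, g p.1 p.2) := measurable_fst.prodMk hg
  ext s hs
  rw [Measure.map_apply hf' hs, Measure.map_apply hg' hs, Measure.prod_apply (hf' hs),
    Measure.prod_apply (hg' hs)]
  refine lintegral_congr fun a => ?_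
  have h1 : ν₁.map (f a) (Prod.mk a ⁻¹' s) = ν₂.map (g a) (Prod.mk a ⁻¹' s) := by rw [h a]
  have hfa : Measurable (f a) := hf.comp measurable_prodMk_left
  have hga : Measurable (g a) := hg.comp measurable_prodMk_left
  rwa [Measure.map_apply hfa (measurable_prodMk_left hs),
    Measure.map_apply hga (measurable_prodMk_left hs)] at h1

/-! ### Rows of a program -/

section Rows

variable {I J : Type*}

theorem Term.value_congr {z z' : Term I J → ℝ} {t : Term I J} (h : ∀ g ∈ t.gvars, z g = z' g) :
    t.value z = t.value z' := by
  induction t with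
  | vec i => exact h _ (by simp [Term.gvars])
  | mul W t _ => exact h _ (by simp [Term.gvars])
  | mulT W t _ => exact h _ (by simp [Term.gvars])
  | nonlin φ args ih =>
    simp only [Term.value]
    congr 1
    ext k
    refine ih k fun g hg => h g ?_
    simp only [Term.gvars, Finset.mem_biUnion, Finset.mem_univ, true_and]
    exact ⟨k, hg⟩

theorem Term.eval_eq_value {n : ℕ} (θ : Params I J n) (t : Term I J) (α : Fin n) :
    t.eval θ α = t.value fun g => g.eval θ α := by
  induction t with
  | vec i => rfl
  | mul W t _ => rfl
  | mulT W t _ => rfl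
  | nonlin φ args ih => simp only [Term.value, Term.eval, ih]

theorem Term.measurable_value (t : Term I J) : Measurable fun z : Term I J → ℝ => t.value z := by
  induction t with
  | vec i => exact measurable_pi_apply _
  | mul W t _ => exact measurable_pi_apply _
  | mulT W t _ => exact measurable_pi_apply _
  | nonlin φ args ih => exact φ.measurable.comp (measurable_pi_lambda _ ih)

theorem Term.measurable_eval {n : ℕ} (t : Term I J) (α : Fin n) :
    Measurable fun θ : Params I J n => t.eval θ α := by
  induction t generalizing α with
  | vec i => simp only [Term.eval]; fun_prop
  | mul W t ih =>
    simp only [Term.eval]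
    refine (Finset.measurable_sum _ fun β _ => Measurable.mul ?_ (ih β)).const_mul _
    fun_prop
  | mulT W t ih =>
    simp only [Term.eval]
    refine (Finset.measurable_sum _ fun β _ => Measurable.mul ?_ (ih β)).const_mul _
    fun_prop
  | nonlin φ args ih => exact φ.measurable.comp (measurable_pi_lambda _ fun k => ih k α)

/-- A product of an input matrix (`side = true`) or its transpose (`side = false`) with a vector. -/
structure Query (I J : Type*) where
  side : Bool
  mat : J
  arg : Term I J

/-- The result of a product. -/
def Query.term (q : Query I J) : Term I J :=
  if q.side then .mul q.mat q.arg else .mulT q.mat q.arg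

open Matrix in
theorem Query.eval_term {n : ℕ} (q : Query I J) (θ : Params I J n) (α : Fin n) :
    q.term.eval θ α =
      (√(n : ℝ))⁻¹ * (TensorProgram.side q.side (of (θ.2 q.mat)) *ᵥ q.arg.eval θ) α := by
  obtain ⟨b, W, h⟩ := q
  cases b <;> simp [Query.term, TensorProgram.side, Term.eval, Matrix.mulVec, dotProduct]

variable [Fintype I]

open scoped Classical in
/-- The input vectors and the results of a list of products. -/
def gset : List (Query I J) → Finset (Term I J)
  | [] => Finset.univ.image Term.vec
  | q :: l => insert q.term (gset l)

/-- Every product of the list is new and its argument is a function of earlier vectors. -/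
def Valid : List (Query I J) → Prop
  | [] => True
  | q :: l => Valid l ∧ q.arg.gvars ⊆ gset l ∧ q.term ∉ gset l

theorem Valid.gvars_arg_subset {l : List (Query I J)} (hl : Valid l) {q : Query I J} (hq : q ∈ l) :
    q.arg.gvars ⊆ gset l := by
  classical
  induction l with
  | nil => simp at hq
  | cons q' l ih =>
    refine subset_trans ?_ (Finset.subset_insert _ _)
    rcases List.mem_cons.1 hq with rfl | h
    · exact hl.2.1
    · exact ih hl.1 h

theorem term_mem_gset {l : List (Query I J)} {q : Query I J} (hq : q ∈ l) : q.term ∈ gset l := by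
  classical
  induction l with
  | nil => simp at hq
  | cons q' l ih =>
    rcases List.mem_cons.1 hq with rfl | h
    · exact Finset.mem_insert_self _ _
    · exact Finset.mem_insert_of_mem (ih h)

theorem vec_mem_gset (l : List (Query I J)) (i : I) : Term.vec i ∈ gset l := by
  classical
  induction l with
  | nil => simp [gset]
  | cons q' l ih => exact Finset.mem_insert_of_mem ih

theorem mem_gset_iff {l : List (Query I J)} {g : Term I J} :
    g ∈ gset l ↔ (∃ i, g = .vec i) ∨ ∃ q ∈ l, g = q.term := by
  classical
  induction l with
  | nil => simp [gset, eq_comm]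
  | cons q' l ih =>
    simp only [gset, Finset.mem_insert, ih, List.mem_cons]
    constructor
    · rintro (h | h | ⟨q, hq, h⟩)
      · exact .inr ⟨q', .inl rfl, h⟩
      · exact .inl h
      · exact .inr ⟨q, .inr hq, h⟩
    · rintro (h | ⟨q, rfl | hq, h⟩)
      · exact .inr (.inl h)
      · exact .inl h
      · exact .inr (.inr ⟨q, hq, h⟩)

/-- The row of input vectors, extended by zero. -/
def vecRow (x : EuclideanSpace ℝ I) : Term I J → ℝ
  | .vec i => x i
  | _ => 0

omit [Fintype I] in
theorem measurable_vecRow [Finite I] : Measurable (vecRow : EuclideanSpace ℝ I → Term I J → ℝ) := by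
  refine measurable_pi_lambda _ fun t => ?_
  cases t
  · simp only [vecRow]; fun_prop
  all_goals exact measurable_const

open scoped Classical in
/-- The coordinates of the input vectors and of the results of the products, extended by zero. -/
def rows {n : ℕ} : List (Query I J) → Params I J n → Fin n → Term I J → ℝ
  | [], θ => fun α => vecRow (θ.1 α)
  | q :: l, θ => fun α => Function.update (rows l θ α) q.term (q.term.eval θ α)

theorem rows_of_mem {n : ℕ} {l : List (Query I J)} {g : Term I J} (hg : g ∈ gset l)
    (θ : Params I J n) (α : Fin n) : rows l θ α g = g.eval θ α := by
  classical
  induction l with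
  | nil =>
    obtain ⟨i, -, rfl⟩ := Finset.mem_image.1 hg
    rfl
  | cons q l ih =>
    by_cases h : g = q.term
    · subst h; simp [rows]
    · simp only [rows]
      rw [Function.update_of_ne h]
      exact ih (Finset.mem_of_mem_insert_of_ne hg h)

theorem value_rows {n : ℕ} {l : List (Query I J)} {t : Term I J} (ht : t.gvars ⊆ gset l)
    (θ : Params I J n) (α : Fin n) : t.value (rows l θ α) = t.eval θ α := by
  rw [Term.eval_eq_value]
  exact Term.value_congr fun g hg => rows_of_mem (ht hg) θ α

theorem measurable_rows {n : ℕ} (l : List (Query I J)) :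
    Measurable fun θ : Params I J n => rows l θ := by
  induction l with
  | nil =>
    refine measurable_pi_lambda _ fun α => measurable_vecRow.comp ?_
    fun_prop
  | cons q l ih =>
    classical
    refine measurable_pi_lambda _ fun α => ?_
    exact measurable_update'.comp (((measurable_pi_apply α).comp ih).prodMk
      (q.term.measurable_eval α))

/-- The argument of a product, as a function of the rows. -/
def Query.argVal {n : ℕ} (q : Query I J) (D : Fin n → Term I J → ℝ) : Fin n → ℝ :=
  fun α => q.arg.value (D α)

omit [Fintype I] in
@[fun_prop]
theorem Query.measurable_argVal {n : ℕ} {𝓐 : Type*} [MeasurableSpace 𝓐] (q : Query I J)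
    {D : 𝓐 → Fin n → Term I J → ℝ} (hD : Measurable D) (α : Fin n) :
    Measurable fun a => q.argVal (D a) α :=
  q.arg.measurable_value.comp ((measurable_pi_apply α).comp hD)

/-- The result of a product, as a function of the rows. -/
def Query.resVal {n : ℕ} (q : Query I J) (D : Fin n → Term I J → ℝ) : Fin n → ℝ :=
  fun α => D α q.term

omit [Fintype I] in
@[fun_prop]
theorem Query.measurable_resVal {n : ℕ} {𝓐 : Type*} [MeasurableSpace 𝓐] (q : Query I J)
    {D : 𝓐 → Fin n → Term I J → ℝ} (hD : Measurable D) (α : Fin n) :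
    Measurable fun a => q.resVal (D a) α :=
  (measurable_pi_apply _).comp ((measurable_pi_apply α).comp hD)

end Rows

/-! ### What the rows reveal about the matrices -/

section Known

open Matrix

variable {I J : Type*} {n : ℕ}

/-- The projection that kills `h` in addition to the kernel of the projection `Q`. -/
def residual (Q : Matrix (Fin n) (Fin n) ℝ) (h : Fin n → ℝ) : Matrix (Fin n) (Fin n) ℝ :=
  Q - vecMulVec (Q *ᵥ h) (((Q *ᵥ h) ⬝ᵥ (Q *ᵥ h))⁻¹ • (Q *ᵥ h))

theorem residual_transpose {Q : Matrix (Fin n) (Fin n) ℝ} (hQ : Qᵀ = Q) (h : Fin n → ℝ) :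
    (residual Q h)ᵀ = residual Q h := by
  rw [residual, transpose_sub, hQ, transpose_vecMulVec, smul_vecMulVec, vecMulVec_smul]

theorem residual_eq_mul {Q : Matrix (Fin n) (Fin n) ℝ} (hQ : Q * Q = Q) (h : Fin n → ℝ) :
    residual Q h = Q * (1 - vecMulVec (Q *ᵥ h) (((Q *ᵥ h) ⬝ᵥ (Q *ᵥ h))⁻¹ • (Q *ᵥ h))) := by
  rw [residual, mul_sub, mul_one, mul_vecMulVec, mulVec_mulVec, hQ]

theorem residual_mulVec_of_mulVec_eq_zero {Q : Matrix (Fin n) (Fin n) ℝ} (hQ : Qᵀ = Q)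
    (h : Fin n → ℝ) {x : Fin n → ℝ} (hx : Q *ᵥ x = 0) : residual Q h *ᵥ x = 0 := by
  have : (Q *ᵥ h) ⬝ᵥ x = 0 := by
    rw [dotProduct_comm, dotProduct_mulVec, ← mulVec_transpose, hQ, hx, zero_dotProduct]
  rw [residual, sub_mulVec, hx, vecMulVec_mulVec, smul_dotProduct, this]
  simp

theorem dotProduct_proj {Q : Matrix (Fin n) (Fin n) ℝ} (hQ : Qᵀ = Q) (hQ2 : Q * Q = Q)
    (h : Fin n → ℝ) : (Q *ᵥ h) ⬝ᵥ h = (Q *ᵥ h) ⬝ᵥ (Q *ᵥ h) := by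
  conv_rhs => rw [dotProduct_mulVec, ← mulVec_transpose, hQ, mulVec_mulVec, hQ2]

theorem residual_mulVec_self {Q : Matrix (Fin n) (Fin n) ℝ} (hQ : Qᵀ = Q) (hQ2 : Q * Q = Q)
    (h : Fin n → ℝ) : residual Q h *ᵥ h = 0 := by
  rw [residual, sub_mulVec, vecMulVec_mulVec, smul_dotProduct, dotProduct_proj hQ hQ2]
  -- If Q h = 0, the inverse is 0 by convention and the residual is Q itself, which already kills h.
  by_cases hv : (Q *ᵥ h) ⬝ᵥ (Q *ᵥ h) = 0
  · rw [dotProduct_self_eq_zero.1 hv]; simp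
  · rw [smul_eq_mul, inv_mul_cancel₀ hv]; simp

theorem residual_sq {Q : Matrix (Fin n) (Fin n) ℝ} (hQ : Qᵀ = Q) (hQ2 : Q * Q = Q)
    (h : Fin n → ℝ) : residual Q h * residual Q h = residual Q h := by
  have h1 : residual Q h *ᵥ (Q *ᵥ h) = 0 := by
    have : Q *ᵥ h = h - (h - Q *ᵥ h) := by simp
    rw [this, mulVec_sub, residual_mulVec_self hQ hQ2,
      residual_mulVec_of_mulVec_eq_zero hQ h (by rw [mulVec_sub, mulVec_mulVec, hQ2, sub_self])]
    simp
  have h2 : residual Q h * Q = residual Q h := by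
    rw [residual, sub_mul, hQ2, vecMulVec_mul, smul_vecMul, ← mulVec_transpose, hQ, mulVec_mulVec, hQ2]
  conv_lhs => enter [2]; rw [residual]
  rw [mul_sub, h2, mul_vecMulVec, h1]
  simp

variable [Fintype I]

open scoped Classical in
/-- The projection away from the arguments of the products of a list that use a given matrix on a
given side. -/
def proj : List (Query I J) → (Fin n → Term I J → ℝ) → Bool → J → Matrix (Fin n) (Fin n) ℝ
  | [], _, _, _ => 1
  | q :: l, D, b, W =>
    if b = q.side ∧ W = q.mat then residual (proj l D b W) (q.argVal D) else proj l D b W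

open scoped Classical in
/-- The part of a matrix that is determined by the results of a list of products. -/
def known : List (Query I J) → (Fin n → Term I J → ℝ) → J → Matrix (Fin n) (Fin n) ℝ
  | [], _, _ => 0
  | q :: l, D, W =>
    if W = q.mat then
      let u := proj l D q.side W *ᵥ q.argVal D
      side q.side (side q.side (known l D W) +
        vecMulVec (√(n : ℝ) • q.resVal D - side q.side (known l D W) *ᵥ q.argVal D)
          ((u ⬝ᵥ u)⁻¹ • u))
    else known l D W

variable {l : List (Query I J)} {D D' : Fin n → Term I J → ℝ}

omit [Fintype I] in
theorem proj_cons_self (q : Query I J) :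
    proj (q :: l) D q.side q.mat = residual (proj l D q.side q.mat) (q.argVal D) := by
  simp [proj]

omit [Fintype I] in
theorem proj_cons_not (q : Query I J) (W : J) :
    proj (q :: l) D (!q.side) W = proj l D (!q.side) W := by
  simp [proj]

omit [Fintype I] in
theorem proj_cons_of_ne {q : Query I J} {W : J} (h : W ≠ q.mat) (b : Bool) :
    proj (q :: l) D b W = proj l D b W := by
  simp [proj, h]

omit [Fintype I] in
theorem known_cons_self (q : Query I J) :
    known (q :: l) D q.mat = side q.side (side q.side (known l D q.mat) +
      vecMulVec (√(n : ℝ) • q.resVal D - side q.side (known l D q.mat) *ᵥ q.argVal D)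
        (((proj l D q.side q.mat *ᵥ q.argVal D) ⬝ᵥ (proj l D q.side q.mat *ᵥ q.argVal D))⁻¹ •
          (proj l D q.side q.mat *ᵥ q.argVal D))) := by
  simp [known]

omit [Fintype I] in
theorem known_cons_of_ne {q : Query I J} {W : J} (h : W ≠ q.mat) :
    known (q :: l) D W = known l D W := by
  simp [known, h]

omit [Fintype I] in
theorem proj_transpose (b : Bool) (W : J) : (proj l D b W)ᵀ = proj l D b W := by
  induction l with
  | nil => simp [proj]
  | cons q l ih =>
    rw [proj]
    split_ifs
    · exact residual_transpose ih _
    · exact ih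

omit [Fintype I] in
theorem proj_mul_self (b : Bool) (W : J) : proj l D b W * proj l D b W = proj l D b W := by
  induction l with
  | nil => simp [proj]
  | cons q l ih =>
    rw [proj]
    split_ifs
    · exact residual_sq (proj_transpose b W) ih _
    · exact ih

omit [Fintype I] in
theorem proj_mulVec_argVal {q : Query I J} (hq : q ∈ l) :
    proj l D q.side q.mat *ᵥ q.argVal D = 0 := by
  induction l with
  | nil => simp at hq
  | cons q' l ih =>
    rw [proj]
    split_ifs with h
    · rcases List.mem_cons.1 hq with rfl | hq
      · exact residual_mulVec_self (proj_transpose _ _) (proj_mul_self _ _) _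
      · exact residual_mulVec_of_mulVec_eq_zero (proj_transpose _ _) _ (ih hq)
    · rcases List.mem_cons.1 hq with rfl | hq
      · exact absurd ⟨rfl, rfl⟩ h
      · exact ih hq

omit [Fintype I] in
-- Together with `proj_mulVec_argVal` and symmetry, this identifies the recursively defined `proj`
-- as the orthogonal projection away from the span of the arguments, whatever the order of the list.
theorem sub_proj_mulVec_mem_span (b : Bool) (W : J) (x : Fin n → ℝ) :
    x - proj l D b W *ᵥ x ∈
      Submodule.span ℝ {v | ∃ q ∈ l, q.side = b ∧ q.mat = W ∧ v = q.argVal D} := by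
  induction l generalizing x with
  | nil => simp [proj]
  | cons q l ih =>
    have hmono : Submodule.span ℝ {v | ∃ q ∈ l, q.side = b ∧ q.mat = W ∧ v = q.argVal D} ≤
        Submodule.span ℝ {v | ∃ q' ∈ q :: l, q'.side = b ∧ q'.mat = W ∧ v = q'.argVal D} :=
      Submodule.span_mono fun v ⟨q', h1, h2⟩ => ⟨q', List.mem_cons_of_mem _ h1, h2⟩
    rw [proj]
    split_ifs with h
    · have h1 := hmono (ih x)
      have h2 := hmono (ih (q.argVal D))
      have h3 : q.argVal D ∈ Submodule.span ℝ
          {v | ∃ q' ∈ q :: l, q'.side = b ∧ q'.mat = W ∧ v = q'.argVal D} :=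
        Submodule.subset_span ⟨q, List.mem_cons_self, h.1.symm, h.2.symm, rfl⟩
      have h4 := Submodule.sub_mem _ h3 h2
      rw [sub_sub_cancel] at h4
      rw [residual, sub_mulVec, vecMulVec_mulVec, ← sub_add, op_smul_eq_smul]
      refine Submodule.add_mem _ h1 ?_
      exact Submodule.smul_mem _ _ h4
    · exact hmono (ih x)

theorem argVal_congr {q : Query I J} (hq : q.arg.gvars ⊆ gset l)
    (h : ∀ α, ∀ g ∈ gset l, D α g = D' α g) : q.argVal D = q.argVal D' :=
  funext fun α => Term.value_congr fun g hg => h α g (hq hg)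

/-- In a valid list all arguments are functions of the coordinates in `gset l`, so a newly adjoined
coordinate does not disturb what was computed from the earlier rows. -/
theorem proj_congr (hl : Valid l) (h : ∀ α, ∀ g ∈ gset l, D α g = D' α g) :
    proj l D = proj l D' := by
  classical
  induction l with
  | nil => rfl
  | cons q l ih =>
    have h' : ∀ α, ∀ g ∈ gset l, D α g = D' α g :=
      fun α g hg => h α g (Finset.mem_insert_of_mem hg)
    ext b W : 2
    simp only [proj]
    rw [ih hl.1 h', argVal_congr hl.2.1 h']

theorem known_congr (hl : Valid l) (h : ∀ α, ∀ g ∈ gset l, D α g = D' α g) :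
    known l D = known l D' := by
  classical
  induction l with
  | nil => rfl
  | cons q l ih =>
    have h' : ∀ α, ∀ g ∈ gset l, D α g = D' α g :=
      fun α g hg => h α g (Finset.mem_insert_of_mem hg)
    have h3 : q.resVal D = q.resVal D' :=
      funext fun α => h α _ (Finset.mem_insert_self _ _)
    ext W : 1
    simp only [known]
    rw [ih hl.1 h', argVal_congr hl.2.1 h', proj_congr hl.1 h', h3]

omit [Fintype I] in
@[fun_prop]
theorem measurable_proj {𝓐 : Type*} [MeasurableSpace 𝓐] (l : List (Query I J))
    {D : 𝓐 → Fin n → Term I J → ℝ} (hD : Measurable D) (b : Bool) (W : J) (i j : Fin n) :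
    Measurable fun a => proj l (D a) b W i j := by
  induction l generalizing i j with
  | nil => exact measurable_const
  | cons q l ih =>
    simp only [proj]
    split_ifs
    · simp only [residual, Matrix.sub_apply, vecMulVec_apply, mulVec, dotProduct, Pi.smul_apply,
        smul_eq_mul]
      fun_prop
    · exact ih i j

@[fun_prop]
theorem measurable_side_apply {𝓐 : Type*} [MeasurableSpace 𝓐] (b : Bool)
    {A : 𝓐 → Matrix (Fin n) (Fin n) ℝ} (hA : ∀ i j, Measurable fun a => A a i j) (i j : Fin n) :
    Measurable fun a => side b (A a) i j := by
  cases b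
  · exact hA j i
  · exact hA i j

omit [Fintype I] in
@[fun_prop]
theorem measurable_known {𝓐 : Type*} [MeasurableSpace 𝓐] (l : List (Query I J))
    {D : 𝓐 → Fin n → Term I J → ℝ} (hD : Measurable D) (W : J) (i j : Fin n) :
    Measurable fun a => known l (D a) W i j := by
  induction l generalizing i j with
  | nil => exact measurable_const
  | cons q l ih =>
    simp only [known]
    split_ifs
    · refine measurable_side_apply _ (fun i j => ?_) i j
      have := fun i j => measurable_side_apply q.side ih i j
      simp only [Matrix.add_apply, vecMulVec_apply, mulVec, dotProduct, Pi.smul_apply, Pi.sub_apply,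
        smul_eq_mul]
      fun_prop
    · exact ih i j

omit [Fintype I] in
theorem side_proj_mul_mul (b : Bool) (W : J) (A : Matrix (Fin n) (Fin n) ℝ) :
    side b (proj l D false W * A * proj l D true W) =
      proj l D (!b) W * side b A * proj l D b W := by
  cases b
  · simp [side, transpose_mul, proj_transpose, mul_assoc]
  · simp [side]

/-- The decomposition A = K + R A Q is updated by each product. Since A h - K h = R A (Q h), the
result reveals R A Q along the direction of Q h. This rank-one piece moves into the known part, and
Q shrinks to the residual projection. -/
theorem of_eq_known_add (hl : Valid l) (θ : Params I J n) (W : J) :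
    of (θ.2 W) = known l (rows l θ) W +
      proj l (rows l θ) false W * of (θ.2 W) * proj l (rows l θ) true W := by
  classical
  induction l generalizing W with
  | nil => simp [known, proj]
  | cons q l ih =>
    have hD : ∀ α, ∀ g ∈ gset l, rows (q :: l) θ α g = rows l θ α g := fun α g hg => by
      rw [rows_of_mem (Finset.mem_insert_of_mem hg), rows_of_mem hg]
    have hp := proj_congr hl.1 hD
    have hk := known_congr hl.1 hD
    have ha := argVal_congr hl.2.1 hD
    by_cases hW : W = q.mat
    · subst hW
      rw [← (Function.LeftInverse.injective (side_side q.side)).eq_iff, side_add,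
        side_proj_mul_mul]
      have h1 := congrArg (side q.side) (ih hl.1 q.mat)
      rw [side_add, side_proj_mul_mul] at h1
      -- The rows store results with the normalization n^(-1/2), which is undone here. The index α
      -- guarantees n ≠ 0.
      have hg : √(n : ℝ) • q.resVal (rows (q :: l) θ) =
          side q.side (of (θ.2 q.mat)) *ᵥ q.argVal (rows l θ) := by
        ext α
        have hn : √(n : ℝ) ≠ 0 := (Real.sqrt_pos.2 (by exact_mod_cast α.pos)).ne'
        have h2 : q.arg.eval θ = q.argVal (rows l θ) :=
          funext fun α => (value_rows hl.2.1 θ α).symm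
        rw [Pi.smul_apply, Query.resVal, rows_of_mem (Finset.mem_insert_self _ _),
          Query.eval_term, h2, smul_eq_mul, mul_inv_cancel_left₀ hn]
      rw [known_cons_self, proj_cons_self, proj_cons_not, side_side, hp, hk, ha, hg]
      set A := side q.side (of (θ.2 q.mat))
      set Q := proj l (rows l θ) q.side q.mat
      set R := proj l (rows l θ) (!q.side) q.mat
      set K := side q.side (known l (rows l θ) q.mat)
      set h := q.argVal (rows l θ)
      have h3 : A *ᵥ h - K *ᵥ h = (R * A) *ᵥ (Q *ᵥ h) := by
        rw [← sub_mulVec, sub_eq_of_eq_add' h1, mulVec_mulVec]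
      rw [h3, residual, mul_sub, mul_vecMulVec]
      conv_lhs => rw [h1]
      abel
    · rw [known_cons_of_ne hW, proj_cons_of_ne hW, proj_cons_of_ne hW, hp, hk]
      exact ih hl.1 W

theorem side_of_eq_known_add (hl : Valid l) (θ : Params I J n) (b : Bool) (W : J) :
    side b (of (θ.2 W)) = side b (known l (rows l θ) W) +
      proj l (rows l θ) (!b) W * side b (of (θ.2 W)) * proj l (rows l θ) b W := by
  rw [← side_proj_mul_mul, ← side_add, ← of_eq_known_add hl]

end Known

/-! ### The part of the matrices that remains random given the rows. -/

section Unknown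

open Matrix

variable {I J : Type*} {n : ℕ}

/-- The part of the matrices about which a list of products reveals nothing. -/
def unknown (l : List (Query I J)) (D : Fin n → Term I J → ℝ) (ω : J → Fin n → Fin n → ℝ) :
    J → Fin n → Fin n → ℝ :=
  fun W i j => (proj l D false W * of (ω W) * proj l D true W) i j

theorem side_unknown (l : List (Query I J)) (D : Fin n → Term I J → ℝ) (ω : J → Fin n → Fin n → ℝ)
    (b : Bool) (W : J) :
    side b (of (unknown l D ω W)) = proj l D (!b) W * side b (of (ω W)) * proj l D b W :=
  side_proj_mul_mul b W (of (ω W))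

theorem measurable_mul_apply {𝓐 : Type*} [MeasurableSpace 𝓐] {A B : 𝓐 → Matrix (Fin n) (Fin n) ℝ}
    (hA : ∀ i j, Measurable fun a => A a i j) (hB : ∀ i j, Measurable fun a => B a i j)
    (i j : Fin n) : Measurable fun a => (A a * B a) i j := by
  simp only [Matrix.mul_apply]
  exact Finset.measurable_sum _ fun k _ => (hA i k).mul (hB k j)

theorem measurable_mulVec_apply {𝓐 : Type*} [MeasurableSpace 𝓐] {A : 𝓐 → Matrix (Fin n) (Fin n) ℝ}
    {v : 𝓐 → Fin n → ℝ} (hA : ∀ i j, Measurable fun a => A a i j)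
    (hv : ∀ i, Measurable fun a => v a i) (i : Fin n) : Measurable fun a => (A a *ᵥ v a) i := by
  simp only [Matrix.mulVec, dotProduct]
  exact Finset.measurable_sum _ fun k _ => (hA i k).mul (hv k)

theorem measurable_unknown {𝓐 : Type*} [MeasurableSpace 𝓐] (l : List (Query I J))
    {D : 𝓐 → Fin n → Term I J → ℝ} (hD : Measurable D) {ω : 𝓐 → J → Fin n → Fin n → ℝ}
    (hω : Measurable ω) : Measurable fun a => unknown l (D a) (ω a) := by
  refine measurable_pi_lambda _ fun W => measurable_pi_lambda _ fun i => measurable_pi_lambda _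
    fun j => ?_
  refine measurable_mul_apply (measurable_mul_apply (measurable_proj l hD false W) ?_)
    (measurable_proj l hD true W) i j
  intro i j
  simp only [of_apply]
  fun_prop

/-- The result of a new product, in terms of the rows and the unknown part of the matrices. -/
def newVal (l : List (Query I J)) (q : Query I J)
    (p : (Fin n → Term I J → ℝ) × (J → Fin n → Fin n → ℝ)) : Fin n → ℝ :=
  fun α => (√(n : ℝ))⁻¹ *
    ((side q.side (known l p.1 q.mat) + side q.side (of (p.2 q.mat))) *ᵥ q.argVal p.1) α

theorem measurable_newVal (l : List (Query I J)) (q : Query I J) :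
    Measurable (newVal (n := n) l q) := by
  refine measurable_pi_lambda _ fun α => Measurable.const_mul ?_ _
  refine measurable_mulVec_apply (fun i j => ?_) (fun i => by fun_prop) α
  refine (measurable_side_apply _ (measurable_known l measurable_fst _) i j).add
    (measurable_side_apply _ (fun i j => ?_) i j)
  simp only [of_apply]
  fun_prop

open scoped Classical in
/-- The rows with the result of a new product adjoined. -/
def extend (q : Query I J) (p : (Fin n → Term I J → ℝ) × (Fin n → ℝ)) : Fin n → Term I J → ℝ :=
  fun α => Function.update (p.1 α) q.term (p.2 α)

theorem measurable_extend (q : Query I J) : Measurable (extend (n := n) q) := by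
  classical
  refine measurable_pi_lambda _ fun α => ?_
  refine measurable_update'.comp (Measurable.prodMk ?_ ?_)
  · exact (measurable_pi_apply α).comp measurable_fst
  · exact (measurable_pi_apply α).comp measurable_snd

open scoped Classical in
/-- The unknown part of the matrices after a new product. -/
def newUnknown (l : List (Query I J)) (q : Query I J)
    (p : (Fin n → Term I J → ℝ) × (J → Fin n → Fin n → ℝ)) : J → Fin n → Fin n → ℝ :=
  fun W => if W = q.mat then
    let u := proj l p.1 q.side W *ᵥ q.argVal p.1
    fun i j => side q.side (side q.side (of (p.2 W)) * (1 - vecMulVec u ((u ⬝ᵥ u)⁻¹ • u))) i j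
  else p.2 W

theorem measurable_newUnknown (l : List (Query I J)) (q : Query I J) :
    Measurable (newUnknown (n := n) l q) := by
  classical
  refine measurable_pi_lambda _ fun W => ?_
  simp only [newUnknown]
  split_ifs
  · refine measurable_pi_lambda _ fun i => measurable_pi_lambda _ fun j => ?_
    refine measurable_side_apply _ (measurable_mul_apply (measurable_side_apply _ ?_) ?_) i j
    · intro i j
      simp only [of_apply]
      fun_prop
    · intro i j
      have hu : ∀ i, Measurable fun p : (Fin n → Term I J → ℝ) × (J → Fin n → Fin n → ℝ) =>
          (proj l p.1 q.side W *ᵥ q.argVal p.1) i :=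
        measurable_mulVec_apply (measurable_proj l measurable_fst _ _) fun i => by fun_prop
      simp only [Matrix.sub_apply, vecMulVec_apply, Pi.smul_apply, smul_eq_mul, dotProduct]
      fun_prop
  · fun_prop

theorem newVal_congr {l : List (Query I J)} {q : Query I J} {D : Fin n → Term I J → ℝ}
    {N N' : J → Fin n → Fin n → ℝ} (h : side q.side (of (N q.mat)) *ᵥ q.argVal D =
      side q.side (of (N' q.mat)) *ᵥ q.argVal D) : newVal l q (D, N) = newVal l q (D, N') := by
  ext α
  rw [newVal, newVal, add_mulVec, add_mulVec, h]

theorem newUnknown_congr {l : List (Query I J)} {q : Query I J} {D : Fin n → Term I J → ℝ}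
    {N N' : J → Fin n → Fin n → ℝ} (hne : ∀ W ≠ q.mat, N W = N' W)
    (h : side q.side (of (N q.mat)) * (1 - vecMulVec (proj l D q.side q.mat *ᵥ q.argVal D)
        (((proj l D q.side q.mat *ᵥ q.argVal D) ⬝ᵥ (proj l D q.side q.mat *ᵥ q.argVal D))⁻¹ •
          (proj l D q.side q.mat *ᵥ q.argVal D))) =
      side q.side (of (N' q.mat)) * (1 - vecMulVec (proj l D q.side q.mat *ᵥ q.argVal D)
        (((proj l D q.side q.mat *ᵥ q.argVal D) ⬝ᵥ (proj l D q.side q.mat *ᵥ q.argVal D))⁻¹ •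
          (proj l D q.side q.mat *ᵥ q.argVal D)))) :
    newUnknown l q (D, N) = newUnknown l q (D, N') := by
  ext W i j
  by_cases hW : W = q.mat
  · subst hW
    simp only [newUnknown, if_true, h]
  · simp only [newUnknown, hW, if_false, hne W hW]

theorem mixAt_of_ne {b : Bool} {W W' : J} (h : W' ≠ W) (v : Fin n → ℝ)
    (p : (J → Fin n → Fin n → ℝ) × (J → Fin n → Fin n → ℝ)) : mixAt b W v p W' = p.1 W' := by
  simp [mixAt, h]

theorem side_mixAt (b : Bool) (W : J) (v : Fin n → ℝ)
    (p : (J → Fin n → Fin n → ℝ) × (J → Fin n → Fin n → ℝ)) :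
    side b (of (mixAt b W v p W)) = mix v (side b (of (p.1 W))) (side b (of (p.2 W))) := by
  rw [show mixAt b W v p W = _ from if_pos rfl]
  exact side_side b _

variable [Fintype I]

theorem rows_cons {l : List (Query I J)} {q : Query I J} (hl : Valid (q :: l)) (θ : Params I J n) :
    rows (q :: l) θ =
      extend q (rows l θ, newVal l q (rows l θ, unknown l (rows l θ) θ.2)) := by
  ext α : 1
  simp only [rows, extend]
  congr 1
  rw [Query.eval_term, newVal, side_unknown, ← side_of_eq_known_add hl.1]
  congr 2
  exact funext fun α => (value_rows hl.2.1 θ α).symm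

/-- Factoring the residual projection as Q(1 - uuᵀ/|u|²) shows that the new unknown part is a
function of the old rows and the old unknown part. This makes an induction on the list possible. -/
theorem unknown_extend {l : List (Query I J)} {q : Query I J} (hl : Valid (q :: l))
    (D : Fin n → Term I J → ℝ) (v : Fin n → ℝ) (ω : J → Fin n → Fin n → ℝ) :
    unknown (q :: l) (extend q (D, v)) ω = newUnknown l q (D, unknown l D ω) := by
  classical
  have hD : ∀ α, ∀ g ∈ gset l, extend q (D, v) α g = D α g := fun α g hg => by
    simp only [extend]
    refine Function.update_of_ne ?_ _ _
    rintro rfl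
    exact hl.2.2 hg
  have hp := proj_congr hl.1 hD
  have ha := argVal_congr hl.2.1 hD
  ext W i j
  by_cases hW : W = q.mat
  · subst hW
    simp only [newUnknown, if_true]
    suffices h : of (unknown (q :: l) (extend q (D, v)) ω q.mat) =
        side q.side (side q.side (of (unknown l D ω q.mat)) *
          (1 - vecMulVec (proj l D q.side q.mat *ᵥ q.argVal D)
          (((proj l D q.side q.mat *ᵥ q.argVal D) ⬝ᵥ (proj l D q.side q.mat *ᵥ q.argVal D))⁻¹ •
            (proj l D q.side q.mat *ᵥ q.argVal D)))) from congrFun (congrFun h i) j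
    rw [← (Function.LeftInverse.injective (side_side q.side)).eq_iff, side_side, side_unknown,
      side_unknown, proj_cons_not, proj_cons_self, hp, ha, residual_eq_mul (proj_mul_self _ _)]
    simp only [mul_assoc]
  · simp only [newUnknown, hW, if_false, unknown]
    rw [proj_cons_of_ne hW, proj_cons_of_ne hW, hp]

variable [DecidableEq I] [Fintype J]

instance Init.isProbabilityMeasure_law (ν : Init I J) (n : ℕ) :
    IsProbabilityMeasure (ν.law n) := by
  unfold Init.law; infer_instance

/-- The unknown part of the matrices is conditionally distributed, given the rows, as if the
matrices were independent of the rows. -/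
theorem law_map_rows_unknown (ν : Init I J) {l : List (Query I J)} (hl : Valid l) (n : ℕ) :
    (ν.law n).map (fun θ => (rows l θ, unknown l (rows l θ) θ.2)) =
      ((ν.law n).prod (matLaw n ν.std)).map fun p => (rows l p.1, unknown l (rows l p.1) p.2) := by
  classical
  induction l with
  | nil =>
    -- Without products the projections are the identity, the unknown part is all of the matrices,
    -- and these are independent of the input vectors.
    have h1 : MeasurePreserving (fun p : Params I J n × (J → Fin n → Fin n → ℝ) => (p.1.1, p.2))
        ((ν.law n).prod (matLaw n ν.std)) (ν.law n) :=
      (measurePreserving_fst.prod (MeasurePreserving.id _))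
    have hm : Measurable fun θ : Params I J n =>
        (rows ([] : List (Query I J)) θ, unknown [] (rows [] θ) θ.2) :=
      (measurable_rows _).prodMk (measurable_unknown _ (measurable_rows _) measurable_snd)
    conv_lhs => rw [← h1.map_eq]
    rw [Measure.map_map hm h1.measurable]
    rfl
  | cons q l ih =>
    have ih := ih hl.1
    set μ := ν.law n
    set ρ := matLaw n ν.std
    -- all maps involved, with their measurability
    have hr : Measurable fun θ : Params I J n => rows l θ := measurable_rows l
    have hN : Measurable fun θ : Params I J n => (rows l θ, unknown l (rows l θ) θ.2) :=
      hr.prodMk (measurable_unknown l hr measurable_snd)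
    have hN' : Measurable fun p : Params I J n × (J → Fin n → Fin n → ℝ) =>
        (rows l p.1, unknown l (rows l p.1) p.2) :=
      (hr.comp measurable_fst).prodMk
        (measurable_unknown l (hr.comp measurable_fst) measurable_snd)
    let A : (Fin n → Term I J → ℝ) × (J → Fin n → Fin n → ℝ) → Fin n → Term I J → ℝ :=
      fun p => extend q (p.1, newVal l q p)
    have hA : Measurable A :=
      (measurable_extend q).comp (measurable_fst.prodMk (measurable_newVal l q))
    have hB := measurable_newUnknown (n := n) l q
    have hAB : Measurable fun p => (A p, newUnknown l q p) := hA.prodMk hB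
    have hC : Measurable fun p : ((Fin n → Term I J → ℝ) × (J → Fin n → Fin n → ℝ)) ×
        (J → Fin n → Fin n → ℝ) => (A p.1, newUnknown l q (p.1.1, unknown l p.1.1 p.2)) :=
      (hA.comp measurable_fst).prodMk (hB.comp ((measurable_fst.comp measurable_fst).prodMk
        (measurable_unknown l (measurable_fst.comp measurable_fst) measurable_snd)))
    let u : Params I J n → Fin n → ℝ := fun θ => proj l (rows l θ) q.side q.mat *ᵥ
      q.argVal (rows l θ)
    have hu : ∀ i, Measurable fun θ => u θ i :=
      measurable_mulVec_apply (measurable_proj l hr _ _) fun i => by fun_prop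
    have hmix : Measurable fun p : Params I J n × ((J → Fin n → Fin n → ℝ) ×
        (J → Fin n → Fin n → ℝ)) => mixAt q.side q.mat (u p.1) p.2 := by
      refine measurable_pi_lambda _ fun W => ?_
      simp only [mixAt]
      split_ifs
      · refine measurable_pi_lambda _ fun i => measurable_pi_lambda _ fun j => ?_
        refine measurable_side_apply _ (fun i j => ?_) i j
        have h1 : ∀ i j, Measurable fun p : Params I J n × ((J → Fin n → Fin n → ℝ) ×
            (J → Fin n → Fin n → ℝ)) => side q.side (of (p.2.1 W)) i j :=
          measurable_side_apply _ fun i j => by simp only [of_apply]; fun_prop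
        have h2 : ∀ i j, Measurable fun p : Params I J n × ((J → Fin n → Fin n → ℝ) ×
            (J → Fin n → Fin n → ℝ)) => side q.side (of (p.2.2 W)) i j :=
          measurable_side_apply _ fun i j => by simp only [of_apply]; fun_prop
        have hu' : ∀ i, Measurable fun p : Params I J n × ((J → Fin n → Fin n → ℝ) ×
            (J → Fin n → Fin n → ℝ)) => u p.1 i := fun i => (hu i).comp measurable_fst
        simp only [mix, Matrix.add_apply, vecMulVec_apply, mulVec, dotProduct, Matrix.sub_apply,
          Pi.smul_apply, smul_eq_mul]
        fun_prop
      · fun_prop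
    -- the two sides in terms of these maps
    have hL : μ.map (fun θ => (rows (q :: l) θ, unknown (q :: l) (rows (q :: l) θ) θ.2)) =
        (μ.prod ρ).map fun p => (A (rows l p.1, unknown l (rows l p.1) p.2),
          newUnknown l q (rows l p.1, unknown l (rows l p.1) p.2)) := by
      have h2 := congrArg (Measure.map fun p => (A p, newUnknown l q p)) ih
      rw [Measure.map_map hAB hN, Measure.map_map hAB hN'] at h2
      refine Eq.trans (congrArg (fun f => Measure.map f μ) ?_) h2
      ext θ : 1
      rw [rows_cons hl, unknown_extend hl]
      rfl
    have hR : (μ.prod ρ).map (fun p => (rows (q :: l) p.1, unknown (q :: l) (rows (q :: l) p.1) p.2))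
        = ((μ.prod ρ).prod ρ).map fun p => (A (rows l p.1.1, unknown l (rows l p.1.1) p.1.2),
          newUnknown l q (rows l p.1.1, unknown l (rows l p.1.1) p.2)) := by
      have h2 := congrArg (fun m => (m.prod ρ).map fun p : ((Fin n → Term I J → ℝ) ×
        (J → Fin n → Fin n → ℝ)) × (J → Fin n → Fin n → ℝ) =>
          (A p.1, newUnknown l q (p.1.1, unknown l p.1.1 p.2))) ih
      have h3 : ∀ {𝓐 : Type _} [MeasurableSpace 𝓐] (m : Measure 𝓐) [SFinite m]
          (f : 𝓐 → (Fin n → Term I J → ℝ) × (J → Fin n → Fin n → ℝ)), Measurable f →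
          (m.map f).prod ρ = (m.prod ρ).map (Prod.map f id) := fun m _ f hf => by
        rw [← Measure.map_prod_map _ _ hf measurable_id, Measure.map_id]
      rw [h3 _ _ hN, h3 _ _ hN', Measure.map_map hC (hN.prodMap measurable_id),
        Measure.map_map hC (hN'.prodMap measurable_id)] at h2
      refine Eq.trans (congrArg (fun f => Measure.map f (μ.prod ρ)) ?_) h2
      ext p : 1
      simp only [Function.comp, Prod.map, id]
      rw [rows_cons hl, unknown_extend hl]
    -- Here lies the reason. The new result reads the fresh matrix only along u, and the new unknown
    -- part reads it only on the orthogonal complement of u. By `matLaw_map_mixAt`, a matrix equal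
    -- to one copy along u and to an independent copy on the complement has the right law given θ.
    -- The single copy used by both components in `hL` may therefore be replaced by the two
    -- independent copies in `hR`.
    have hM : (μ.prod (ρ.prod ρ)).map (fun p => (p.1, mixAt q.side q.mat (u p.1) p.2)) =
        (μ.prod ρ).map fun p => (p.1, p.2) :=
      prod_map_congr (f := fun θ => mixAt q.side q.mat (u θ)) (g := fun _ ω => ω) hmix
        measurable_snd fun θ => by rw [matLaw_map_mixAt]; exact Measure.map_id.symm
    have hAB' : Measurable fun p : Params I J n × (J → Fin n → Fin n → ℝ) =>
        (A (rows l p.1, unknown l (rows l p.1) p.2),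
          newUnknown l q (rows l p.1, unknown l (rows l p.1) p.2)) := hAB.comp hN'
    have hS : MeasurePreserving (fun p : (Params I J n × (J → Fin n → Fin n → ℝ)) ×
        (J → Fin n → Fin n → ℝ) => (p.1.1, (p.2, p.1.2))) ((μ.prod ρ).prod ρ)
        (μ.prod (ρ.prod ρ)) :=
      ((MeasurePreserving.id μ).prod Measure.measurePreserving_swap).comp
        (measurePreserving_prodAssoc μ ρ ρ)
    have h4 := congrArg (Measure.map fun p : Params I J n × (J → Fin n → Fin n → ℝ) =>
        (A (rows l p.1, unknown l (rows l p.1) p.2),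
          newUnknown l q (rows l p.1, unknown l (rows l p.1) p.2))) hM
    rw [Measure.map_map hAB' (measurable_fst.prodMk hmix), Measure.map_map hAB' (by fun_prop),
      ← hS.map_eq, Measure.map_map (hAB'.comp (measurable_fst.prodMk hmix)) hS.measurable] at h4
    rw [hL, hR]
    refine Eq.trans h4.symm ?_
    congr 1
    ext p : 1
    simp only [Function.comp]
    set D := rows l p.1.1
    have hu0 : side q.side (of (unknown l D (mixAt q.side q.mat (u p.1.1) (p.2, p.1.2)) q.mat)) *ᵥ
        q.argVal D = side q.side (of (unknown l D p.1.2 q.mat)) *ᵥ q.argVal D := by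
      have : ∀ M : Matrix (Fin n) (Fin n) ℝ, M *ᵥ (proj l D q.side q.mat *ᵥ q.argVal D) =
        M *ᵥ u p.1.1 := fun M => rfl
      rw [side_unknown, side_unknown, ← mulVec_mulVec, ← mulVec_mulVec, this, this, ← mulVec_mulVec,
        ← mulVec_mulVec]
      congr 1
      rw [side_mixAt]
      exact mix_mulVec _ _ _
    refine Prod.ext ?_ ?_
    · exact congrArg (fun v => extend q (D, v)) (newVal_congr hu0)
    · refine newUnknown_congr (fun W hW => ?_) ?_
      · ext i j
        simp only [unknown, mixAt_of_ne hW]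
      · have hv : u p.1.1 ᵥ* (proj l D q.side q.mat * (1 - vecMulVec (u p.1.1)
            (((u p.1.1) ⬝ᵥ (u p.1.1))⁻¹ • u p.1.1))) = 0 := by
          have hQ : proj l D q.side q.mat *ᵥ u p.1.1 = u p.1.1 := by
            simp only [u, mulVec_mulVec, D]
            rw [proj_mul_self]
          rw [← vecMul_vecMul, ← mulVec_transpose (proj _ _ _ _), proj_transpose, hQ, vecMul_sub, vecMul_one,
            vecMul_vecMulVec]
          by_cases hz : u p.1.1 ⬝ᵥ u p.1.1 = 0
          · rw [dotProduct_self_eq_zero.1 hz]; simp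
          · rw [smul_smul, mul_inv_cancel₀ hz, one_smul, sub_self]
        rw [side_unknown, side_unknown, mul_assoc, mul_assoc (_ * _) (proj l D q.side q.mat),
          mul_assoc, mul_assoc, side_mixAt]
        exact congrArg _ (mix_mul _ _ hv)

end Unknown

/-! ### The conditional law of a new product -/

section CondLaw

open Matrix

variable {I J : Type*} {n : ℕ}

/-- The conditional mean of a new product. -/
def condMean (l : List (Query I J)) (q : Query I J) (D : Fin n → Term I J → ℝ) : Fin n → ℝ :=
  fun α => (√(n : ℝ))⁻¹ * (side q.side (known l D q.mat) *ᵥ q.argVal D) α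

/-- The part of the argument of a new product that is orthogonal to the earlier arguments. -/
def newPart (l : List (Query I J)) (q : Query I J) (D : Fin n → Term I J → ℝ) : Fin n → ℝ :=
  proj l D q.side q.mat *ᵥ q.argVal D

/-- The conditional standard deviation of a new product. -/
def condStd (σ : J → ℝ≥0) (l : List (Query I J)) (q : Query I J) (D : Fin n → Term I J → ℝ) : ℝ :=
  (√(n : ℝ))⁻¹ * (σ q.mat * √(newPart l q D ⬝ᵥ newPart l q D))

theorem measurable_condMean (l : List (Query I J)) (q : Query I J) :
    Measurable (condMean (n := n) l q) := by
  refine measurable_pi_lambda _ fun α => Measurable.const_mul ?_ _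
  exact measurable_mulVec_apply (measurable_side_apply _ (measurable_known l measurable_id _))
    (fun i => q.measurable_argVal measurable_id i) α

theorem measurable_condStd (σ : J → ℝ≥0) (l : List (Query I J)) (q : Query I J) :
    Measurable (condStd (n := n) σ l q) := by
  have h : ∀ i, Measurable fun D : Fin n → Term I J → ℝ => newPart l q D i :=
    measurable_mulVec_apply (measurable_proj l measurable_id _ _)
      fun i => q.measurable_argVal measurable_id i
  unfold condStd
  simp only [dotProduct]
  fun_prop

variable [Fintype I] [DecidableEq I] [Fintype J]

/-- Given the rows, the unknown part may be computed from an independent copy ω of the matrices. The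
new result is then the conditional mean plus n^(-1/2) R ω u, where the new part u of the argument is
fixed by the rows, and ω u has independent normal entries of variance σ²|u|². -/
theorem law_map_rows_eval (ν : Init I J) {l : List (Query I J)} {q : Query I J}
    (hl : Valid (q :: l)) (n : ℕ) :
    (ν.law n).map (fun θ => (rows l θ, q.term.eval θ)) =
      ((ν.law n).prod (stdNormal (Fin n))).map fun p => (rows l p.1, fun α =>
        condMean l q (rows l p.1) α +
          condStd ν.std l q (rows l p.1) * (proj l (rows l p.1) (!q.side) q.mat *ᵥ p.2) α) := by
  have hr : Measurable fun θ : Params I J n => rows l θ := measurable_rows l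
  have hN : Measurable fun θ : Params I J n => (rows l θ, unknown l (rows l θ) θ.2) :=
    hr.prodMk (measurable_unknown l hr measurable_snd)
  have hN' : Measurable fun p : Params I J n × (J → Fin n → Fin n → ℝ) =>
      (rows l p.1, unknown l (rows l p.1) p.2) :=
    (hr.comp measurable_fst).prodMk
      (measurable_unknown l (hr.comp measurable_fst) measurable_snd)
  have hA : Measurable fun p : (Fin n → Term I J → ℝ) × (J → Fin n → Fin n → ℝ) =>
      (p.1, newVal l q p) := measurable_fst.prodMk (measurable_newVal l q)
  have h1 := congrArg (Measure.map fun p => (p.1, newVal l q p)) (law_map_rows_unknown ν hl.1 n)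
  rw [Measure.map_map hA hN, Measure.map_map hA hN'] at h1
  have hg : Measurable fun p : Params I J n × (Fin n → ℝ) => fun α => condMean l q (rows l p.1) α +
      condStd ν.std l q (rows l p.1) * (proj l (rows l p.1) (!q.side) q.mat *ᵥ p.2) α := by
    refine measurable_pi_lambda _ fun α => ?_
    have hr' : Measurable fun p : Params I J n × (Fin n → ℝ) => rows l p.1 :=
      hr.comp measurable_fst
    have h2 := ((measurable_pi_apply α).comp (measurable_condMean (n := n) l q)).comp hr'
    have h3 := (measurable_condStd (n := n) ν.std l q).comp hr'
    refine h2.add (h3.mul ?_)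
    exact measurable_mulVec_apply (measurable_proj l (hr.comp measurable_fst) _ _)
      (fun i => (measurable_pi_apply i).comp measurable_snd) α
  have hf : Measurable fun p : Params I J n × (J → Fin n → Fin n → ℝ) =>
      newVal l q (rows l p.1, unknown l (rows l p.1) p.2) := (measurable_newVal l q).comp hN'
  have h2 := prod_map_congr (μ := ν.law n) (ν₁ := matLaw n ν.std) (ν₂ := stdNormal (Fin n))
    (f := fun θ ω => newVal l q (rows l θ, unknown l (rows l θ) ω))
    (g := fun θ z α => condMean l q (rows l θ) α +
      condStd ν.std l q (rows l θ) * (proj l (rows l θ) (!q.side) q.mat *ᵥ z) α) hf hg ?_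
  · have hT : Measurable fun p : Params I J n × (Fin n → ℝ) => (rows l p.1, p.2) :=
      (hr.comp measurable_fst).prodMk measurable_snd
    have h3 := congrArg (Measure.map fun p : Params I J n × (Fin n → ℝ) => (rows l p.1, p.2)) h2
    rw [Measure.map_map hT (measurable_fst.prodMk hf),
      Measure.map_map hT (measurable_fst.prodMk hg)] at h3
    refine Eq.trans ?_ (h1.trans h3)
    congr 1
    ext θ : 1
    refine Prod.ext rfl (funext fun α => ?_)
    have := congrFun (congrFun (rows_cons hl θ) α) q.term
    simp only [rows, extend, Function.update_self] at this
    exact this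
  · intro θ
    set D := rows l θ
    have hF : Measurable fun v : Fin n → ℝ => fun α => condMean l q D α +
        (√(n : ℝ))⁻¹ * (proj l D (!q.side) q.mat *ᵥ v) α := by
      refine measurable_pi_lambda _ fun α => Measurable.const_add (Measurable.const_mul ?_ _) _
      exact (measurable_pi_apply α).comp (measurable_mulVec _)
    have h4 := congrArg (Measure.map fun v : Fin n → ℝ => fun α => condMean l q D α +
        (√(n : ℝ))⁻¹ * (proj l D (!q.side) q.mat *ᵥ v) α)
        (matLaw_map_mulVec ν.std q.side q.mat (newPart l q D))
    have h5 : Measurable fun ω : J → Fin n → Fin n → ℝ =>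
        side q.side (of (ω q.mat)) *ᵥ newPart l q D := by
      refine measurable_pi_lambda _ fun i => ?_
      have h6 : ∀ i j, Measurable fun ω : J → Fin n → Fin n → ℝ => side q.side (of (ω q.mat)) i j :=
        measurable_side_apply _ fun i j => by simp only [of_apply]; fun_prop
      exact measurable_mulVec_apply (v := fun _ => newPart l q D) h6 (fun i => measurable_const) i
    rw [Measure.map_map hF h5, Measure.map_map hF (by fun_prop)] at h4
    refine Eq.trans ?_ (h4.trans ?_)
    · congr 1
      ext ω α
      simp only [Function.comp, newVal, condMean, side_unknown, add_mulVec, Pi.add_apply, mul_add,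
        newPart, mulVec_mulVec, mul_assoc]
    · congr 1
      ext z α
      have : (fun α => (ν.std q.mat * √(newPart l q D ⬝ᵥ newPart l q D)) * z α) =
          ((ν.std q.mat : ℝ) * √(newPart l q D ⬝ᵥ newPart l q D)) • z := rfl
      simp only [Function.comp, this, mulVec_smul, Pi.smul_apply, smul_eq_mul, condStd]
      ring

/-! #### Formulas in terms of empirical averages -/

variable {r r' : Type*} [Fintype r] [DecidableEq r] [Fintype r'] [DecidableEq r']

/-- The arguments of a family of products, as functions of a row. -/
def args (Q : r → Query I J) (i : r) (z : Term I J → ℝ) : ℝ := (Q i).arg.value z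

omit [Fintype I] [DecidableEq I] [Fintype J] in
-- Both sides are symmetric, kill the arguments, and differ from the identity only by vectors in
-- their span. Calling them A and P, this gives AP = A and PA = P, and transposition yields A = P.
theorem proj_eq {l : List (Query I J)} {D : Fin n → Term I J → ℝ} {b : Bool} {W : J}
    {Q : r → Query I J} (hQ : ∀ i, Q i ∈ l ∧ (Q i).side = b ∧ (Q i).mat = W)
    (hspan : ∀ q ∈ l, q.side = b → q.mat = W → ∃ c : r → ℝ, ∀ α,
      q.argVal D α = ∑ i, c i * args Q i (D α))
    (hdet : ((design (args Q) D)ᵀ * design (args Q) D).det ≠ 0) :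
    proj l D b W = 1 - design (args Q) D *
      ((design (args Q) D)ᵀ * design (args Q) D)⁻¹ * (design (args Q) D)ᵀ := by
  set H := design (args Q) D
  set A := proj l D b W
  set P := 1 - H * (Hᵀ * H)⁻¹ * Hᵀ
  have hu : IsUnit (Hᵀ * H).det := hdet.isUnit
  have hPt : Pᵀ = P := by
    simp only [P, transpose_sub, transpose_one, transpose_mul, transpose_transpose,
      transpose_nonsing_inv, Matrix.mul_assoc]
  have hAt : Aᵀ = A := proj_transpose b W
  have hAH : A * H = 0 := by
    ext α i
    obtain ⟨h1, h2, h3⟩ := hQ i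
    have := congrFun (proj_mulVec_argVal (D := D) h1) α
    rw [h2, h3] at this
    exact this
  have hPH : P * H = 0 := by
    simp only [P, Matrix.sub_mul, Matrix.one_mul, Matrix.mul_assoc]
    rw [nonsing_inv_mul _ hu, Matrix.mul_one, sub_self]
  have h1 : A * P = A := by
    simp only [P, Matrix.mul_sub, Matrix.mul_one, ← Matrix.mul_assoc, hAH, Matrix.zero_mul, sub_zero]
  have h2 : P * A = P := by
    have h3 : ∀ v ∈ Submodule.span ℝ {v | ∃ q ∈ l, q.side = b ∧ q.mat = W ∧ v = q.argVal D},
        P *ᵥ v = 0 := by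
      intro v hv
      induction hv using Submodule.span_induction with
      | mem v hv =>
        obtain ⟨q, hq, hb, hW, rfl⟩ := hv
        obtain ⟨c, hc⟩ := hspan q hq hb hW
        have : q.argVal D = H *ᵥ c := by
          ext α
          rw [hc]
          simp only [H, design, mulVec, dotProduct, of_apply]
          exact Finset.sum_congr rfl fun i _ => mul_comm _ _
        rw [this, mulVec_mulVec, hPH, zero_mulVec]
      | zero => simp
      | add x y _ _ hx hy => rw [mulVec_add, hx, hy, add_zero]
      | smul a x _ hx => rw [mulVec_smul, hx, smul_zero]
    refine ext_of_mulVec_single fun i => ?_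
    have := h3 _ (sub_proj_mulVec_mem_span (l := l) (D := D) b W (Pi.single i 1))
    rw [mulVec_sub, mulVec_mulVec, sub_eq_zero] at this
    exact this.symm
  rw [← h1, ← hPt, ← hAt, ← transpose_mul, h2]

omit [Fintype I] [DecidableEq I] [Fintype J] in
theorem inv_mulVec_transpose_mulVec (hn : 0 < n) (h : r → (Term I J → ℝ) → ℝ)
    (x : Fin n → Term I J → ℝ) (hdet : (empGram h x).det ≠ 0) (v : Fin n → ℝ) :
    ((design h x)ᵀ * design h x)⁻¹ *ᵥ ((design h x)ᵀ *ᵥ v) =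
      (empGram h x)⁻¹ *ᵥ fun i => avg fun α => h i (x α) * v α := by
  have hn0 : (n : ℝ) ≠ 0 := by positivity
  have h2 : (design h x)ᵀ *ᵥ v = (n : ℝ) • fun j => avg fun α => h j (x α) * v α := by
    ext j
    simp [Matrix.mulVec, dotProduct, design, avg, hn0]
  let _ := invertibleOfNonzero hn0
  rw [h2, design_transpose_mul hn, Matrix.inv_smul _ _ hdet.isUnit, mulVec_smul, smul_mulVec, smul_smul]
  simp [hn0]

/-- The regression coefficients of `v` on the functions `h i`. -/
def regr (h : r → (Term I J → ℝ) → ℝ) (x : Fin n → Term I J → ℝ) (v : Fin n → ℝ) : r → ℝ :=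
  (empGram h x)⁻¹ *ᵥ fun i => avg fun α => h i (x α) * v α

omit [Fintype I] [DecidableEq I] [Fintype J] in
theorem residual_mulVec_eq (hn : 0 < n) (h : r → (Term I J → ℝ) → ℝ)
    (x : Fin n → Term I J → ℝ) (hdet : (empGram h x).det ≠ 0) (v : Fin n → ℝ) :
    (1 - design h x * ((design h x)ᵀ * design h x)⁻¹ * (design h x)ᵀ) *ᵥ v =
      v - design h x *ᵥ regr h x v := by
  rw [sub_mulVec, one_mulVec, ← mulVec_mulVec, ← mulVec_mulVec,
    inv_mulVec_transpose_mulVec hn h x hdet, regr]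

omit [DecidableEq I] [Fintype J] in
/-- The conditional mean of a new product, in terms of bases of the earlier arguments on the same
side and on the opposite side. -/
theorem condMean_eq {l : List (Query I J)} (hl : Valid l) {q : Query I J} (θ : Params I J n)
    (hn : 0 < n) {Q : r → Query I J} (hQ : ∀ i, Q i ∈ l ∧ (Q i).side = q.side ∧ (Q i).mat = q.mat)
    {Q' : r' → Query I J} (hQ' : ∀ i, Q' i ∈ l ∧ (Q' i).side = (!q.side) ∧ (Q' i).mat = q.mat)
    (hdet : (empGram (args Q) (rows l θ)).det ≠ 0) (hdet' : (empGram (args Q') (rows l θ)).det ≠ 0)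
    (hP : proj l (rows l θ) q.side q.mat = 1 - design (args Q) (rows l θ) *
      ((design (args Q) (rows l θ))ᵀ * design (args Q) (rows l θ))⁻¹ * (design (args Q) (rows l θ))ᵀ)
    (hP' : proj l (rows l θ) (!q.side) q.mat = 1 - design (args Q') (rows l θ) *
      ((design (args Q') (rows l θ))ᵀ * design (args Q') (rows l θ))⁻¹ *
        (design (args Q') (rows l θ))ᵀ) (α : Fin n) :
    condMean l q (rows l θ) α =
      ∑ i, regr (args Q) (rows l θ) (q.argVal (rows l θ)) i * rows l θ α (Q i).term +
      ∑ j, ((empGram (args Q') (rows l θ))⁻¹ *ᵥ fun j =>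
        (avg fun α => rows l θ α (Q' j).term * q.argVal (rows l θ) α) -
          ∑ i, (avg fun α => rows l θ α (Q' j).term * args Q i (rows l θ α)) *
            regr (args Q) (rows l θ) (q.argVal (rows l θ)) i) j * args Q' j (rows l θ α) := by
  set D := rows l θ
  set A := side q.side (of (θ.2 q.mat))
  set h := q.argVal D
  set H := design (args Q) D
  set Y := design (args Q') D
  set a := regr (args Q) D h
  have hn0 : (0 : ℝ) < n := by exact_mod_cast hn
  have hs : √(n : ℝ) ≠ 0 := (Real.sqrt_pos.2 hn0).ne'
  have hAq : ∀ q' ∈ l, q'.mat = q.mat → ∀ α, (side q'.side (of (θ.2 q.mat)) *ᵥ q'.argVal D) α =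
      √(n : ℝ) * D α q'.term := by
    intro q' hq' hW α
    have h2 : q'.arg.eval θ = q'.argVal D :=
      funext fun α => (value_rows (hl.gvars_arg_subset hq') θ α).symm
    rw [show D α q'.term = _ from rows_of_mem (term_mem_gset hq') θ α, Query.eval_term, h2, hW,
      mul_inv_cancel_left₀ hs]
  have hAH : A *ᵥ (H *ᵥ a) = √(n : ℝ) • fun α => ∑ i, a i * D α (Q i).term := by
    have hcol : H *ᵥ a = ∑ i, a i • (Q i).argVal D := by
      ext α
      simp only [H, design, mulVec, dotProduct, of_apply, Finset.sum_apply, Pi.smul_apply,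
        smul_eq_mul]
      exact Finset.sum_congr rfl fun i _ => mul_comm _ _
    rw [hcol, mulVec_sum]
    ext α
    simp only [Finset.sum_apply, mulVec_smul, Pi.smul_apply, smul_eq_mul, Finset.mul_sum]
    refine Finset.sum_congr rfl fun i _ => ?_
    obtain ⟨h1, h2, h3⟩ := hQ i
    have := hAq (Q i) h1 h3 α
    rw [h2] at this
    rw [this]
    ring
  set w := h - H *ᵥ a
  have hw : proj l D q.side q.mat *ᵥ h = w := by
    rw [hP, residual_mulVec_eq hn _ _ hdet]
  -- The known part is A - R A Q. Splitting h into its regression H a and the remainder w = Q h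
  -- gives A(H a) + (1 - R) A w, and 1 - R is regression on the opposite arguments.
  have hK : side q.side (known l D q.mat) *ᵥ h =
      A *ᵥ (H *ᵥ a) + Y *ᵥ regr (args Q') D (A *ᵥ w) := by
    have h1 := side_of_eq_known_add hl θ q.side q.mat
    have h2 : side q.side (known l D q.mat) *ᵥ h =
        A *ᵥ h - proj l D (!q.side) q.mat *ᵥ (A *ᵥ (proj l D q.side q.mat *ᵥ h)) := by
      rw [mulVec_mulVec, mulVec_mulVec, ← sub_mulVec]
      congr 1
      exact (sub_eq_of_eq_add h1).symm
    rw [h2, hw, hP', residual_mulVec_eq hn _ _ hdet']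
    simp only [w, mulVec_sub]
    abel
  -- Moving A to the other factor of ⟨h'ⱼ, A w⟩ turns it into ⟨Aᵀ h'ⱼ, w⟩, in which the first vector
  -- is an earlier result. The conditional mean thereby becomes a function of the rows.
  have hreg : regr (args Q') D (A *ᵥ w) = √(n : ℝ) • ((empGram (args Q') D)⁻¹ *ᵥ fun j =>
        (avg fun α => D α (Q' j).term * h α) -
          ∑ i, (avg fun α => D α (Q' j).term * args Q i (D α)) * a i) := by
    rw [regr, ← mulVec_smul]
    congr 1
    ext j
    obtain ⟨h1, h2, h3⟩ := hQ' j
    have hAt : ∀ α, (Aᵀ *ᵥ (Q' j).argVal D) α = √(n : ℝ) * D α (Q' j).term := by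
      intro α
      have := hAq (Q' j) h1 h3 α
      have h4 : Aᵀ = side (!q.side) (of (θ.2 q.mat)) := by
        simp only [A]
        cases q.side <;> simp [side]
      rw [h4, ← h2]
      exact this
    have h5 : ∑ α, args Q' j (D α) * (A *ᵥ w) α = ∑ α, √(n : ℝ) * D α (Q' j).term * w α := by
      have h6 : (Q' j).argVal D ⬝ᵥ (A *ᵥ w) = (Aᵀ *ᵥ (Q' j).argVal D) ⬝ᵥ w := by
        rw [dotProduct_mulVec, mulVec_transpose]
      simp only [dotProduct, hAt] at h6
      exact h6
    simp only [avg, h5, Pi.smul_apply, smul_eq_mul]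
    have h7 : ∑ α, √(n : ℝ) * D α (Q' j).term * w α = √(n : ℝ) * (∑ α, D α (Q' j).term * h α -
        ∑ i, (∑ α, D α (Q' j).term * args Q i (D α)) * a i) := by
      simp only [w, H, design, Pi.sub_apply, mulVec, dotProduct, of_apply, mul_sub,
        Finset.sum_sub_distrib, Finset.mul_sum, Finset.sum_mul]
      congr 1
      · exact Finset.sum_congr rfl fun α _ => by ring
      · rw [Finset.sum_comm]
        exact Finset.sum_congr rfl fun i _ => Finset.sum_congr rfl fun α _ => by ring
    rw [h7, mul_left_comm, mul_sub]
    congr 2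
    rw [Finset.mul_sum]
    exact Finset.sum_congr rfl fun i _ => (mul_assoc _ _ _).symm
  rw [condMean, hK, hAH, hreg, mulVec_smul, ← smul_add, Pi.smul_apply, smul_eq_mul,
    inv_mul_cancel_left₀ hs, Pi.add_apply]
  congr 1
  simp only [Y, design, mulVec, dotProduct, of_apply]
  exact Finset.sum_congr rfl fun j _ => mul_comm _ _

omit [Fintype I] [DecidableEq I] [Fintype J] in
-- Pythagoras: |Q h|² = ⟨Q h, h⟩ for an orthogonal projection, and Q h is the regression remainder.
theorem condStd_eq {l : List (Query I J)} {q : Query I J} (σ : J → ℝ≥0)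
    (D : Fin n → Term I J → ℝ) (hn : 0 < n) {Q : r → Query I J}
    (hdet : (empGram (args Q) D).det ≠ 0)
    (hP : proj l D q.side q.mat = 1 - design (args Q) D *
      ((design (args Q) D)ᵀ * design (args Q) D)⁻¹ * (design (args Q) D)ᵀ) :
    condStd σ l q D = √((σ q.mat : ℝ) ^ 2 * ((avg fun α => q.argVal D α ^ 2) -
      ∑ i, regr (args Q) D (q.argVal D) i * avg fun α => args Q i (D α) * q.argVal D α)) := by
  have hn0 : (0 : ℝ) < n := by exact_mod_cast hn
  set h := q.argVal D
  have h1 : newPart l q D ⬝ᵥ newPart l q D = (n : ℝ) * ((avg fun α => h α ^ 2) -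
      ∑ i, regr (args Q) D h i * avg fun α => args Q i (D α) * h α) := by
    have h2 : newPart l q D ⬝ᵥ newPart l q D = newPart l q D ⬝ᵥ h :=
      (dotProduct_proj (proj_transpose _ _) (proj_mul_self _ _) h).symm
    rw [h2, newPart, hP, residual_mulVec_eq hn _ _ hdet, sub_dotProduct, mul_sub, Finset.mul_sum]
    congr 1
    · simp only [avg, mul_inv_cancel_left₀ hn0.ne', dotProduct, sq]
      rfl
    · simp only [design, mulVec, dotProduct, of_apply, avg, Finset.sum_mul, Finset.mul_sum]
      rw [Finset.sum_comm]
      refine Finset.sum_congr rfl fun i _ => Finset.sum_congr rfl fun α _ => ?_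
      rw [mul_left_comm (n : ℝ), mul_inv_cancel_left₀ hn0.ne']
      ring
  have h3 : 0 ≤ (avg fun α => h α ^ 2) -
      ∑ i, regr (args Q) D h i * avg fun α => args Q i (D α) * h α := by
    have : 0 ≤ newPart l q D ⬝ᵥ newPart l q D := by
      rw [dotProduct]; exact Finset.sum_nonneg fun i _ => mul_self_nonneg _
    rw [h1] at this
    exact nonneg_of_mul_nonneg_right this hn0
  rw [condStd, h1, Real.sqrt_mul hn0.le, Real.sqrt_mul (sq_nonneg _), Real.sqrt_sq (NNReal.coe_nonneg _)]
  have := (Real.sqrt_pos.2 hn0).ne'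
  field_simp

end CondLaw

/-! ### Bases in `L²` -/

section Basis

open Matrix

variable {𝓧 ι : Type*} [MeasurableSpace 𝓧] {Λ : Measure 𝓧}

/-- Greedy selection: a function joins `B` unless it is almost everywhere a combination of those
already chosen. -/
theorem exists_basis_aux [DecidableEq ι] (h : ι → 𝓧 → ℝ) (s : Finset ι) :
    ∃ B ⊆ s, (∀ c : ι → ℝ, (∀ᵐ z ∂Λ, ∑ i ∈ B, c i * h i z = 0) → ∀ i ∈ B, c i = 0) ∧
      ∀ j ∈ s, ∃ c : ι → ℝ, ∀ᵐ z ∂Λ, h j z = ∑ i ∈ B, c i * h i z := by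
  induction s using Finset.induction_on with
  | empty => exact ⟨∅, subset_rfl, by simp, by simp⟩
  | insert j s hj ih =>
    obtain ⟨B, hB, hind, hspan⟩ := ih
    by_cases hc : ∃ c : ι → ℝ, ∀ᵐ z ∂Λ, h j z = ∑ i ∈ B, c i * h i z
    · refine ⟨B, hB.trans (Finset.subset_insert _ _), hind, fun k hk => ?_⟩
      rcases Finset.mem_insert.1 hk with rfl | hk
      · exact hc
      · exact hspan k hk
    · have hjB : j ∉ B := fun h => hj (hB h)
      have hext : ∀ (c : ι → ℝ) (a : ℝ) (z : 𝓧),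
          ∑ i ∈ insert j B, Function.update c j a i * h i z =
            a * h j z + ∑ i ∈ B, c i * h i z := by
        intro c a z
        rw [Finset.sum_insert hjB, Function.update_self]
        congr 1
        refine Finset.sum_congr rfl fun i hi => ?_
        rw [Function.update_of_ne (by rintro rfl; exact hjB hi)]
      refine ⟨insert j B, Finset.insert_subset_insert _ hB, fun c h0 => ?_, fun k hk => ?_⟩
      · have hcj : c j = 0 := by
          by_contra hne
          refine hc ⟨fun i => -(c i / c j), ?_⟩
          filter_upwards [h0] with z hz
          rw [Finset.sum_insert hjB] at hz
          have : ∑ i ∈ B, -(c i / c j) * h i z = -(∑ i ∈ B, c i * h i z) / c j := by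
            rw [neg_div, Finset.sum_div, ← Finset.sum_neg_distrib]
            exact Finset.sum_congr rfl fun i _ => by ring
          rw [this, eq_div_iff hne]
          linarith
        intro i hi
        rcases Finset.mem_insert.1 hi with rfl | hi
        · exact hcj
        · refine hind c ?_ i hi
          filter_upwards [h0] with z hz
          rwa [Finset.sum_insert hjB, hcj, zero_mul, zero_add] at hz
      · rcases Finset.mem_insert.1 hk with rfl | hk
        · exact ⟨Function.update 0 k 1, ae_of_all _ fun z => by rw [hext]; simp⟩
        · obtain ⟨c, hc'⟩ := hspan k hk
          refine ⟨Function.update c j 0, ?_⟩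
          filter_upwards [hc'] with z hz
          rw [hext, zero_mul, zero_add, hz]

/-- A finite family of functions has a subfamily with invertible Gram matrix of which all others are
linear combinations almost everywhere. -/
theorem exists_basis [DecidableEq ι] (h : ι → 𝓧 → ℝ) (s : Finset ι)
    (hi : ∀ i ∈ s, ∀ j ∈ s, Integrable (fun z => h i z * h j z) Λ) :
    ∃ B ⊆ s, (limGram Λ fun i : B => h i).det ≠ 0 ∧
      ∀ j ∈ s, ∃ c : B → ℝ, ∀ᵐ z ∂Λ, h j z = ∑ i : B, c i * h i z := by
  obtain ⟨B, hB, hind, hspan⟩ := exists_basis_aux (Λ := Λ) h s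
  have hsum : ∀ (c : ι → ℝ) z, ∑ i ∈ B, c i * h i z = ∑ i : B, c i * h i z :=
    fun c z => (Finset.sum_coe_sort B fun i => c i * h i z).symm
  refine ⟨B, hB, fun hdet => ?_, fun j hj => ?_⟩
  -- A null vector of the Gram matrix would give a combination of vanishing L² norm, contradicting
  -- independence.
  · obtain ⟨v, hv, hv0⟩ := exists_mulVec_eq_zero_iff.2 hdet
    have hint : ∀ i j : B, Integrable (fun z => h i z * h j z) Λ :=
      fun i j => hi _ (hB i.2) _ (hB j.2)
    have h1 : ∫ z, (∑ i : B, v i * h i z) ^ 2 ∂Λ = 0 := by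
      have h2 : ∀ z, (∑ i : B, v i * h i z) ^ 2 =
          ∑ i : B, ∑ j : B, v i * v j * (h i z * h j z) := by
        intro z
        rw [sq, Finset.sum_mul_sum]
        exact Finset.sum_congr rfl fun i _ => Finset.sum_congr rfl fun j _ => by ring
      simp_rw [h2]
      rw [integral_finsetSum _ fun i _ => integrable_finsetSum _ fun j _ => (hint i j).const_mul _]
      have h3 : v ⬝ᵥ (limGram Λ (fun i : B => h i) *ᵥ v) = 0 := by rw [hv0, dotProduct_zero]
      rw [← h3]
      simp only [dotProduct, mulVec, limGram, of_apply, Finset.mul_sum]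
      refine Finset.sum_congr rfl fun i _ => ?_
      rw [integral_finsetSum _ fun j _ => (hint i j).const_mul _]
      refine Finset.sum_congr rfl fun j _ => ?_
      rw [integral_const_mul]
      ring
    have hint2 : Integrable (fun z => (∑ i : B, v i * h i z) ^ 2) Λ := by
      have h2 : ∀ z, (∑ i : B, v i * h i z) ^ 2 =
          ∑ i : B, ∑ j : B, v i * v j * (h i z * h j z) := by
        intro z
        rw [sq, Finset.sum_mul_sum]
        exact Finset.sum_congr rfl fun i _ => Finset.sum_congr rfl fun j _ => by ring
      simp_rw [h2]
      exact integrable_finsetSum _ fun i _ => integrable_finsetSum _ fun j _ =>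
        (hint i j).const_mul _
    have h4 := (integral_eq_zero_iff_of_nonneg (fun z => sq_nonneg _) hint2).1 h1
    refine hv (funext fun i => ?_)
    have h5 := hind (fun i => if hi : i ∈ B then v ⟨i, hi⟩ else 0) (by
      filter_upwards [h4] with z hz
      rw [hsum]
      simpa using hz) i i.2
    simpa using h5
  · obtain ⟨c, hc⟩ := hspan j hj
    refine ⟨fun i => c i, ?_⟩
    filter_upwards [hc] with z hz
    rw [hz, hsum]

end Basis

/-! ### Parity -/

section Parity

variable {I J : Type*}

open scoped Classical in
/-- Negation of the input vectors with index in `V`. -/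
def flip (V : Set I) {n : ℕ} (θ : Params I J n) : Params I J n :=
  (fun α => WithLp.toLp 2 fun i => if i ∈ V then - θ.1 α i else θ.1 α i, θ.2)

theorem negatedOn_flip (V : Set I) {n : ℕ} (θ : Params I J n) : NegatedOn V θ (flip V θ) := by
  refine ⟨⟨fun α i hi => ?_, rfl⟩, fun α i hi => ?_⟩ <;> simp [flip, hi]

/-- The parity condition on products in a BP-like program. -/
def Query.Parity (V : Set I) (q : Query I J) : Prop :=
  if q.side then q.arg.IndepOf V else q.arg.OddIn V

theorem Query.Parity.eval_arg {V : Set I} {q : Query I J} (hq : q.Parity V) {n : ℕ}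
    (θ : Params I J n) :
    q.arg.eval (flip V θ) = (if q.side then 1 else -1 : ℝ) • q.arg.eval θ := by
  have h := negatedOn_flip V θ
  unfold Query.Parity at hq
  split_ifs at hq ⊢
  · rw [one_smul]; exact hq n _ _ h.1
  · rw [neg_one_smul]; exact hq n _ _ h

/-- Products are linear in their arguments and the flip leaves the matrices alone, so a result has
the parity of its argument: even for W, odd for Wᵀ. -/
theorem Query.Parity.eval_term {V : Set I} {q : Query I J} (hq : q.Parity V) {n : ℕ}
    (θ : Params I J n) :
    q.term.eval (flip V θ) = (if q.side then 1 else -1 : ℝ) • q.term.eval θ := by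
  ext α
  rw [Query.eval_term, hq.eval_arg, Matrix.mulVec_smul, Pi.smul_apply, Pi.smul_apply,
    Query.eval_term]
  simp only [flip, smul_eq_mul]
  ring

variable [Fintype I] [DecidableEq I] [Fintype J]

/-- The characteristic function is invariant: the means on V vanish, and no covariance links V to
its complement, so each surviving term of the quadratic form acquires an even number of signs. -/
theorem multivariateGaussian_map_flip {m : EuclideanSpace ℝ I} {S : Matrix I I ℝ}
    (hS : S.PosSemidef) {V : Set I} [DecidablePred (· ∈ V)] (hm : ∀ i ∈ V, m i = 0)
    (hc : ∀ i ∈ V, ∀ j ∉ V, S i j = 0) :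
    (multivariateGaussian m S).map
      (fun x => WithLp.toLp 2 fun i => if i ∈ V then - x i else x i) =
      multivariateGaussian m S := by
  let ε : I → ℝ := fun i => if i ∈ V then -1 else 1
  have hf : Measurable fun x : EuclideanSpace ℝ I =>
      (WithLp.toLp 2 fun i => if i ∈ V then - x i else x i : EuclideanSpace ℝ I) := by
    refine (WithLp.measurable_toLp 2 _).comp (measurable_pi_lambda _ fun i => ?_)
    split_ifs <;> fun_prop
  have := Measure.isProbabilityMeasure_map (μ := multivariateGaussian m S) hf.aemeasurable
  refine Measure.ext_of_charFun (funext fun t => ?_)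
  have h1 : charFun ((multivariateGaussian m S).map
      (fun x => WithLp.toLp 2 fun i => if i ∈ V then - x i else x i)) t =
      charFun (multivariateGaussian m S) (WithLp.toLp 2 fun i => ε i * t i) := by
    rw [charFun_apply, charFun_apply, integral_map hf.aemeasurable (by fun_prop)]
    congr with x
    congr 3
    simp only [PiLp.inner_apply, ε]
    refine Finset.sum_congr rfl fun i _ => ?_
    split_ifs <;> simp
  rw [h1, charFun_multivariateGaussian hS, charFun_multivariateGaussian hS]
  congr 3
  · congr 1
    simp only [PiLp.inner_apply, ε]
    refine Finset.sum_congr rfl fun i _ => ?_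
    split_ifs with h
    · simp [hm i h]
    · simp
  · congr 1
    simp only [dotProduct, Matrix.mulVec, Finset.mul_sum, ε]
    refine Finset.sum_congr rfl fun i _ => Finset.sum_congr rfl fun j _ => ?_
    have hsymm : S j i = S i j := by
      have := congrFun (congrFun hS.1 i) j
      simpa using this
    by_cases hi : i ∈ V <;> by_cases hj : j ∈ V
    · simp [hi, hj]
    · simp [hi, hj, hc i hi j hj]
    · simp [hi, hj, ← hsymm, hc j hj i hi]
    · simp [hi, hj]

theorem Init.measurePreserving_flip (ν : Init I J) {V : Set I} (hm : ∀ i ∈ V, ν.mean i = 0)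
    (hc : ∀ i ∈ V, ∀ j ∉ V, ν.cov i j = 0) (n : ℕ) :
    MeasurePreserving (flip V) (ν.law n) (ν.law n) := by
  classical
  refine MeasurePreserving.prod (f := fun (x : Fin n → EuclideanSpace ℝ I) α =>
    (WithLp.toLp 2 fun i => if i ∈ V then - x α i else x α i : EuclideanSpace ℝ I)) (g := id) ?_
    (MeasurePreserving.id _)
  refine measurePreserving_pi _ _ (f := fun _ (x : EuclideanSpace ℝ I) =>
    (WithLp.toLp 2 fun i => if i ∈ V then - x i else x i : EuclideanSpace ℝ I)) fun _ => ⟨?_, ?_⟩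
  · refine (WithLp.measurable_toLp 2 _).comp (measurable_pi_lambda _ fun i => ?_)
    split_ifs <;> fun_prop
  · exact multivariateGaussian_map_flip ν.cov_posSemidef hm hc

end Parity

/-! ### Adjoining a product -/

section Step

open Matrix

variable {I J : Type*} [Fintype I] [DecidableEq I] [Fintype J] {ν : Init I J}
  {l : List (Query I J)} {Λ : Measure (Term I J → ℝ)}

/-- The rows obey the law of large numbers with limit law `Λ`, with bounded moments. -/
structure Converges (ν : Init I J) (l : List (Query I J)) (Λ : Measure (Term I J → ℝ)) : Prop where
  lln : LLN ν.law (fun n (θ : Params I J n) => rows l θ) Λ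
  bdd : ∀ g ∈ gset l, BddMoments ν.law fun p => g.eval p.2

namespace Converges

theorem bdd_eval (h : Converges ν l Λ) {t : Term I J} (ht : t.gvars ⊆ gset l) :
    BddMoments ν.law fun p => t.eval p.2 := by
  induction t with
  | vec i => exact h.bdd _ (ht (by simp [Term.gvars]))
  | mul W t _ => exact h.bdd _ (ht (by simp [Term.gvars]))
  | mulT W t _ => exact h.bdd _ (ht (by simp [Term.gvars]))
  | nonlin φ args ih =>
    refine BddMoments.polyBounded φ.polyBounded fun k => ih k (subset_trans ?_ ht)
    classical
    rw [Term.gvars]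
    intro g hg
    simp only [Finset.mem_biUnion, Finset.mem_univ, true_and]
    exact ⟨k, hg⟩

theorem bdd_value (h : Converges ν l Λ) {t : Term I J} (ht : t.gvars ⊆ gset l) :
    BddMoments ν.law fun p α => t.value (rows l p.2 α) := by
  simp only [value_rows ht]
  exact h.bdd_eval ht

theorem bdd_rows (h : Converges ν l Λ) {g : Term I J} (hg : g ∈ gset l) :
    BddMoments ν.law fun p α => rows l p.2 α g := by
  simp only [rows_of_mem hg]
  exact h.bdd g hg

variable [IsProbabilityMeasure Λ]

theorem integrable_mul (h : Converges ν l Λ) {s t : Term I J} (hs : s.gvars ⊆ gset l)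
    (ht : t.gvars ⊆ gset l) : Integrable (fun z => s.value z * t.value z) Λ :=
  h.lln.integrable (f := fun z => s.value z * t.value z)
    (s.measurable_value.mul t.measurable_value) ((h.bdd_value hs).mul (h.bdd_value ht))

theorem tendsto_avg_mul (h : Converges ν l Λ) {s t : Term I J} (hs : s.gvars ⊆ gset l)
    (ht : t.gvars ⊆ gset l) :
    Tendsto (fun p : Σ n, Params I J n =>
      avg fun α => s.value (rows l p.2 α) * t.value (rows l p.2 α))
      (complete ν.law) (𝓝 (∫ z, s.value z * t.value z ∂Λ)) :=
  h.lln.tendsto_avg (f := fun z => s.value z * t.value z) (s.measurable_value.mul t.measurable_value)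
    ((h.bdd_value hs).mul (h.bdd_value ht))

theorem tendsto_empGram_det (h : Converges ν l Λ) {r : Type*} [Fintype r] [DecidableEq r]
    {Q : r → Query I J} (hQ : ∀ i, (Q i).arg.gvars ⊆ gset l) :
    Tendsto (fun p : Σ n, Params I J n => (empGram (args Q) (rows l p.2)).det) (complete ν.law)
      (𝓝 (limGram Λ (args Q)).det) := by
  have hm : ∀ j, Measurable (args Q j) := fun j => (Q j).arg.measurable_value
  have hb : ∀ j, BddMoments ν.law fun p α => args Q j (rows l p.2 α) :=
    fun j => h.bdd_value (hQ j)
  have h1 := tendsto_empGram h.lln hm hb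
  have h2 : Continuous fun M : Matrix r r ℝ => M.det := continuous_id.matrix_det
  exact (h2.tendsto _).comp h1

theorem tendsto_regr (h : Converges ν l Λ) {r : Type*} [Fintype r] [DecidableEq r]
    {Q : r → Query I J} (hQ : ∀ i, (Q i).arg.gvars ⊆ gset l) (hdet : (limGram Λ (args Q)).det ≠ 0)
    {t : Term I J} (ht : t.gvars ⊆ gset l) :
    Tendsto (fun p : Σ n, Params I J n =>
      regr (args Q) (rows l p.2) fun α => t.value (rows l p.2 α)) (complete ν.law)
      (𝓝 ((limGram Λ (args Q))⁻¹ *ᵥ fun i => ∫ z, args Q i z * t.value z ∂Λ)) := by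
  have hm : ∀ j, Measurable (args Q j) := fun j => (Q j).arg.measurable_value
  have hb : ∀ j, BddMoments ν.law fun p α => args Q j (rows l p.2 α) :=
    fun j => h.bdd_value (hQ j)
  have h1 := tendsto_empGram_inv h.lln hm hb hdet
  have h2 : Tendsto (fun (p : Σ n, Params I J n) i =>
      avg fun α => args Q i (rows l p.2 α) * t.value (rows l p.2 α)) (complete ν.law)
      (𝓝 fun i => ∫ z, args Q i z * t.value z ∂Λ) :=
    tendsto_pi_nhds.2 fun i => h.tendsto_avg_mul (hQ i) ht
  have hc : Continuous fun p : Matrix r r ℝ × (r → ℝ) => p.1 *ᵥ p.2 := by fun_prop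
  have h3 := (hc.tendsto (_, _)).comp (h1.prodMk_nhds h2)
  simp only [regr]
  exact h3

/-- The results of products on one side are asymptotically orthogonal to the arguments on the other
side. -/
theorem tendsto_cross (h : Converges ν l Λ) {V : Set I}
    (hflip : ∀ n, MeasurePreserving (flip V) (ν.law n) (ν.law n)) {q₁ q₂ : Query I J}
    (h₁ : q₁ ∈ l) (h₂ : q₂.arg.gvars ⊆ gset l) (hp₁ : q₁.Parity V) (hp₂ : q₂.Parity V)
    (hs : q₁.side = !q₂.side) :
    Tendsto (fun p : Σ n, Params I J n =>
      avg fun α => rows l p.2 α q₁.term * q₂.argVal (rows l p.2) α)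
      (complete ν.law) (𝓝 0) := by
  have h1 : Tendsto (fun p : Σ n, Params I J n =>
      avg fun α => rows l p.2 α q₁.term * q₂.argVal (rows l p.2) α)
      (complete ν.law) (𝓝 (∫ z, z q₁.term * q₂.arg.value z ∂Λ)) :=
    h.lln.tendsto_avg (f := fun z => z q₁.term * q₂.arg.value z)
      ((measurable_pi_apply _).mul q₂.arg.measurable_value)
      ((h.bdd_rows (term_mem_gset h₁)).mul (h.bdd_value h₂))
  -- The sides being opposite, exactly one of the two factors is odd under the flip, so the average
  -- is a symmetric random variable.
  have h2 := eq_zero_of_tendsto_complete_of_neg hflip (fun n θ => ?_) h1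
  · rwa [h2] at h1
  · simp only [rows_of_mem (term_mem_gset h₁), Query.argVal, value_rows h₂, hp₁.eval_term,
      hp₂.eval_arg, Pi.smul_apply, smul_eq_mul]
    rw [← avg_neg]
    congr 1
    ext α
    rw [hs]
    cases q₂.side <;> simp

open scoped Classical in
-- At finite width the rank of the arguments need not be stable. The basis is therefore chosen in
-- L²(Λ). The remaining arguments are combinations of it almost everywhere, hence eventually exactly
-- in all rows, so the finite-width projection is given by a Gram matrix with invertible limit.
theorem exists_side_basis (h : Converges ν l Λ) (hl : Valid l) (b : Bool) (W : J) :
    ∃ B : Finset (Query I J), (∀ i : B, i.1 ∈ l ∧ i.1.side = b ∧ i.1.mat = W) ∧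
      (limGram Λ (args fun i : B => i.1)).det ≠ 0 ∧
      (∀ q' ∈ l, q'.side = b → q'.mat = W →
        ∃ c : B → ℝ, ∀ᵐ z ∂Λ, q'.arg.value z = ∑ i, c i * args (fun i : B => i.1) i z) ∧
      ∀ᶠ p : Σ n, Params I J n in complete ν.law,
        (empGram (args fun i : B => i.1) (rows l p.2)).det ≠ 0 ∧
        proj l (rows l p.2) b W = 1 - design (args fun i : B => i.1) (rows l p.2) *
          ((design (args fun i : B => i.1) (rows l p.2))ᵀ *
            design (args fun i : B => i.1) (rows l p.2))⁻¹ *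
          (design (args fun i : B => i.1) (rows l p.2))ᵀ := by
  obtain ⟨B, hB, hdet, hspan⟩ := exists_basis (Λ := Λ) (fun (q : Query I J) z => q.arg.value z)
    (l.toFinset.filter fun q => q.side = b ∧ q.mat = W) (fun i hi j hj => by
      simp only [Finset.mem_filter, List.mem_toFinset] at hi hj
      exact h.integrable_mul (hl.gvars_arg_subset hi.1) (hl.gvars_arg_subset hj.1))
  have hB' : ∀ i : B, i.1 ∈ l ∧ i.1.side = b ∧ i.1.mat = W := fun i => by
    have := hB i.2
    simpa only [Finset.mem_filter, List.mem_toFinset] using this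
  have hdet' : (limGram Λ (args fun i : B => i.1)).det ≠ 0 := hdet
  have hspan' : ∀ q' ∈ l, q'.side = b → q'.mat = W →
      ∃ c : B → ℝ, ∀ᵐ z ∂Λ, q'.arg.value z = ∑ i, c i * args (fun i : B => i.1) i z :=
    fun q' hq' h1 h2 => hspan q' (by simp [hq', h1, h2])
  refine ⟨B, hB', hdet', hspan', ?_⟩
  have e1 : ∀ᶠ p : Σ n, Params I J n in complete ν.law,
      ∀ q' ∈ l.toFinset, q'.side = b → q'.mat = W → ∃ c : B → ℝ, ∀ α,
        q'.argVal (rows l p.2) α = ∑ i, c i * args (fun i : B => i.1) i (rows l p.2 α) := by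
    refine (eventually_all_finset _).2 fun q' hq' => ?_
    by_cases hc : q'.side = b ∧ q'.mat = W
    · obtain ⟨c, hc⟩ := hspan' q' (List.mem_toFinset.1 hq') hc.1 hc.2
      have h5 := h.lln.eventually_of_ae hc
      exact h5.mono fun p hp _ _ => ⟨c, fun α => hp α⟩
    · exact Eventually.of_forall fun p h1 h2 => absurd ⟨h1, h2⟩ hc
  have e2 : ∀ᶠ p : Σ n, Params I J n in complete ν.law,
      (empGram (args fun i : B => i.1) (rows l p.2)).det ≠ 0 := by
    exact (h.tendsto_empGram_det (Q := fun i : B => i.1)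
      fun j => hl.gvars_arg_subset (hB' j).1).eventually_ne hdet'
  filter_upwards [e1, e2, eventually_fst_complete (p := fun n => 0 < n) (eventually_gt_atTop 0)]
    with p h1 h2 h3
  refine ⟨h2, proj_eq hB' (fun q hq => h1 q (List.mem_toFinset.2 hq)) ?_⟩
  rw [design_transpose_mul h3, det_smul]
  have : (p.1 : ℝ) ≠ 0 := by exact_mod_cast h3.ne'
  exact mul_ne_zero (pow_ne_zero _ this) h2

end Converges

/-- The case of vanishing limit variance, which `GaussianStep` excludes: the new coordinate is
eventually a function of the rows. -/
theorem LLN.prodMk_of_eventually_eq {Ω : ℕ → Type*} [∀ n, MeasurableSpace (Ω n)]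
    {μ : ∀ n, Measure (Ω n)} {𝓧 : Type*} [MeasurableSpace 𝓧] {X : ∀ n, Ω n → Fin n → 𝓧}
    {Λ : Measure 𝓧} [IsProbabilityMeasure Λ] (h : LLN μ X Λ) {m₀ : 𝓧 → ℝ} (hm : Measurable m₀)
    {G : ∀ n, Ω n → Fin n → ℝ}
    (hG : ∀ᶠ p : Σ n, Ω n in complete μ, ∀ α, G p.1 p.2 α = m₀ (X p.1 p.2 α)) :
    LLN μ (fun n ω α => (X n ω α, G n ω α)) (GaussianStep.limit Λ m₀ 0) := by
  have h1 := h.map (measurable_id.prodMk hm)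
  have h2 : GaussianStep.limit Λ m₀ 0 = Λ.map fun z => (z, m₀ z) := by
    have : (fun p : 𝓧 × ℝ => (p.1, m₀ p.1 + 0 * p.2)) = (fun z => (z, m₀ z)) ∘ Prod.fst := by
      ext p <;> simp
    have hm' : Measurable fun z => (z, m₀ z) := measurable_id.prodMk hm
    rw [GaussianStep.limit, this, ← Measure.map_map hm' measurable_fst,
      Measure.map_fst_prod]
    simp
  rw [h2]
  refine h1.congr ?_
  filter_upwards [hG] with p hp α
  simp [hp]

end Step

/-! ### Limit regression coefficients and vanishing limit variance. -/

section StepBases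

open Matrix

variable {I J : Type*} [Fintype I] [DecidableEq I] [Fintype J] {ν : Init I J}
  {l : List (Query I J)} {Λ : Measure (Term I J → ℝ)}

/-- Zero standard deviations are admitted. Then the limit variance vanishes without any relation
among the arguments, and this case needs its own treatment. -/
theorem Init.ae_matrix_eq_zero (ν : Init I J) {W : J} (hW : ν.std W = 0) (n : ℕ) :
    ∀ᵐ θ ∂ν.law n, ∀ α β, θ.2 W α β = 0 := by
  refine ae_all_iff.2 fun α => ae_all_iff.2 fun β => ?_
  have h1 : MeasurePreserving (fun θ : Params I J n => θ.2 W α β) (ν.law n)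
      (gaussianReal 0 (ν.std W ^ 2)) :=
    (measurePreserving_eval (fun _ : Fin n => gaussianReal 0 (ν.std W ^ 2)) β).comp
      ((measurePreserving_eval (fun _ : Fin n => Measure.pi fun _ : Fin n =>
        gaussianReal 0 (ν.std W ^ 2)) α).comp
      ((measurePreserving_eval (fun W => gaussianMatrix n (ν.std W)) W).comp measurePreserving_snd))
  have h2 : ∀ᵐ t ∂(gaussianReal 0 (ν.std W ^ 2)), t = 0 := by
    rw [hW]
    simp only [ne_eq, OfNat.ofNat_ne_zero, not_false_eq_true, zero_pow, gaussianReal_zero_var]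
    rw [ae_dirac_eq]
    rfl
  exact h1.quasiMeasurePreserving.ae h2

omit [Fintype I] [DecidableEq I] [Fintype J] in
theorem eval_term_of_matrix_eq_zero {n : ℕ} {q : Query I J} {θ : Params I J n}
    (h : ∀ α β, θ.2 q.mat α β = 0) (α : Fin n) : q.term.eval θ α = 0 := by
  have h0 : (of (θ.2 q.mat)) = 0 := by ext α β; exact h α β
  rw [Query.eval_term, h0]
  cases q.side <;> simp [side]

variable {r r' : Type*} [Fintype r] [DecidableEq r] [Fintype r'] [DecidableEq r']
  {Q : r → Query I J} {Q' : r' → Query I J} {q : Query I J}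

/-- The coefficients of the projection of the argument of `q` to the span of the arguments of `Q`. -/
def limCoef (Λ : Measure (Term I J → ℝ)) (Q : r → Query I J) (q : Query I J) : r → ℝ :=
  (limGram Λ (args Q))⁻¹ *ᵥ fun i => ∫ z, args Q i z * q.arg.value z ∂Λ

/-- The limit of the conditional mean of a new product. -/
def limMean (Λ : Measure (Term I J → ℝ)) (Q : r → Query I J) (q : Query I J)
    (z : Term I J → ℝ) : ℝ := ∑ i, limCoef Λ Q q i * z (Q i).term

/-- The limit of the conditional variance of a new product. -/
def limVar (ν : Init I J) (Λ : Measure (Term I J → ℝ)) (Q : r → Query I J) (q : Query I J) : ℝ :=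
  (ν.std q.mat : ℝ) ^ 2 * (∫ z, q.arg.value z * q.arg.value z ∂Λ -
    ∑ i, limCoef Λ Q q i * ∫ z, args Q i z * q.arg.value z ∂Λ)

omit [Fintype I] [DecidableEq I] [Fintype J] in
theorem limGram_mulVec_limCoef (hdet : (limGram Λ (args Q)).det ≠ 0) :
    limGram Λ (args Q) *ᵥ limCoef Λ Q q = fun i => ∫ z, args Q i z * q.arg.value z ∂Λ := by
  rw [limCoef, mulVec_mulVec, mul_nonsing_inv _ hdet.isUnit, one_mulVec]

namespace Converges

variable [IsProbabilityMeasure Λ]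

/-- By the normal equations the cross term is twice the quadratic one. Hence the bracket in `limVar`
is the squared L² distance of the argument from the span of the chosen ones: it is nonnegative, and
it vanishes only for a combination. -/
theorem integral_sub_sq (h : Converges ν l Λ) (hQ : ∀ i, (Q i).arg.gvars ⊆ gset l)
    (hq : q.arg.gvars ⊆ gset l) (hdet : (limGram Λ (args Q)).det ≠ 0) :
    Integrable (fun z => (q.arg.value z - ∑ i, limCoef Λ Q q i * args Q i z) ^ 2) Λ ∧
    ∫ z, (q.arg.value z - ∑ i, limCoef Λ Q q i * args Q i z) ^ 2 ∂Λ =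
      ∫ z, q.arg.value z * q.arg.value z ∂Λ -
        ∑ i, limCoef Λ Q q i * ∫ z, args Q i z * q.arg.value z ∂Λ := by
  set a := limCoef Λ Q q
  have h1 : ∀ z, (q.arg.value z - ∑ i, a i * args Q i z) ^ 2 =
      q.arg.value z * q.arg.value z - 2 * ∑ i, a i * (args Q i z * q.arg.value z) +
        ∑ i, a i * ∑ j, a j * (args Q i z * args Q j z) := by
    intro z
    have h2 : ∑ i, a i * ∑ j, a j * (args Q i z * args Q j z) = (∑ i, a i * args Q i z) ^ 2 := by
      rw [sq, Finset.sum_mul_sum]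
      simp only [Finset.mul_sum]
      exact Finset.sum_congr rfl fun i _ => Finset.sum_congr rfl fun j _ => by ring
    have h3 : ∑ i, a i * (args Q i z * q.arg.value z) = (∑ i, a i * args Q i z) * q.arg.value z := by
      rw [Finset.sum_mul]
      exact Finset.sum_congr rfl fun i _ => by ring
    rw [h2, h3]
    ring
  have i1 : Integrable (fun z => q.arg.value z * q.arg.value z) Λ := h.integrable_mul hq hq
  have i2 : ∀ i, Integrable (fun z => args Q i z * q.arg.value z) Λ :=
    fun i => h.integrable_mul (hQ i) hq
  have i3 : ∀ i j, Integrable (fun z => args Q i z * args Q j z) Λ :=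
    fun i j => h.integrable_mul (hQ i) (hQ j)
  have i4 : Integrable (fun z => 2 * ∑ i, a i * (args Q i z * q.arg.value z)) Λ :=
    (integrable_finsetSum _ fun i _ => (i2 i).const_mul _).const_mul _
  have i5 : ∀ i, Integrable (fun z => a i * ∑ j, a j * (args Q i z * args Q j z)) Λ :=
    fun i => (integrable_finsetSum _ fun j _ => (i3 i j).const_mul _).const_mul _
  have i6 : Integrable (fun z => ∑ i, a i * ∑ j, a j * (args Q i z * args Q j z)) Λ :=
    integrable_finsetSum _ fun i _ => i5 i
  simp only [h1]
  refine ⟨(i1.sub i4).add i6, ?_⟩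
  have hb := limGram_mulVec_limCoef (q := q) hdet
  have h4 : ∀ i, ∑ j, a j * ∫ z, args Q i z * args Q j z ∂Λ = ∫ z, args Q i z * q.arg.value z ∂Λ := by
    intro i
    rw [← congrFun hb i]
    simp only [mulVec, dotProduct, limGram, of_apply]
    exact Finset.sum_congr rfl fun j _ => mul_comm _ _
  have i7 : Integrable (fun z => q.arg.value z * q.arg.value z -
      2 * ∑ i, a i * (args Q i z * q.arg.value z)) Λ := i1.sub i4
  rw [integral_add i7 i6, integral_sub i1 i4, integral_const_mul,
    integral_finsetSum _ fun i _ => (i2 i).const_mul _, integral_finsetSum _ fun i _ => i5 i]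
  have h5 : ∀ i, ∫ z, a i * ∑ j, a j * (args Q i z * args Q j z) ∂Λ =
      a i * ∫ z, args Q i z * q.arg.value z ∂Λ := by
    intro i
    rw [integral_const_mul, integral_finsetSum _ fun j _ => (i3 i j).const_mul _, ← h4]
    simp only [integral_const_mul]
  simp only [h5, integral_const_mul]
  ring

theorem limVar_nonneg (h : Converges ν l Λ) (hQ : ∀ i, (Q i).arg.gvars ⊆ gset l)
    (hq : q.arg.gvars ⊆ gset l) (hdet : (limGram Λ (args Q)).det ≠ 0) : 0 ≤ limVar ν Λ Q q := by
  rw [limVar, ← (h.integral_sub_sq hQ hq hdet).2]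
  exact mul_nonneg (sq_nonneg _) (integral_nonneg fun z => sq_nonneg _)

/-- If the limit variance vanishes, a new product is eventually a linear combination of earlier
ones. -/
theorem eventually_eq_of_limVar_eq_zero (h : Converges ν l Λ) (hl : Valid (q :: l))
    (hQ : ∀ i, Q i ∈ l ∧ (Q i).side = q.side ∧ (Q i).mat = q.mat)
    (hdet : (limGram Λ (args Q)).det ≠ 0) (h0 : limVar ν Λ Q q = 0) :
    ∀ᶠ p : Σ n, Params I J n in complete ν.law, ∀ α,
      q.term.eval p.2 α = limMean Λ Q q (rows l p.2 α) := by
  have hQ' : ∀ i, (Q i).arg.gvars ⊆ gset l := fun i => hl.1.gvars_arg_subset (hQ i).1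
  -- The limit variance vanishes for one of two reasons: the matrix is zero, so that all results
  -- with it are zero, or the argument lies in the L² span of earlier arguments.
  by_cases hσ : ν.std q.mat = 0
  · have h1 := eventually_complete_of_ae (μ := ν.law) (q := fun _ => True)
      (p := fun p => ∀ α β, p.2.2 q.mat α β = 0) (Eventually.of_forall fun _ => trivial)
      (fun n => measure_mono_null (fun θ hθ => hθ.2) (ae_iff.1 (ν.ae_matrix_eq_zero hσ n)))
    filter_upwards [h1] with p hp α
    rw [eval_term_of_matrix_eq_zero hp, limMean]
    refine (Finset.sum_eq_zero fun i _ => ?_).symm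
    rw [rows_of_mem (term_mem_gset (hQ i).1), eval_term_of_matrix_eq_zero, mul_zero]
    rw [(hQ i).2.2]
    exact hp
  · have h2 := h.integral_sub_sq hQ' hl.2.1 hdet
    have h3 : ∫ z, (q.arg.value z - ∑ i, limCoef Λ Q q i * args Q i z) ^ 2 ∂Λ = 0 := by
      rw [h2.2]
      have hσ' : (ν.std q.mat : ℝ) ^ 2 ≠ 0 := pow_ne_zero _ (by exact_mod_cast hσ)
      exact (mul_eq_zero.1 h0).resolve_left hσ'
    have h4 := (integral_eq_zero_iff_of_nonneg (fun z => sq_nonneg _) h2.1).1 h3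
    have h5 : ∀ᵐ z ∂Λ, q.arg.value z = ∑ i, limCoef Λ Q q i * args Q i z := by
      filter_upwards [h4] with z hz
      exact sub_eq_zero.1 (pow_eq_zero_iff two_ne_zero |>.1 hz)
    -- The relation becomes exact in every row, and multiplication by the matrix carries it over to
    -- the results.
    have h6 := h.lln.eventually_of_ae h5
    filter_upwards [h6] with p hp α
    have h7 : q.arg.eval p.2 = ∑ i, limCoef Λ Q q i • (Q i).arg.eval p.2 := by
      ext β
      have := hp β
      rw [value_rows hl.2.1] at this
      rw [this, Finset.sum_apply]
      refine Finset.sum_congr rfl fun i _ => ?_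
      rw [Pi.smul_apply, smul_eq_mul, args, value_rows (hQ' i)]
    rw [Query.eval_term, h7, mulVec_sum, Finset.sum_apply, Finset.mul_sum, limMean]
    refine Finset.sum_congr rfl fun i _ => ?_
    rw [rows_of_mem (term_mem_gset (hQ i).1), Query.eval_term, (hQ i).2.1, (hQ i).2.2, mulVec_smul,
      Pi.smul_apply, smul_eq_mul]
    ring

end Converges

end StepBases

/-! ### Verification of the Gaussian step for a new product. -/

section Adjoin

open Matrix

variable {I J : Type*} [Fintype I] [DecidableEq I] [Fintype J] {ν : Init I J}
  {l : List (Query I J)} {Λ : Measure (Term I J → ℝ)}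
  {r r' : Type*} [Fintype r] [DecidableEq r] [Fintype r'] [DecidableEq r']
  {Q : r → Query I J} {Q' : r' → Query I J} {q : Query I J}

/-- The event that the projection is given by the arguments of `Q`. -/
def IsBasisAt (l : List (Query I J)) (Q : r → Query I J) (b : Bool) (W : J) {n : ℕ}
    (D : Fin n → Term I J → ℝ) : Prop :=
  (empGram (args Q) D).det ≠ 0 ∧
    proj l D b W = 1 - design (args Q) D *
      ((design (args Q) D)ᵀ * design (args Q) D)⁻¹ * (design (args Q) D)ᵀ

/-- The coefficients of the conditional mean on the arguments of the opposite side. -/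
def crossCoef (Q : r → Query I J) (Q' : r' → Query I J) (q : Query I J) {n : ℕ}
    (D : Fin n → Term I J → ℝ) : r' → ℝ :=
  (empGram (args Q') D)⁻¹ *ᵥ fun j => (avg fun α => D α (Q' j).term * q.argVal D α) -
    ∑ i, (avg fun α => D α (Q' j).term * args Q i (D α)) * regr (args Q) D (q.argVal D) i

namespace Converges

variable [IsProbabilityMeasure Λ]

/-- The only asymptotic obstruction to treating W and Wᵀ as independent is this correction to the
conditional mean. Every average in it pairs a result on one side with an argument on the other, and
parity makes each of them vanish in the limit. -/
theorem tendsto_crossCoef (h : Converges ν l Λ) (hl : Valid (q :: l)) {V : Set I}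
    (hflip : ∀ n, MeasurePreserving (flip V) (ν.law n) (ν.law n)) (hpar : ∀ q' ∈ l, q'.Parity V)
    (hparq : q.Parity V) (hQ : ∀ i, Q i ∈ l ∧ (Q i).side = q.side ∧ (Q i).mat = q.mat)
    (hdet : (limGram Λ (args Q)).det ≠ 0)
    (hQ' : ∀ i, Q' i ∈ l ∧ (Q' i).side = (!q.side) ∧ (Q' i).mat = q.mat)
    (hdet' : (limGram Λ (args Q')).det ≠ 0) :
    Tendsto (fun p : Σ n, Params I J n => crossCoef Q Q' q (rows l p.2)) (complete ν.law) (𝓝 0) := by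
  have hg : ∀ i, (Q i).arg.gvars ⊆ gset l := fun i => hl.1.gvars_arg_subset (hQ i).1
  have hg' : ∀ i, (Q' i).arg.gvars ⊆ gset l := fun i => hl.1.gvars_arg_subset (hQ' i).1
  have hm : ∀ j, Measurable (args Q' j) := fun j => (Q' j).arg.measurable_value
  have hb : ∀ j, BddMoments ν.law fun p α => args Q' j (rows l p.2 α) :=
    fun j => h.bdd_value (hg' j)
  have h1 := tendsto_empGram_inv h.lln hm hb hdet'
  have h2 := h.tendsto_regr hg hdet hl.2.1
  have h3 : Tendsto (fun (p : Σ n, Params I J n) j =>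
      (avg fun α => rows l p.2 α (Q' j).term * q.argVal (rows l p.2) α) -
      ∑ i, (avg fun α => rows l p.2 α (Q' j).term * (Q i).argVal (rows l p.2) α) *
        regr (args Q) (rows l p.2) (q.argVal (rows l p.2)) i) (complete ν.law) (𝓝 0) := by
    refine tendsto_pi_nhds.2 fun j => ?_
    have h4 := h.tendsto_cross hflip (hQ' j).1 hl.2.1 (hpar _ (hQ' j).1) hparq (hQ' j).2.1
    have h5 : ∀ i, Tendsto (fun p : Σ n, Params I J n =>
        (avg fun α => rows l p.2 α (Q' j).term * (Q i).argVal (rows l p.2) α) *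
        regr (args Q) (rows l p.2) (q.argVal (rows l p.2)) i) (complete ν.law)
        (𝓝 (0 * limCoef Λ Q q i)) := by
      intro i
      refine Tendsto.mul ?_ (tendsto_pi_nhds.1 h2 i)
      refine h.tendsto_cross hflip (hQ' j).1 (hg i) (hpar _ (hQ' j).1) (hpar _ (hQ i).1) ?_
      rw [(hQ' j).2.1, (hQ i).2.1]
    have h6 := h4.sub (tendsto_finsetSum Finset.univ fun i _ => h5 i)
    simpa using h6
  have hc : Continuous fun p : Matrix r' r' ℝ × (r' → ℝ) => p.1 *ᵥ p.2 := by fun_prop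
  have h7 := (hc.tendsto (_, _)).comp (h1.prodMk_nhds h3)
  simp only [mulVec_zero] at h7
  exact h7

theorem eventually_condMean_eq (hl : Valid l)
    (hQ : ∀ i, Q i ∈ l ∧ (Q i).side = q.side ∧ (Q i).mat = q.mat)
    (hQ' : ∀ i, Q' i ∈ l ∧ (Q' i).side = (!q.side) ∧ (Q' i).mat = q.mat)
    (e : ∀ᶠ p : Σ n, Params I J n in complete ν.law, IsBasisAt l Q q.side q.mat (rows l p.2))
    (e' : ∀ᶠ p : Σ n, Params I J n in complete ν.law,
      IsBasisAt l Q' (!q.side) q.mat (rows l p.2)) :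
    ∀ᶠ p : Σ n, Params I J n in complete ν.law, ∀ α, condMean l q (rows l p.2) α =
      ∑ i, regr (args Q) (rows l p.2) (q.argVal (rows l p.2)) i * rows l p.2 α (Q i).term +
      ∑ j, crossCoef Q Q' q (rows l p.2) j * args Q' j (rows l p.2 α) := by
  filter_upwards [e, e', eventually_fst_complete (p := fun n => 0 < n) (eventually_gt_atTop 0)]
    with p h1 h2 h3 α
  exact condMean_eq hl p.2 h3 hQ hQ' h1.1 h2.1 h1.2 h2.2 α

theorem gaussianStep (h : Converges ν l Λ) (hl : Valid (q :: l)) {V : Set I}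
    (hflip : ∀ n, MeasurePreserving (flip V) (ν.law n) (ν.law n)) (hpar : ∀ q' ∈ l, q'.Parity V)
    (hparq : q.Parity V) (hQ : ∀ i, Q i ∈ l ∧ (Q i).side = q.side ∧ (Q i).mat = q.mat)
    (hdet : (limGram Λ (args Q)).det ≠ 0)
    (hQ' : ∀ i, Q' i ∈ l ∧ (Q' i).side = (!q.side) ∧ (Q' i).mat = q.mat)
    (hdet' : (limGram Λ (args Q')).det ≠ 0)
    (e : ∀ᶠ p : Σ n, Params I J n in complete ν.law, IsBasisAt l Q q.side q.mat (rows l p.2))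
    (e' : ∀ᶠ p : Σ n, Params I J n in complete ν.law,
      IsBasisAt l Q' (!q.side) q.mat (rows l p.2))
    (hpos : 0 < limVar ν Λ Q q) :
    GaussianStep ν.law (fun n (θ : Params I J n) => rows l θ) Λ
      (fun n (θ : Params I J n) => q.term.eval θ) (fun _ => condMean l q)
      (fun _ => condStd ν.std l q) (fun _ D => proj l D (!q.side) q.mat) (args Q')
      (limMean Λ Q q) (√(limVar ν Λ Q q)) := by
  have hg : ∀ i, (Q i).arg.gvars ⊆ gset l := fun i => hl.1.gvars_arg_subset (hQ i).1
  have hg' : ∀ i, (Q' i).arg.gvars ⊆ gset l := fun i => hl.1.gvars_arg_subset (hQ' i).1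
  have hreg := h.tendsto_regr hg hdet hl.2.1
  have hcross := h.tendsto_crossCoef hl hflip hpar hparq hQ hdet hQ' hdet'
  have hmean := eventually_condMean_eq hl.1 hQ hQ' e e'
  have hbt : ∀ i, BddMoments ν.law fun p α => rows l p.2 α (Q i).term :=
    fun i => h.bdd_rows (term_mem_gset (hQ i).1)
  have hba : ∀ j, BddMoments ν.law fun p α => args Q' j (rows l p.2 α) :=
    fun j => h.bdd_value (hg' j)
  refine
    { lln := h.lln
      X_meas := fun n => measurable_rows l
      G_meas := fun n => measurable_pi_lambda _ fun α => q.term.measurable_eval α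
      m_meas := fun n => measurable_condMean l q
      s_meas := fun n => measurable_condStd ν.std l q
      R_meas := fun n α β => measurable_proj l measurable_id _ _ α β
      h_meas := fun j => (Q' j).arg.measurable_value
      m₀_meas := Finset.measurable_sum _ fun i _ => (measurable_pi_apply _).const_mul _
      law := fun n => law_map_rows_eval ν hl n
      m_bdd := ?_
      m_lim := ?_
      s_lim := ?_
      s_pos := Real.sqrt_pos.2 hpos
      h_bdd := hba
      gram_det := hdet'
      R_eq := e'.mono fun p hp => hp.2 }
  · have h1 : BddMoments ν.law fun p α =>
        ∑ i, regr (args Q) (rows l p.2) (q.argVal (rows l p.2)) i * rows l p.2 α (Q i).term +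
        ∑ j, crossCoef Q Q' q (rows l p.2) j * args Q' j (rows l p.2 α) :=
      (BddMoments.sum _ fun i _ => (hbt i).smul_tendsto (tendsto_pi_nhds.1 hreg i)).add
        (BddMoments.sum _ fun j _ => (hba j).smul_tendsto (tendsto_pi_nhds.1 hcross j))
    refine h1.mono ?_
    filter_upwards [hmean] with p hp α
    rw [hp]
  -- The averaged distance between conditional mean and limit mean is bounded by the errors of the
  -- regression coefficients and the cross coefficients, times bounds on first moments.
  · choose C hC using fun i => hbt i 1
    choose C' hC' using fun j => hba j 1
    have hlim : Tendsto (fun p : Σ n, Params I J n =>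
        ∑ i, |regr (args Q) (rows l p.2) (q.argVal (rows l p.2)) i - limCoef Λ Q q i| * C i +
        ∑ j, |crossCoef Q Q' q (rows l p.2) j| * C' j) (complete ν.law) (𝓝 0) := by
      have h1 : ∀ i, Tendsto (fun p : Σ n, Params I J n =>
          |regr (args Q) (rows l p.2) (q.argVal (rows l p.2)) i - limCoef Λ Q q i| * C i)
          (complete ν.law) (𝓝 (|limCoef Λ Q q i - limCoef Λ Q q i| * C i)) :=
        fun i => (((tendsto_pi_nhds.1 hreg i).sub_const _).abs).mul_const _
      have h2 : ∀ j, Tendsto (fun p : Σ n, Params I J n =>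
          |crossCoef Q Q' q (rows l p.2) j| * C' j) (complete ν.law) (𝓝 (|0| * C' j)) :=
        fun j => ((tendsto_pi_nhds.1 hcross j).abs).mul_const _
      have h3 := (tendsto_finsetSum Finset.univ fun i _ => h1 i).add
        (tendsto_finsetSum Finset.univ fun j _ => h2 j)
      simpa using h3
    refine tendsto_of_tendsto_of_tendsto_of_le_of_le' tendsto_const_nhds hlim
      (Eventually.of_forall fun p => avg_nonneg fun α => abs_nonneg _) ?_
    filter_upwards [hmean, eventually_all.2 hC, eventually_all.2 hC'] with p hp h1 h2
    have h3 : ∀ α, |condMean l q (rows l p.2) α - limMean Λ Q q (rows l p.2 α)| ≤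
        ∑ i, |regr (args Q) (rows l p.2) (q.argVal (rows l p.2)) i - limCoef Λ Q q i| *
          |rows l p.2 α (Q i).term| +
        ∑ j, |crossCoef Q Q' q (rows l p.2) j| * |args Q' j (rows l p.2 α)| := by
      intro α
      rw [hp, limMean, add_sub_right_comm, ← Finset.sum_sub_distrib]
      refine (abs_add_le _ _).trans (add_le_add ?_ ?_)
      · refine (Finset.abs_sum_le_sum_abs _ _).trans (Finset.sum_le_sum fun i _ => ?_)
        rw [← sub_mul, abs_mul]
      · refine (Finset.abs_sum_le_sum_abs _ _).trans (Finset.sum_le_sum fun i _ => ?_)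
        rw [abs_mul]
    refine (avg_mono h3).trans ?_
    rw [avg_add, avg_sum, avg_sum]
    simp only [avg_const_mul]
    simp only [pow_one] at h1 h2
    exact add_le_add
      (Finset.sum_le_sum fun i _ => mul_le_mul_of_nonneg_left (h1 i) (abs_nonneg _))
      (Finset.sum_le_sum fun j _ => mul_le_mul_of_nonneg_left (h2 j) (abs_nonneg _))
  · have h1 := h.tendsto_avg_mul hl.2.1 hl.2.1
    have h2 : ∀ i, Tendsto (fun p : Σ n, Params I J n =>
        avg fun α => (Q i).arg.value (rows l p.2 α) * q.arg.value (rows l p.2 α))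
        (complete ν.law) (𝓝 (∫ z, (Q i).arg.value z * q.arg.value z ∂Λ)) :=
      fun i => h.tendsto_avg_mul (hg i) hl.2.1
    have h3 := ((h1.sub (tendsto_finsetSum Finset.univ fun i _ =>
      (tendsto_pi_nhds.1 hreg i).mul (h2 i))).const_mul ((ν.std q.mat : ℝ) ^ 2)).sqrt
    refine h3.congr' ?_
    filter_upwards [e, eventually_fst_complete (p := fun n => 0 < n) (eventually_gt_atTop 0)]
      with p hp hn
    rw [condStd_eq ν.std (rows l p.2) hn hp.1 hp.2]
    simp only [sq, Query.argVal, args]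
    rfl

/-- The law of large numbers and the moment bounds persist when the result of a product is
adjoined. -/
theorem lln_prod (h : Converges ν l Λ) (hl : Valid (q :: l)) {V : Set I}
    (hflip : ∀ n, MeasurePreserving (flip V) (ν.law n) (ν.law n)) (hpar : ∀ q' ∈ l, q'.Parity V)
    (hparq : q.Parity V) (hQ : ∀ i, Q i ∈ l ∧ (Q i).side = q.side ∧ (Q i).mat = q.mat)
    (hdet : (limGram Λ (args Q)).det ≠ 0)
    (hQ' : ∀ i, Q' i ∈ l ∧ (Q' i).side = (!q.side) ∧ (Q' i).mat = q.mat)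
    (hdet' : (limGram Λ (args Q')).det ≠ 0)
    (e : ∀ᶠ p : Σ n, Params I J n in complete ν.law, IsBasisAt l Q q.side q.mat (rows l p.2))
    (e' : ∀ᶠ p : Σ n, Params I J n in complete ν.law,
      IsBasisAt l Q' (!q.side) q.mat (rows l p.2)) :
    LLN ν.law (fun n (θ : Params I J n) α => (rows l θ α, q.term.eval θ α))
        (GaussianStep.limit Λ (limMean Λ Q q) (√(limVar ν Λ Q q))) ∧
      BddMoments ν.law fun p => q.term.eval p.2 := by
  have hg : ∀ i, (Q i).arg.gvars ⊆ gset l := fun i => hl.1.gvars_arg_subset (hQ i).1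
  -- Total variation continuity needs a positive limit variance. If the variance is zero, the exact
  -- linear relation takes its place.
  rcases (h.limVar_nonneg hg hl.2.1 hdet).lt_or_eq with hpos | h0
  · have H := h.gaussianStep hl hflip hpar hparq hQ hdet hQ' hdet' e e' hpos
    exact ⟨H.lln_prod, H.bddMoments⟩
  · have h1 := h.eventually_eq_of_limVar_eq_zero hl hQ hdet h0.symm
    rw [← h0, Real.sqrt_zero]
    refine ⟨h.lln.prodMk_of_eventually_eq
      (Finset.measurable_sum _ fun i _ => (measurable_pi_apply _).const_mul _) h1, ?_⟩
    have h2 : BddMoments ν.law fun p α => ∑ i, limCoef Λ Q q i * rows l p.2 α (Q i).term :=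
      BddMoments.sum _ fun i _ => (bddMoments_const _).mul (h.bdd_rows (term_mem_gset (hQ i).1))
    refine h2.mono ?_
    filter_upwards [h1] with p hp α
    rw [hp, limMean]

end Converges

end Adjoin

/-! ### The Gaussian limit law -/

section LimitLaw

open Complex (I)

variable {I₀ J : Type*} {ν : Init I₀ J}

theorem gaussianMoment_comm (ν : Init I₀ J) (a b : Term I₀ J) {F F' : Finset (Term I₀ J)}
    (h : F = F') :
    gaussianMoment ν a b F (Matrix.of fun g g' => limitCov ν g.1 g'.1) =
      gaussianMoment ν b a F' (Matrix.of fun g g' => limitCov ν g.1 g'.1) := by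
  subst h
  simp only [gaussianMoment, mul_comm]

theorem limitMoment_comm (ν : Init I₀ J) (a b : Term I₀ J) :
    limitMoment ν a b = limitMoment ν b a := by
  classical
  exact gaussianMoment_comm ν a b (Finset.union_comm _ _)

theorem limitCov_mul (ν : Init I₀ J) (W W' : J) (h h' : Term I₀ J) [Decidable (W = W')] :
    limitCov ν (.mul W h) (.mul W' h') =
      if W = W' then (ν.std W : ℝ) ^ 2 * limitMoment ν h h' else 0 := by
  rw [limitCov, limitMoment]
  congr

theorem limitCov_mulT (ν : Init I₀ J) (W W' : J) (h h' : Term I₀ J) [Decidable (W = W')] :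
    limitCov ν (.mulT W h) (.mulT W' h') =
      if W = W' then (ν.std W : ℝ) ^ 2 * limitMoment ν h h' else 0 := by
  rw [limitCov, limitMoment]
  congr

open scoped Classical in
theorem limitCov_term (ν : Init I₀ J) (q q' : Query I₀ J) :
    limitCov ν q.term q'.term =
      if q.side = q'.side ∧ q.mat = q'.mat then
        (ν.std q.mat : ℝ) ^ 2 * limitMoment ν q.arg q'.arg else 0 := by
  obtain ⟨b, W, h⟩ := q
  obtain ⟨b', W', h'⟩ := q'
  cases b <;> cases b' <;> simp [Query.term, limitCov_mul, limitCov_mulT]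
  · rw [limitCov] <;> simp
  · rw [limitCov] <;> simp

theorem limitCov_vec_term (ν : Init I₀ J) (i : I₀) (q : Query I₀ J) :
    limitCov ν (.vec i) q.term = 0 := by
  obtain ⟨b, W, h⟩ := q
  cases b <;> simp only [Query.term] <;> rw [limitCov] <;> simp

theorem limitMean_term (ν : Init I₀ J) (q : Query I₀ J) : limitMean ν q.term = 0 := by
  obtain ⟨b, W, h⟩ := q
  cases b <;> rfl

theorem limitCov_comm (ν : Init I₀ J) (g g' : Term I₀ J) :
    limitCov ν g g' = limitCov ν g' g := by
  classical
  cases g <;> cases g' <;>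
    first
    | (rw [limitCov_mul, limitCov_mul, limitMoment_comm]; simp only [eq_comm]; split_ifs <;> simp_all)
    | (rw [limitCov_mulT, limitCov_mulT, limitMoment_comm]; simp only [eq_comm]; split_ifs <;> simp_all)
    | skip
  · rw [limitCov, limitCov]
    exact (ν.cov_posSemidef.1.apply _ _).symm
  all_goals
    rw [limitCov, limitCov] <;> simp

/-- Under `Λ`, the coordinates in `F` are jointly Gaussian with the limit mean and covariance. -/
def IsLimitLaw (ν : Init I₀ J) (F : Finset (Term I₀ J)) (Λ : Measure (Term I₀ J → ℝ)) : Prop :=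
  ∀ x : Term I₀ J → ℝ, ∫ z, Complex.exp ((∑ g ∈ F, x g * z g : ℝ) * I) ∂Λ =
    Complex.exp ((∑ g ∈ F, x g * limitMean ν g : ℝ) * I -
      (∑ g ∈ F, ∑ g' ∈ F, x g * x g' * limitCov ν g g' : ℝ) / 2)

namespace IsLimitLaw

variable {F F' : Finset (Term I₀ J)} {Λ : Measure (Term I₀ J → ℝ)}

theorem mono (h : IsLimitLaw ν F Λ) (hF : F' ⊆ F) : IsLimitLaw ν F' Λ := by
  classical
  intro x
  have h1 : ∀ c : Term I₀ J → ℝ, ∑ g ∈ F, (if g ∈ F' then x g else 0) * c g = ∑ g ∈ F', x g * c g := by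
    intro c
    simp only [ite_mul, zero_mul]
    rw [← Finset.sum_filter, Finset.filter_mem_eq_inter, Finset.inter_eq_right.2 hF]
  have := h fun g => if g ∈ F' then x g else 0
  simp only [mul_assoc, ← Finset.mul_sum, h1] at this ⊢
  exact this

variable [IsProbabilityMeasure Λ]

/-- A characteristic function is bounded by 1, which forces the quadratic form to be nonnegative.
Thus positive semidefiniteness of the recursively defined Σ follows from the existence of the limit
law. -/
theorem sum_nonneg (h : IsLimitLaw ν F Λ) (x : Term I₀ J → ℝ) :
    0 ≤ ∑ g ∈ F, ∑ g' ∈ F, x g * x g' * limitCov ν g g' := by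
  have h1 : ‖∫ z, Complex.exp ((∑ g ∈ F, x g * z g : ℝ) * I) ∂Λ‖ ≤ 1 := by
    refine (norm_integral_le_of_norm_le_const (C := 1) (Eventually.of_forall fun z => ?_)).trans
      (by simp)
    rw [Complex.norm_exp_ofReal_mul_I]
  rw [h x, Complex.norm_exp] at h1
  have h2 := Real.exp_le_one_iff.1 h1
  rw [Complex.sub_re, Complex.re_ofReal_mul, Complex.I_re] at h2
  have h3 : (((∑ g ∈ F, ∑ g' ∈ F, x g * x g' * limitCov ν g g' : ℝ) : ℂ) / 2).re =
      (∑ g ∈ F, ∑ g' ∈ F, x g * x g' * limitCov ν g g') / 2 := by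
    rw [← Complex.ofReal_ofNat, ← Complex.ofReal_div, Complex.ofReal_re]
  rw [h3] at h2
  linarith

theorem posSemidef (h : IsLimitLaw ν F Λ) :
    (Matrix.of fun g g' : F => limitCov ν g.1 g'.1).PosSemidef := by
  classical
  refine .of_dotProduct_mulVec_nonneg (Matrix.IsHermitian.ext fun g g' => ?_) fun x => ?_
  · simp [limitCov_comm ν g.1 g'.1]
  · have h1 := h.sum_nonneg fun g => if hg : g ∈ F then x ⟨g, hg⟩ else 0
    rw [← Finset.sum_coe_sort F] at h1
    simp only [← Finset.sum_coe_sort F] at h1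
    simpa [dotProduct, Matrix.mulVec, Finset.mul_sum, mul_assoc, mul_comm] using h1

/-- The limit law of the coordinates in `F`. -/
theorem map_restrict (h : IsLimitLaw ν F Λ) :
    Λ.map (fun z => WithLp.toLp 2 fun g : F => z g.1) =
      open scoped Classical in
      multivariateGaussian (WithLp.toLp 2 fun g : F => limitMean ν g.1)
        (Matrix.of fun g g' : F => limitCov ν g.1 g'.1) := by
  classical
  have hm : Measurable fun z : Term I₀ J → ℝ => WithLp.toLp 2 fun g : F => z g.1 := by fun_prop
  have := Measure.isProbabilityMeasure_map (μ := Λ) hm.aemeasurable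
  refine Measure.ext_of_charFun ?_
  ext x
  rw [charFun_multivariateGaussian h.posSemidef, charFun_apply, integral_map hm.aemeasurable
    (by fun_prop)]
  have h1 := h fun g => if hg : g ∈ F then x ⟨g, hg⟩ else 0
  simp only [← Finset.sum_coe_sort F] at h1
  simp only [Finset.coe_mem, dite_true, Subtype.coe_eta] at h1
  simp only [PiLp.inner_apply]
  convert h1 using 2
  · simp
  · simp [dotProduct, Matrix.mulVec, Finset.mul_sum, mul_comm, mul_left_comm]

/-- The recursion for Σ integrates over the G-variables of a and b only. This law is the marginal of
Λ on those coordinates. -/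
theorem limitMoment_eq (h : IsLimitLaw ν F Λ) {a b : Term I₀ J} (ha : a.gvars ⊆ F)
    (hb : b.gvars ⊆ F) : limitMoment ν a b = ∫ z, a.value z * b.value z ∂Λ := by
  classical
  have h' := (h.mono (Finset.union_subset ha hb)).map_restrict
  have hm : Measurable fun z : Term I₀ J → ℝ =>
    WithLp.toLp 2 fun g : (a.gvars ∪ b.gvars : Finset (Term I₀ J)) => z g.1 := by fun_prop
  rw [limitMoment, gaussianMoment, ← h', integral_map hm.aemeasurable]
  · refine integral_congr_ae (Eventually.of_forall fun z => ?_)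
    simp only
    congr 1
    · exact Term.value_congr fun g hg => by simp [hg]
    · exact Term.value_congr fun g hg => by simp [hg]
  · refine Measurable.aestronglyMeasurable (Measurable.mul ?_ ?_)
    all_goals
      refine (Term.measurable_value _).comp (measurable_pi_lambda _ fun g => ?_)
      by_cases hg : g ∈ a.gvars ∪ b.gvars
      · simp only [hg, dite_true]; fun_prop
      · simp only [hg, dite_false]; exact measurable_const

end IsLimitLaw

variable [Fintype I₀] [DecidableEq I₀] [Fintype J] {l : List (Query I₀ J)}
  {Λ : Measure (Term I₀ J → ℝ)} [IsProbabilityMeasure Λ]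
  {r : Type*} [Fintype r] [DecidableEq r] {Q : r → Query I₀ J} {q : Query I₀ J}

/-- Regression of arguments is regression of results. For a result with the same matrix and side,
the argument lies in the span of the basis, where the argument of `q` and its projection have equal
inner products; the factor σ² is common. For every other G-variable both sides are zero. -/
theorem Converges.sum_limCoef_mul_limitCov (h : Converges ν l Λ) (hΛ : IsLimitLaw ν (gset l) Λ)
    (hl : Valid (q :: l)) (hQ : ∀ i, Q i ∈ l ∧ (Q i).side = q.side ∧ (Q i).mat = q.mat)
    (hdet : (limGram Λ (args Q)).det ≠ 0)
    (hspan : ∀ q' ∈ l, q'.side = q.side → q'.mat = q.mat →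
      ∃ c : r → ℝ, ∀ᵐ z ∂Λ, q'.arg.value z = ∑ i, c i * args Q i z)
    {g : Term I₀ J} (hg : g ∈ gset l) :
    ∑ i, limCoef Λ Q q i * limitCov ν g (Q i).term = limitCov ν g q.term := by
  classical
  have hQ' : ∀ i, (Q i).arg.gvars ⊆ gset l := fun i => hl.1.gvars_arg_subset (hQ i).1
  rcases mem_gset_iff.1 hg with ⟨i, rfl⟩ | ⟨q', hq', rfl⟩
  · simp [limitCov_vec_term]
  simp only [limitCov_term]
  by_cases hc : q'.side = q.side ∧ q'.mat = q.mat
  · obtain ⟨c, hc'⟩ := hspan q' hq' hc.1 hc.2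
    have hq'g := hl.1.gvars_arg_subset hq'
    have h1 : ∀ t : Term I₀ J, t.gvars ⊆ gset l → limitMoment ν q'.arg t =
        ∑ k, c k * ∫ z, args Q k z * t.value z ∂Λ := by
      intro t ht
      rw [hΛ.limitMoment_eq hq'g ht]
      have h2 : ∫ z, q'.arg.value z * t.value z ∂Λ =
          ∫ z, ∑ k, c k * (args Q k z * t.value z) ∂Λ := by
        refine integral_congr_ae ?_
        filter_upwards [hc'] with z hz
        rw [hz, Finset.sum_mul]
        exact Finset.sum_congr rfl fun k _ => mul_assoc _ _ _
      have i1 : ∀ k, Integrable (fun z => c k * (args Q k z * t.value z)) Λ :=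
        fun k => (h.integrable_mul (hQ' k) ht).const_mul _
      rw [h2, integral_finsetSum _ fun k _ => i1 k]
      simp only [integral_const_mul]
    have h3 : ∀ k, ∫ z, args Q k z * q.arg.value z ∂Λ =
        ∑ i, limCoef Λ Q q i * ∫ z, args Q k z * args Q i z ∂Λ := by
      intro k
      rw [← congrFun (limGram_mulVec_limCoef (q := q) hdet) k]
      simp only [Matrix.mulVec, dotProduct, limGram, Matrix.of_apply]
      exact Finset.sum_congr rfl fun j _ => mul_comm _ _
    have h4 : ∀ i, q'.side = (Q i).side ∧ q'.mat = (Q i).mat := fun i => by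
      rw [(hQ i).2.1, (hQ i).2.2]; exact hc
    simp only [if_pos (h4 _), if_pos hc, h1 _ (hQ' _), h1 _ hl.2.1, h3]
    have h5 : ∀ i k, ∫ z, args Q k z * (Q i).arg.value z ∂Λ = ∫ z, args Q k z * args Q i z ∂Λ :=
      fun _ _ => rfl
    simp only [h5, Finset.mul_sum]
    rw [Finset.sum_comm]
    exact Finset.sum_congr rfl fun k _ => Finset.sum_congr rfl fun i _ => by ring
  · have h4 : ∀ i, ¬ (q'.side = (Q i).side ∧ q'.mat = (Q i).mat) := fun i => by
      rw [(hQ i).2.1, (hQ i).2.2]; exact hc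
    simp [h4, hc]

omit [DecidableEq I₀] [Fintype J] in
-- The variance of the new coordinate splits into the part explained by regression and the variance
-- of the added noise.
theorem Converges.sum_limCoef_add_limVar (hΛ : IsLimitLaw ν (gset l) Λ)
    (hl : Valid (q :: l)) (hQ : ∀ i, Q i ∈ l ∧ (Q i).side = q.side ∧ (Q i).mat = q.mat) :
    ∑ i, limCoef Λ Q q i * limitCov ν (Q i).term q.term + limVar ν Λ Q q =
      limitCov ν q.term q.term := by
  classical
  have h4 : ∀ i, (Q i).side = q.side ∧ (Q i).mat = q.mat := fun i => (hQ i).2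
  have h5 : ∀ i, limitMoment ν (Q i).arg q.arg = ∫ z, args Q i z * q.arg.value z ∂Λ :=
    fun i => hΛ.limitMoment_eq (hl.1.gvars_arg_subset (hQ i).1) hl.2.1
  simp only [limitCov_term, h4, and_self, if_true, h5, hΛ.limitMoment_eq hl.2.1 hl.2.1, limVar]
  have h6 : ∑ i, limCoef Λ Q q i * ((ν.std q.mat : ℝ) ^ 2 * ∫ z, args Q i z * q.arg.value z ∂Λ) =
      (ν.std q.mat : ℝ) ^ 2 * ∑ i, limCoef Λ Q q i * ∫ z, args Q i z * q.arg.value z ∂Λ := by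
    rw [Finset.mul_sum]
    exact Finset.sum_congr rfl fun i _ => by ring
  rw [h6]
  ring

open scoped Classical in
/-- The limit law of the rows after a product is adjoined. -/
def adjoin (ν : Init I₀ J) (Λ : Measure (Term I₀ J → ℝ)) (Q : r → Query I₀ J) (q : Query I₀ J) :
    Measure (Term I₀ J → ℝ) :=
  (GaussianStep.limit Λ (limMean Λ Q q) (√(limVar ν Λ Q q))).map fun p =>
    Function.update p.1 q.term p.2

omit [Fintype I₀] [DecidableEq I₀] [Fintype J] [IsProbabilityMeasure Λ] in
theorem measurable_limMean : Measurable (limMean Λ Q q) :=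
  Finset.measurable_sum _ fun _ _ => (measurable_pi_apply _).const_mul _

omit [Fintype I₀] [DecidableEq I₀] [Fintype J] [IsProbabilityMeasure Λ] in
open scoped Classical in
theorem adjoin_eq : adjoin ν Λ Q q = (Λ.prod (gaussianReal 0 1)).map (
    fun p => Function.update p.1 q.term (limMean Λ Q q p.1 + √(limVar ν Λ Q q) * p.2)) := by
  have := measurable_limMean (Λ := Λ) (Q := Q) (q := q)
  rw [adjoin, GaussianStep.limit, Measure.map_map measurable_update' (by fun_prop)]
  rfl

omit [Fintype I₀] [DecidableEq I₀] [Fintype J] in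
instance : IsProbabilityMeasure (adjoin ν Λ Q q) := by
  classical
  have := measurable_limMean (Λ := Λ) (Q := Q) (q := q)
  rw [adjoin_eq]
  exact Measure.isProbabilityMeasure_map (measurable_update'.comp
    (measurable_fst.prodMk (by fun_prop))).aemeasurable

/-- Under the adjoined law the new coordinate is a combination of earlier ones plus independent
normal noise, so the characteristic function factors. The two preceding covariance identities match
its exponent with Σ. -/
theorem Converges.isLimitLaw_adjoin (h : Converges ν l Λ) (hΛ : IsLimitLaw ν (gset l) Λ)
    (hl : Valid (q :: l)) (hQ : ∀ i, Q i ∈ l ∧ (Q i).side = q.side ∧ (Q i).mat = q.mat)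
    (hdet : (limGram Λ (args Q)).det ≠ 0)
    (hspan : ∀ q' ∈ l, q'.side = q.side → q'.mat = q.mat →
      ∃ c : r → ℝ, ∀ᵐ z ∂Λ, q'.arg.value z = ∑ i, c i * args Q i z) :
    IsLimitLaw ν (gset (q :: l)) (adjoin ν Λ Q q) := by
  classical
  have hm := measurable_limMean (Λ := Λ) (Q := Q) (q := q)
  have hupd : Measurable fun p : (Term I₀ J → ℝ) × ℝ =>
      Function.update p.1 q.term (limMean Λ Q q p.1 + √(limVar ν Λ Q q) * p.2) :=
    measurable_update'.comp (measurable_fst.prodMk (by fun_prop))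
  intro x
  set a := limCoef Λ Q q
  set s₀ := √(limVar ν Λ Q q)
  have hs₀ : s₀ ^ 2 = limVar ν Λ Q q := Real.sq_sqrt
    (h.limVar_nonneg (fun i => hl.1.gvars_arg_subset (hQ i).1) hl.2.1 hdet)
  -- The coefficient of the new coordinate is distributed over the earlier results according to the
  -- regression. Summing over `i` avoids any injectivity of the results.
  let y : Term I₀ J → ℝ := fun g => x g + x q.term * ∑ i, if (Q i).term = g then a i else 0
  have hy : ∀ c : Term I₀ J → ℝ, ∑ g ∈ gset l, y g * c g =
      ∑ g ∈ gset l, x g * c g + x q.term * ∑ i, a i * c (Q i).term := by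
    intro c
    simp only [y, add_mul, Finset.sum_add_distrib, mul_assoc, ← Finset.mul_sum, Finset.sum_mul]
    rw [Finset.sum_comm]
    congr 2
    refine Finset.sum_congr rfl fun i _ => ?_
    simp only [ite_mul, zero_mul]
    rw [Finset.sum_ite_eq, if_pos (term_mem_gset (hQ i).1)]
  have hlin : ∀ p : (Term I₀ J → ℝ) × ℝ, ∑ g ∈ gset (q :: l),
      x g * Function.update p.1 q.term (limMean Λ Q q p.1 + s₀ * p.2) g =
      ∑ g ∈ gset l, y g * p.1 g + x q.term * s₀ * p.2 := by
    intro p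
    rw [gset, Finset.sum_insert hl.2.2, hy]
    have h1 : ∑ g ∈ gset l, x g * Function.update p.1 q.term (limMean Λ Q q p.1 + s₀ * p.2) g =
        ∑ g ∈ gset l, x g * p.1 g := by
      refine Finset.sum_congr rfl fun g hg => ?_
      rw [Function.update_of_ne]
      rintro rfl
      exact hl.2.2 hg
    rw [h1, Function.update_self, limMean]
    ring
  have hmean : ∑ g ∈ gset (q :: l), x g * limitMean ν g = ∑ g ∈ gset l, y g * limitMean ν g := by
    rw [gset, Finset.sum_insert hl.2.2, hy]
    simp [limitMean_term]
  have hquad : ∑ g ∈ gset (q :: l), ∑ g' ∈ gset (q :: l), x g * x g' * limitCov ν g g' =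
      ∑ g ∈ gset l, ∑ g' ∈ gset l, y g * y g' * limitCov ν g g' + (x q.term * s₀) ^ 2 := by
    have e1 : ∀ g ∈ gset l, ∑ i, a i * limitCov ν g (Q i).term = limitCov ν g q.term :=
      fun g hg => h.sum_limCoef_mul_limitCov hΛ hl hQ hdet hspan hg
    have e2 := Converges.sum_limCoef_add_limVar hΛ hl hQ
    have e3 : ∀ g ∈ gset l, ∑ g' ∈ gset l, y g' * limitCov ν g g' =
        ∑ g' ∈ gset l, x g' * limitCov ν g g' + x q.term * limitCov ν g q.term := fun g hg => by
      rw [hy, e1 g hg]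
    simp only [mul_assoc, ← Finset.mul_sum]
    have e8 : ∑ g ∈ gset l, y g * ∑ g' ∈ gset l, y g' * limitCov ν g g' = ∑ g ∈ gset l, y g *
        (∑ g' ∈ gset l, x g' * limitCov ν g g' + x q.term * limitCov ν g q.term) :=
      Finset.sum_congr rfl fun g hg => by rw [e3 g hg]
    rw [e8, hy, gset]
    simp only [Finset.sum_insert hl.2.2]
    have e4 : ∑ i, a i * ∑ g' ∈ gset l, x g' * limitCov ν (Q i).term g' =
        ∑ g' ∈ gset l, x g' * limitCov ν g' q.term := by
      simp only [Finset.mul_sum]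
      rw [Finset.sum_comm]
      refine Finset.sum_congr rfl fun g hg => ?_
      rw [← e1 g hg, Finset.mul_sum]
      refine Finset.sum_congr rfl fun i _ => ?_
      rw [limitCov_comm ν g]
      ring
    simp only [mul_add, Finset.sum_add_distrib, e4]
    have e5 : ∑ i, a i * (x q.term * limitCov ν (Q i).term q.term) =
        x q.term * (limitCov ν q.term q.term - s₀ ^ 2) := by
      rw [hs₀, ← e2, add_sub_cancel_right, Finset.mul_sum]
      exact Finset.sum_congr rfl fun i _ => by ring
    have e6 : ∑ g ∈ gset l, x g * limitCov ν q.term g = ∑ g ∈ gset l, x g * limitCov ν g q.term :=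
      Finset.sum_congr rfl fun g _ => by rw [limitCov_comm]
    have e7 : ∑ g ∈ gset l, x g * (x q.term * limitCov ν g q.term) =
        x q.term * ∑ g ∈ gset l, x g * limitCov ν g q.term := by
      rw [Finset.mul_sum]
      exact Finset.sum_congr rfl fun i _ => by ring
    rw [e5, e6, e7]
    ring
  have hme : Measurable fun z : Term I₀ J → ℝ =>
      Complex.exp ((∑ g ∈ gset (q :: l), x g * z g : ℝ) * I) :=
    Complex.measurable_exp.comp ((Complex.measurable_ofReal.comp (Finset.measurable_sum _
      fun g _ => (measurable_pi_apply g).const_mul _)).mul_const _)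
  rw [adjoin_eq, integral_map hupd.aemeasurable hme.aestronglyMeasurable]
  simp only [hlin, hmean, hquad]
  have hsplit : ∀ p : (Term I₀ J → ℝ) × ℝ,
      Complex.exp ((∑ g ∈ gset l, y g * p.1 g + x q.term * s₀ * p.2 : ℝ) * I) =
      Complex.exp ((∑ g ∈ gset l, y g * p.1 g : ℝ) * I) *
        Complex.exp ((x q.term * s₀ : ℝ) * p.2 * I) := fun p => by
    rw [← Complex.exp_add]
    push_cast
    ring_nf
  simp only [hsplit]
  rw [integral_prod_mul (fun z : Term I₀ J → ℝ => Complex.exp ((∑ g ∈ gset l, y g * z g : ℝ) * I))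
    fun t : ℝ => Complex.exp ((x q.term * s₀ : ℝ) * t * I), hΛ y, ← charFun_apply_real,
    charFun_gaussianReal, ← Complex.exp_add]
  push_cast
  ring_nf

end LimitLaw

/-! ### The input vectors -/

section Base

theorem LLN.comp_measurePreserving {Ω Ω' : ℕ → Type*} [∀ n, MeasurableSpace (Ω n)]
    [∀ n, MeasurableSpace (Ω' n)] {μ : ∀ n, Measure (Ω n)} {μ' : ∀ n, Measure (Ω' n)}
    {𝓧 : Type*} [MeasurableSpace 𝓧] {X : ∀ n, Ω' n → Fin n → 𝓧} {Λ : Measure 𝓧}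
    (h : LLN μ' X Λ) {T : ∀ n, Ω n → Ω' n} (hT : ∀ n, MeasurePreserving (T n) (μ n) (μ' n)) :
    LLN μ (fun n ω => X n (T n ω)) Λ := by
  have h2 := tendsto_complete_map hT
  refine ⟨fun ψ hψ hb => ?_, fun N hN h0 => ?_⟩
  · have h1 := h.conv ψ hψ hb
    have h3 := h1.comp h2
    refine h3.congr fun x => ?_
    rfl
  · have h1 := h.null N hN h0
    have h3 := h2.eventually h1
    refine h3.mono fun x hx => ?_
    exact hx

variable {𝓨 : Type*} [MeasurableSpace 𝓨] (ρ : Measure 𝓨) [IsProbabilityMeasure ρ]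

/-- The law of large numbers for independent identically distributed random variables. -/
theorem lln_pi : LLN (fun n => Measure.pi fun _ : Fin n => ρ) (fun _ y => y) ρ where
  conv ψ hψ := by
    rintro ⟨C, hC⟩
    have hB : ∀ y, |ψ y| ≤ |C| + 1 := fun y => (hC y).trans ((le_abs_self C).trans (by linarith))
    set B := |C| + 1
    have hB0 : 0 < B := by positivity
    refine Metric.tendsto_nhds.2 fun ε hε => ?_
    -- The factor n⁰ only brings the bound into the form polynomial times exponential.
    have hsum : Summable fun n : ℕ => 2 * ((n : ℝ) ^ 0 * Real.exp (-(ε ^ 2 / (2 * B ^ 2)) * n)) :=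
      (Real.summable_pow_mul_exp_neg_nat_mul _ (by positivity)).mul_left _
    refine eventually_complete_of_le hsum.tsum_ofReal_ne_top
      (eventually_fst_complete (p := fun n => 0 < n) (eventually_gt_atTop 0)) fun n => ?_
    rcases Nat.eq_zero_or_pos n with rfl | hn
    · simp
    have hn0 : (0 : ℝ) < n := by exact_mod_cast hn
    refine (measure_mono ?_).trans ((hoeffding_pi (fun _ : Fin n => ρ) (f := fun _ => ψ)
      (ε := ε * n) (fun _ => hψ) (fun _ => hB) (by positivity)).trans ?_)
    · rintro y ⟨-, hy⟩
      rw [Real.dist_eq, not_lt] at hy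
      have h1 : avg (fun α => ψ (y α)) - ∫ t, ψ t ∂ρ =
          (n : ℝ)⁻¹ * ∑ α : Fin n, (ψ (y α) - ∫ t, ψ t ∂ρ) := by
        rw [avg, Finset.sum_sub_distrib, mul_sub]
        simp [hn0.ne']
      rw [h1, abs_mul, abs_of_pos (inv_pos.2 hn0), inv_mul_eq_div, le_div_iff₀ hn0] at hy
      exact hy
    · refine ENNReal.ofReal_le_ofReal (mul_le_mul_of_nonneg_left ?_ (by norm_num))
      rw [pow_zero, one_mul, Fintype.card_fin]
      refine (congrArg Real.exp ?_).le
      field_simp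
  null N hN h0 := by
    refine eventually_complete_of_ae (q := fun _ => True) (Eventually.of_forall fun _ => trivial)
      fun n => ?_
    have h1 : ∀ᵐ y ∂(Measure.pi fun _ : Fin n => ρ), ∀ α, y α ∉ N := by
      refine ae_all_iff.2 fun α => ?_
      exact (measurePreserving_eval (fun _ : Fin n => ρ) α).quasiMeasurePreserving.ae
        (measure_eq_zero_iff_ae_notMem.1 h0)
    exact measure_mono_null (fun y hy => hy.2) (ae_iff.1 h1)

theorem bddMoments_pi {f : 𝓨 → ℝ} (hf : Measurable f) (hL : ∀ p : ℕ, MemLp f p ρ) :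
    BddMoments (fun n => Measure.pi fun _ : Fin n => ρ) fun p α => f (p.2 α) := by
  intro k
  obtain ⟨K, hK⟩ := exists_measure_pi_avg_gt_le ρ (f := fun y => |f y| ^ k) (by fun_prop)
    (memLp_abs_pow hL k)
  refine ⟨∫ y, |f y| ^ k ∂ρ + 1, ?_⟩
  have hsum : ∑' n : ℕ, ENNReal.ofReal (K * (1 / (n : ℝ) ^ 2)) ≠ ⊤ :=
    ((Real.summable_one_div_nat_pow.2 one_lt_two).mul_left _).tsum_ofReal_ne_top
  refine eventually_complete_of_le hsum
    (eventually_fst_complete (p := fun n => 0 < n) (eventually_gt_atTop 0)) fun n => ?_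
  rcases Nat.eq_zero_or_pos n with rfl | hn
  · simp
  refine (measure_mono ?_).trans ((hK n hn).trans ?_)
  · rintro y ⟨-, hy⟩
    exact not_le.1 hy
  · rw [mul_one_div]

open Complex (I)

variable {I₀ J : Type*} [Fintype I₀] [DecidableEq I₀] [Fintype J]

/-- The law of a row of input vectors. -/
def inputLaw (ν : Init I₀ J) : Measure (Term I₀ J → ℝ) :=
  (multivariateGaussian (WithLp.toLp 2 ν.mean) ν.cov).map vecRow

omit [Fintype J] in
instance (ν : Init I₀ J) : IsProbabilityMeasure (inputLaw ν) :=
  Measure.isProbabilityMeasure_map measurable_vecRow.aemeasurable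

omit [Fintype J] in
theorem isLimitLaw_inputLaw (ν : Init I₀ J) : IsLimitLaw ν (gset []) (inputLaw ν) := by
  classical
  intro x
  have hsum : ∀ c : Term I₀ J → ℝ, ∑ g ∈ gset ([] : List (Query I₀ J)), c g = ∑ i, c (.vec i) :=
    fun c => Finset.sum_image fun i _ j _ h => Term.vec.inj h
  have hme : Measurable fun z : Term I₀ J → ℝ => Complex.exp ((∑ i, x (.vec i) * z (.vec i) : ℝ) * I) :=
    Complex.measurable_exp.comp ((Complex.measurable_ofReal.comp (Finset.measurable_sum _
      fun i _ => (measurable_pi_apply _).const_mul _)).mul_const _)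
  simp only [hsum]
  rw [inputLaw, integral_map measurable_vecRow.aemeasurable hme.aestronglyMeasurable]
  have h1 := charFun_multivariateGaussian (μ := WithLp.toLp 2 ν.mean) ν.cov_posSemidef
    (WithLp.toLp 2 fun i => x (.vec i))
  rw [charFun_apply] at h1
  convert h1 using 2
  · simp [vecRow, PiLp.inner_apply]
  · have h2 : ∀ i j, limitCov ν (.vec i) (.vec j) = ν.cov i j := fun i j => by rw [limitCov]
    simp [limitMean, h2, dotProduct, Matrix.mulVec, Finset.mul_sum, PiLp.inner_apply, mul_comm,
      mul_assoc]

theorem converges_nil (ν : Init I₀ J) : Converges ν [] (inputLaw ν) := by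
  classical
  set ρ := multivariateGaussian (WithLp.toLp 2 ν.mean) ν.cov
  have hT : ∀ n, MeasurePreserving (fun θ : Params I₀ J n => θ.1) (ν.law n)
      (Measure.pi fun _ : Fin n => ρ) := fun n => measurePreserving_fst
  refine ⟨((lln_pi ρ).comp_measurePreserving hT).map measurable_vecRow, fun g hg => ?_⟩
  obtain ⟨i, -, rfl⟩ := Finset.mem_image.1 hg
  have h1 : BddMoments (fun n => Measure.pi fun _ : Fin n => ρ) fun p α => p.2 α i := by
    refine bddMoments_pi ρ (f := fun y => y i) (by fun_prop) fun p => ?_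
    have := measurePreserving_eval_multivariateGaussian (μ := WithLp.toLp 2 ν.mean)
      ν.cov_posSemidef (i := i)
    exact (memLp_id_gaussianReal' p (ENNReal.natCast_ne_top p)).comp_measurePreserving this
  intro k
  obtain ⟨C, hC⟩ := h1 k
  exact ⟨C, (tendsto_complete_map hT).eventually hC⟩

end Base

/-! ### Convergence of programs -/

section Convergence

variable {I J : Type*} [Fintype I] [DecidableEq I] [Fintype J] {ν : Init I J}

theorem Converges.exists_cons {l : List (Query I J)} {q : Query I J}
    {Λ : Measure (Term I J → ℝ)} [IsProbabilityMeasure Λ] (h : Converges ν l Λ)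
    (hΛ : IsLimitLaw ν (gset l) Λ) (hl : Valid (q :: l)) {V : Set I}
    (hflip : ∀ n, MeasurePreserving (flip V) (ν.law n) (ν.law n)) (hpar : ∀ q' ∈ l, q'.Parity V)
    (hparq : q.Parity V) :
    ∃ Λ' : Measure (Term I J → ℝ), IsProbabilityMeasure Λ' ∧ IsLimitLaw ν (gset (q :: l)) Λ' ∧
      Converges ν (q :: l) Λ' := by
  classical
  obtain ⟨B, hB, hdet, hspan, e⟩ := h.exists_side_basis hl.1 q.side q.mat
  obtain ⟨B', hB', hdet', -, e'⟩ := h.exists_side_basis hl.1 (!q.side) q.mat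
  obtain ⟨h1, h2⟩ := h.lln_prod hl hflip hpar hparq hB hdet hB' hdet' e e'
  refine ⟨adjoin ν Λ (fun i : B => i.1) q, inferInstance,
    h.isLimitLaw_adjoin hΛ hl hB hdet hspan, h1.map measurable_update', fun g hg => ?_⟩
  rcases Finset.mem_insert.1 hg with rfl | hg
  · exact h2
  · exact h.bdd g hg

theorem exists_converges {V : Set I}
    (hflip : ∀ n, MeasurePreserving (flip V) (ν.law n) (ν.law n)) {l : List (Query I J)}
    (hl : Valid l) (hpar : ∀ q ∈ l, q.Parity V) :
    ∃ Λ : Measure (Term I J → ℝ), IsProbabilityMeasure Λ ∧ IsLimitLaw ν (gset l) Λ ∧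
      Converges ν l Λ := by
  induction l with
  | nil => exact ⟨inputLaw ν, inferInstance, isLimitLaw_inputLaw ν, converges_nil ν⟩
  | cons q l ih =>
    have hpar' : ∀ q' ∈ l, q'.Parity V := fun q' hq' => hpar q' (List.mem_cons_of_mem _ hq')
    obtain ⟨Λ, _, hΛ, h⟩ := ih hl.1 hpar'
    exact h.exists_cons hΛ hl hflip hpar' (hpar q List.mem_cons_self)

end Convergence

/-! ### From expressions to lists of products. -/

section Programs

variable {I J : Type*}

variable [Fintype I]

/-- The expression tree is linearized: products in the arguments are listed before the products that
use them, and a product already present is not repeated. The statement extends an arbitrary valid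
list so that several vectors can be accommodated in one list. -/
theorem Valid.exists_extension {P : Set (Term I J)} {t : Term I J}
    (ht : ∀ s, Subterm s t → s ∈ P) {l : List (Query I J)} (hl : Valid l)
    (hlP : ∀ q ∈ l, q.term ∈ P) :
    ∃ l' : List (Query I J), Valid l' ∧ (∀ q ∈ l', q.term ∈ P) ∧ gset l ⊆ gset l' ∧
      t.gvars ⊆ gset l' := by
  classical
  have key : ∀ (q : Query I J) (l' : List (Query I J)), q.term ∈ P → Valid l' →
      (∀ q ∈ l', q.term ∈ P) → q.arg.gvars ⊆ gset l' →
      ∃ l'' : List (Query I J), Valid l'' ∧ (∀ q ∈ l'', q.term ∈ P) ∧ gset l' ⊆ gset l'' ∧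
        {q.term} ⊆ gset l'' := by
    intro q l' hq hl' hlP' harg
    by_cases hmem : q.term ∈ gset l'
    · exact ⟨l', hl', hlP', subset_rfl, Finset.singleton_subset_iff.2 hmem⟩
    · refine ⟨q :: l', ⟨hl', harg, hmem⟩, fun q' hq' => ?_, Finset.subset_insert _ _,
        Finset.singleton_subset_iff.2 (Finset.mem_insert_self _ _)⟩
      rcases List.mem_cons.1 hq' with rfl | h
      · exact hq
      · exact hlP' _ h
  induction t generalizing l with
  | vec i =>
    exact ⟨l, hl, hlP, subset_rfl, by simpa [Term.gvars] using vec_mem_gset l i⟩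
  | mul W h ih =>
    obtain ⟨l', h1, h2, h3, h4⟩ := ih (fun s hs => ht s (.mul W hs)) hl hlP
    obtain ⟨l'', h5, h6, h7, h8⟩ := key ⟨true, W, h⟩ l' (ht _ (.refl _)) h1 h2 h4
    exact ⟨l'', h5, h6, h3.trans h7, h8⟩
  | mulT W h ih =>
    obtain ⟨l', h1, h2, h3, h4⟩ := ih (fun s hs => ht s (.mulT W hs)) hl hlP
    obtain ⟨l'', h5, h6, h7, h8⟩ := key ⟨false, W, h⟩ l' (ht _ (.refl _)) h1 h2 h4
    exact ⟨l'', h5, h6, h3.trans h7, h8⟩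
  | @nonlin m φ args ih =>
    have hS : ∀ S : Finset (Fin m), ∃ l' : List (Query I J), Valid l' ∧ (∀ q ∈ l', q.term ∈ P) ∧
        gset l ⊆ gset l' ∧ (S.biUnion fun k => (args k).gvars) ⊆ gset l' := by
      intro S
      induction S using Finset.induction_on with
      | empty => exact ⟨l, hl, hlP, subset_rfl, by simp⟩
      | insert k S _ ihS =>
        obtain ⟨l', h1, h2, h3, h4⟩ := ihS
        obtain ⟨l'', h5, h6, h7, h8⟩ := ih k (fun s hs => ht s (.nonlin φ args k hs)) h1 h2
        refine ⟨l'', h5, h6, h3.trans h7, ?_⟩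
        rw [Finset.biUnion_insert]
        exact Finset.union_subset h8 (h4.trans h7)
    exact hS Finset.univ

variable [DecidableEq I] [Fintype J] {ν : Init I J}

/-- In a BP-like program, the empirical second moments converge to the limit moments. -/
theorem BPLike.tendsto_avg_mul {P : Set (Term I J)} (hP : BPLike ν P) {a b : Term I J}
    (ha : ∀ s, Subterm s a → s ∈ P) (hb : ∀ s, Subterm s b → s ∈ P) :
    Tendsto (fun p : Σ n, Params I J n => avg fun α => a.eval p.2 α * b.eval p.2 α)
      (complete ν.law) (𝓝 (limitMoment ν a b)) := by
  obtain ⟨V, -, hmean, hcov, hT, hN⟩ := hP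
  have hflip := ν.measurePreserving_flip hmean hcov
  have hpar : ∀ q : Query I J, q.term ∈ P → q.Parity V := by
    rintro ⟨b, W, h⟩ hq
    cases b
    · exact hT W h hq
    · exact hN W h hq
  obtain ⟨l₁, h1, h2, -, h4⟩ := Valid.exists_extension (P := P) ha
    (l := ([] : List (Query I J))) trivial (by simp)
  obtain ⟨l, h5, h6, h7, h8⟩ := Valid.exists_extension (P := P) hb h1 h2
  obtain ⟨Λ, _, hΛ, h⟩ := exists_converges hflip h5 fun q hq => hpar q (h6 q hq)
  have h9 := h.tendsto_avg_mul (h4.trans h7) h8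
  rw [← hΛ.limitMoment_eq (h4.trans h7) h8] at h9
  simpa only [value_rows (h4.trans h7), value_rows h8] using h9

end Programs

/-! ### The neural tangent kernel -/

section NTK

theorem sum_map_mul_sum_map {𝓐 𝓑 : Type*} (L : List 𝓐) (L' : List 𝓑) (f : 𝓐 → ℝ) (g : 𝓑 → ℝ) :
    (L.map f).sum * (L'.map g).sum = (L.map fun a => (L'.map fun b => f a * g b).sum).sum := by
  simp only [List.sum_map_mul_left, List.sum_map_mul_right]

theorem finsetSum_sum_map {ι 𝓐 : Type*} (s : Finset ι) (L : List 𝓐) (f : ι → 𝓐 → ℝ) :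
    ∑ i ∈ s, (L.map (f i)).sum = (L.map fun a => ∑ i ∈ s, f i a).sum := by
  induction L with
  | nil => simp
  | cons a L ih => simp [Finset.sum_add_distrib, ih]

theorem tendsto_sum_map {𝓐 𝓑 : Type*} {F : Filter 𝓑} {f : 𝓐 → 𝓑 → ℝ} {c : 𝓐 → ℝ}
    {L : List 𝓐} (h : ∀ a ∈ L, Tendsto (f a) F (𝓝 (c a))) :
    Tendsto (fun x => (L.map fun a => f a x).sum) F (𝓝 (L.map c).sum) := by
  induction L with
  | nil => simpa using tendsto_const_nhds
  | cons a L ih =>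
    simp only [List.map_cons, List.sum_cons]
    exact (h a List.mem_cons_self).add (ih fun b hb => h b (List.mem_cons_of_mem _ hb))

namespace Network

variable {X I J : Type*} [Fintype I] [DecidableEq I] [Fintype J] [DecidableEq J]

/-- An outer product pairs with another as the product of two inner products. The prefactors
n^(-1/2) and n⁻¹ of the gradients are exactly what turns each inner product into an average. -/
theorem ntk_eq (N : Network X I J) (n : ℕ) (ξ ξ' : X) (θ : Params I J n) :
    N.ntk n ξ ξ' θ =
      (∑ i, ((N.vecAdj ξ i).map fun d => ((N.vecAdj ξ' i).map fun d' =>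
        avg fun α => d.eval θ α * d'.eval θ α).sum).sum) +
      ∑ W, ((N.matAdj ξ W).map fun p => ((N.matAdj ξ' W).map fun p' =>
        (avg fun α => p.1.eval θ α * p'.1.eval θ α) *
          avg fun α => p.2.eval θ α * p'.2.eval θ α).sum).sum := by
  have hn : (√(n : ℝ))⁻¹ * (√(n : ℝ))⁻¹ = (n : ℝ)⁻¹ := by
    rw [← mul_inv, Real.mul_self_sqrt (Nat.cast_nonneg n)]
  rw [ntk]
  congr 1
  · rw [Finset.sum_comm]
    refine Finset.sum_congr rfl fun i _ => ?_
    have h1 : ∀ α, N.gradVec n ξ θ α i * N.gradVec n ξ' θ α i =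
        ((N.vecAdj ξ i).map fun d => ((N.vecAdj ξ' i).map fun d' =>
          (n : ℝ)⁻¹ * (d.eval θ α * d'.eval θ α)).sum).sum := by
      intro α
      rw [gradVec, gradVec, mul_mul_mul_comm, hn, sum_map_mul_sum_map]
      simp only [List.sum_map_mul_left]
    simp only [h1, finsetSum_sum_map, avg, Finset.mul_sum]
  · refine Finset.sum_congr rfl fun W _ => ?_
    have h1 : ∀ α β, N.gradMat n ξ θ W α β * N.gradMat n ξ' θ W α β =
        ((N.matAdj ξ W).map fun p => ((N.matAdj ξ' W).map fun p' =>
          (n : ℝ)⁻¹ * (p.1.eval θ α * p'.1.eval θ α) *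
            ((n : ℝ)⁻¹ * (p.2.eval θ β * p'.2.eval θ β))).sum).sum := by
      intro α β
      rw [gradMat, gradMat, mul_mul_mul_comm, sum_map_mul_sum_map, ← List.sum_map_mul_left]
      refine congrArg List.sum (List.map_congr_left fun p _ => ?_)
      rw [← List.sum_map_mul_left]
      refine congrArg List.sum (List.map_congr_left fun p' _ => ?_)
      ring
    simp only [h1, finsetSum_sum_map, avg, Finset.mul_sum, Finset.sum_mul]
    refine congrArg List.sum (List.map_congr_left fun p _ => ?_)
    refine congrArg List.sum (List.map_congr_left fun p' _ => ?_)
    rw [Finset.sum_comm]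

theorem tendsto_ntk (N : Network X I J) {ν : Init I J} (hN : BPLike ν N.program) (ξ ξ' : X) :
    Tendsto (fun p : Σ n, Params I J n => N.ntk p.1 ξ ξ' p.2) (complete ν.law)
      (𝓝 (N.limitKernel ν ξ ξ')) := by
  have hv : ∀ ξ i, ∀ d ∈ N.vecAdj ξ i, ∀ s, Subterm s d → s ∈ N.program :=
    fun ξ i d hd s hs => ⟨ξ, d, hs, .inr (.inr (.inl ⟨i, hd⟩))⟩
  have hm1 : ∀ ξ W, ∀ p ∈ N.matAdj ξ W, ∀ s, Subterm s p.1 → s ∈ N.program :=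
    fun ξ W p hp s hs => ⟨ξ, p.1, hs, .inr (.inr (.inr ⟨W, p, hp, .inl rfl⟩))⟩
  have hm2 : ∀ ξ W, ∀ p ∈ N.matAdj ξ W, ∀ s, Subterm s p.2 → s ∈ N.program :=
    fun ξ W p hp s hs => ⟨ξ, p.2, hs, .inr (.inr (.inr ⟨W, p, hp, .inr rfl⟩))⟩
  simp only [ntk_eq, limitKernel]
  refine Tendsto.add (tendsto_finsetSum _ fun i _ => ?_) (tendsto_finsetSum _ fun W _ => ?_)
  · exact tendsto_sum_map fun d hd => tendsto_sum_map fun d' hd' =>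
      hN.tendsto_avg_mul (hv ξ i d hd) (hv ξ' i d' hd')
  · exact tendsto_sum_map fun p hp => tendsto_sum_map fun p' hp' =>
      (hN.tendsto_avg_mul (hm1 ξ W p hp) (hm1 ξ' W p' hp')).mul
        (hN.tendsto_avg_mul (hm2 ξ W p hp) (hm2 ξ' W p' hp'))

theorem ae_tendsto_ntk (N : Network X I J) {ν : Init I J} (hN : BPLike ν N.program)
    {Ω : Type*} [MeasurableSpace Ω] {P : Measure Ω} {θ : (n : ℕ) → Ω → Params I J n}
    (hθ : ∀ n, HasLaw (θ n) (ν.law n) P) (s : Finset X) :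
    ∀ᵐ ω ∂P, ∀ ξ ∈ s, ∀ ξ' ∈ s,
      Tendsto (fun n => N.ntk n ξ ξ' (θ n ω)) atTop (𝓝 (N.limitKernel ν ξ ξ')) := by
  refine (Filter.eventually_all_finset s).2 fun ξ _ => ?_
  refine (Filter.eventually_all_finset s).2 fun ξ' _ => ?_
  have h := ae_tendsto_of_tendsto_complete (μ := ν.law) hθ
    (X := fun p : Σ n, Params I J n => N.ntk p.1 ξ ξ' p.2) (N.tendsto_ntk hN ξ ξ')
  exact h

end Network

end NTK

/-! ### Backpropagation computes the gradient -/

section Backprop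

variable {I J : Type*} [Fintype I] [DecidableEq I] [Fintype J] [DecidableEq J] {n : ℕ}

/-- The `α`-th coordinate of the `i`-th input vector. -/
def vecEntry (α : Fin n) (i : I) : Params I J n →L[ℝ] ℝ :=
  (EuclideanSpace.proj i).comp ((ContinuousLinearMap.proj (R := ℝ) (φ := fun _ : Fin n => EuclideanSpace ℝ I)
    α).comp
    (ContinuousLinearMap.fst ℝ _ _))

/-- An entry of a matrix. -/
def matEntry (W : J) (α β : Fin n) : Params I J n →L[ℝ] ℝ :=
  (ContinuousLinearMap.proj (R := ℝ) (φ := fun _ : Fin n => ℝ) β).comp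
    ((ContinuousLinearMap.proj (R := ℝ) (φ := fun _ : Fin n => Fin n → ℝ) α).comp
      ((ContinuousLinearMap.proj (R := ℝ) (φ := fun _ : J => Fin n → Fin n → ℝ) W).comp
        (ContinuousLinearMap.snd ℝ _ _)))

omit [Fintype I] [DecidableEq I] [Fintype J] [DecidableEq J] in
theorem hasFDerivAt_vecEntry [Finite I] [Finite J] (α : Fin n) (i : I) (θ : Params I J n) :
    HasFDerivAt (fun θ : Params I J n => θ.1 α i) (vecEntry α i) θ :=
  (vecEntry α i : Params I J n →L[ℝ] ℝ).hasFDerivAt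

omit [Fintype I] [DecidableEq I] [Fintype J] [DecidableEq J] in
theorem hasFDerivAt_matEntry [Finite I] [Finite J] (W : J) (α β : Fin n) (θ : Params I J n) :
    HasFDerivAt (fun θ : Params I J n => θ.2 W α β) (matEntry W α β) θ :=
  (matEntry W α β : Params I J n →L[ℝ] ℝ).hasFDerivAt

/-- The pairing of the backpropagated adjoints with a direction in parameter space. -/
def Net.pairing (b : Net I J) (d : Term I J) (θ δ : Params I J n) : ℝ :=
  (∑ i, ∑ α, ((b.vecAdj i d).map fun t => t.eval θ α).sum * δ.1 α i) +
    (√(n : ℝ))⁻¹ * ∑ W, ∑ α, ∑ β,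
      ((b.matAdj W d).map fun p => p.1.eval θ α * p.2.eval θ β).sum * δ.2 W α β

theorem Net.pairing_vec (j : I) (d : Term I J) (θ δ : Params I J n) :
    (Net.vec j).pairing d θ δ = ∑ α, d.eval θ α * δ.1 α j := by
  have h : ∀ i α, ((if j = i then [d] else []).map fun t => t.eval θ α).sum * δ.1 α i =
      if j = i then d.eval θ α * δ.1 α i else 0 := fun i α => by split_ifs <;> simp
  simp only [Net.pairing, Net.vecAdj, Net.matAdj, h]
  rw [Finset.sum_comm]
  simp

theorem Net.pairing_mul (W : J) (b : Net I J) (d : Term I J) (θ δ : Params I J n) :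
    (Net.mul W b).pairing d θ δ = b.pairing (.mulT W d) θ δ +
      (√(n : ℝ))⁻¹ * ∑ α, ∑ β, d.eval θ α * b.toTerm.eval θ β * δ.2 W α β := by
  have h : ∀ W' α β, ((((if W = W' then [(d, b.toTerm)] else []) ++
      b.matAdj W' (.mulT W d)).map fun p => p.1.eval θ α * p.2.eval θ β).sum * δ.2 W' α β) =
      (if W = W' then d.eval θ α * b.toTerm.eval θ β * δ.2 W' α β else 0) +
        ((b.matAdj W' (.mulT W d)).map fun p => p.1.eval θ α * p.2.eval θ β).sum * δ.2 W' α β :=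
    fun W' α β => by split_ifs <;> simp [add_mul]
  have h2 : ∀ f : J → Fin n → Fin n → ℝ,
      ∑ W', ∑ α, ∑ β, (if W = W' then f W' α β else 0) = ∑ α, ∑ β, f W α β := fun f => by
    rw [Finset.sum_eq_single W (fun W' _ hW => by simp [hW.symm]) (by simp)]
    simp
  simp only [Net.pairing, Net.vecAdj, Net.matAdj, h, Finset.sum_add_distrib, h2]
  ring

theorem Net.pairing_mulT (W : J) (b : Net I J) (d : Term I J) (θ δ : Params I J n) :
    (Net.mulT W b).pairing d θ δ = b.pairing (.mul W d) θ δ +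
      (√(n : ℝ))⁻¹ * ∑ α, ∑ β, b.toTerm.eval θ α * d.eval θ β * δ.2 W α β := by
  have h : ∀ W' α β, ((((if W = W' then [(b.toTerm, d)] else []) ++
      b.matAdj W' (.mul W d)).map fun p => p.1.eval θ α * p.2.eval θ β).sum * δ.2 W' α β) =
      (if W = W' then b.toTerm.eval θ α * d.eval θ β * δ.2 W' α β else 0) +
        ((b.matAdj W' (.mul W d)).map fun p => p.1.eval θ α * p.2.eval θ β).sum * δ.2 W' α β :=
    fun W' α β => by split_ifs <;> simp [add_mul]
  have h2 : ∀ f : J → Fin n → Fin n → ℝ,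
      ∑ W', ∑ α, ∑ β, (if W = W' then f W' α β else 0) = ∑ α, ∑ β, f W α β := fun f => by
    rw [Finset.sum_eq_single W (fun W' _ hW => by simp [hW.symm]) (by simp)]
    simp
  simp only [Net.pairing, Net.vecAdj, Net.matAdj, h, Finset.sum_add_distrib, h2]
  ring

theorem sum_map_flatten_ofFn {𝓐 : Type*} {m : ℕ} (L : Fin m → List 𝓐) (f : 𝓐 → ℝ) :
    ((List.ofFn L).flatten.map f).sum = ∑ k, ((L k).map f).sum := by
  rw [List.map_flatten, List.sum_flatten, List.map_ofFn, List.map_ofFn, List.sum_ofFn]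
  rfl

theorem Net.pairing_act {m : ℕ} (φ : Activation m) (args : Fin m → Net I J) (d : Term I J)
    (θ δ : Params I J n) :
    (Net.act φ args).pairing d θ δ = ∑ k, (args k).pairing (backArg φ args d k) θ δ := by
  simp only [Net.pairing, Net.vecAdj, Net.matAdj, sum_map_flatten_ofFn, Finset.sum_add_distrib,
    Finset.sum_mul, ← Finset.mul_sum]
  congr 1
  · rw [Finset.sum_comm]
    conv_rhs => rw [Finset.sum_comm]
    simp only [Finset.sum_comm (s := (Finset.univ : Finset (Fin m)))]
    rw [Finset.sum_comm]
  · congr 1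
    simp only [Finset.sum_comm (t := (Finset.univ : Finset (Fin m)))]

omit [Fintype I] [DecidableEq I] [Fintype J] [DecidableEq J] in
theorem eval_backArg {m : ℕ} (φ : Activation m) (args : Fin m → Net I J) (d : Term I J) (k : Fin m)
    (θ : Params I J n) (α : Fin n) :
    (backArg φ args d k).eval θ α =
      d.eval θ α * φ.deriv k fun j => (args j).toTerm.eval θ α := rfl

/-- Backpropagation is the transpose of the derivative. The identity is stated for every adjoint d,
because the induction passes from d at a node to Wᵀ d, W d or the adjoint through an activation at
its arguments. The derivatives `D` are those of the chain rule and do not depend on d. -/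
theorem Net.hasFDerivAt_eval {θ : Params I J n} (b : Net I J) (hb : b.RegularAt θ) :
    ∃ D : Fin n → Params I J n →L[ℝ] ℝ,
      (∀ α, HasFDerivAt (fun θ => b.toTerm.eval θ α) (D α) θ) ∧
      ∀ (d : Term I J) (δ : Params I J n), ∑ α, d.eval θ α * D α δ = b.pairing d θ δ := by
  induction b with
  | vec j =>
    refine ⟨fun α => vecEntry α j, fun α => hasFDerivAt_vecEntry α j θ, fun d δ => ?_⟩
    rw [Net.pairing_vec]
    rfl
  | mul W b ih =>
    obtain ⟨D, hD, hp⟩ := ih hb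
    refine ⟨fun α => (√(n : ℝ))⁻¹ • ∑ β, (θ.2 W α β • D β + b.toTerm.eval θ β • matEntry W α β),
      fun α => ?_, fun d δ => ?_⟩
    · exact (HasFDerivAt.fun_sum fun β _ =>
        (hasFDerivAt_matEntry W α β θ).mul (hD β)).const_mul _
    · rw [Net.pairing_mul, ← hp]
      simp only [smul_apply, sum_apply,
        add_apply, smul_eq_mul, Term.eval, Finset.sum_add_distrib, mul_add,
        Finset.mul_sum, Finset.sum_mul]
      congr 1
      -- Transposition: ⟨d, W x⟩ = ⟨Wᵀ d, x⟩, with x the derivative of the argument.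
      · rw [Finset.sum_comm]
        exact Finset.sum_congr rfl fun β _ => Finset.sum_congr rfl fun α _ => by ring
      · exact Finset.sum_congr rfl fun α _ => Finset.sum_congr rfl fun β _ => by
          rw [show matEntry W α β δ = δ.2 W α β from rfl]
          ring
  | mulT W b ih =>
    obtain ⟨D, hD, hp⟩ := ih hb
    refine ⟨fun α => (√(n : ℝ))⁻¹ • ∑ β, (θ.2 W β α • D β + b.toTerm.eval θ β • matEntry W β α),
      fun α => ?_, fun d δ => ?_⟩
    · exact (HasFDerivAt.fun_sum fun β _ =>
        (hasFDerivAt_matEntry W β α θ).mul (hD β)).const_mul _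
    · rw [Net.pairing_mulT, ← hp]
      simp only [smul_apply, sum_apply,
        add_apply, smul_eq_mul, Term.eval, Finset.sum_add_distrib, mul_add,
        Finset.mul_sum, Finset.sum_mul]
      congr 1
      · rw [Finset.sum_comm]
        exact Finset.sum_congr rfl fun β _ => Finset.sum_congr rfl fun α _ => by ring
      · rw [Finset.sum_comm]
        exact Finset.sum_congr rfl fun α _ => Finset.sum_congr rfl fun β _ => by
          rw [show matEntry W α β δ = δ.2 W α β from rfl]
          ring
  | @act m φ args ih =>
    choose D hD hp using fun k => ih k (hb.1 k)
    refine ⟨fun α => ∑ k, φ.deriv k (fun j => (args j).toTerm.eval θ α) • D k α,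
      fun α => ?_, fun d δ => ?_⟩
    · have h1 : HasFDerivAt (fun θ k => (args k).toTerm.eval θ α)
          (ContinuousLinearMap.pi fun k => D k α) θ := hasFDerivAt_pi.2 fun k => hD k α
      have h2 := (hb.2 α).comp θ h1
      refine h2.congr_fderiv ?_
      ext δ <;> simp [sum_apply]
    · rw [Net.pairing_act]
      simp only [← hp, eval_backArg, sum_apply, smul_apply,
        smul_eq_mul, Finset.mul_sum]
      rw [Finset.sum_comm]
      exact Finset.sum_congr rfl fun k _ => Finset.sum_congr rfl fun α _ => by ring

variable {X : Type*}

/-- At regular parameters, backpropagation computes the gradient of the output. -/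
theorem Network.hasFDerivAt_output (N : Network X I J) {ξ : X} {θ : Params I J n}
    (h : (N.body ξ).RegularAt θ) :
    ∃ L : Params I J n →L[ℝ] ℝ,
      HasFDerivAt (N.output n ξ) L θ ∧ ∀ δ, L δ = N.gradPairing n ξ θ δ := by
  obtain ⟨D, hD, hp⟩ := (N.body ξ).hasFDerivAt_eval h
  refine ⟨(√(n : ℝ))⁻¹ • ∑ α, (θ.1 α (N.readout ξ) • D α +
    (N.body ξ).toTerm.eval θ α • vecEntry α (N.readout ξ)), ?_, fun δ => ?_⟩
  · exact (HasFDerivAt.fun_sum fun α _ =>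
      (hasFDerivAt_vecEntry α (N.readout ξ) θ).mul (hD α)).const_mul _
  · have hn : (√(n : ℝ))⁻¹ * (√(n : ℝ))⁻¹ = (n : ℝ)⁻¹ := by
      rw [← mul_inv, Real.mul_self_sqrt (Nat.cast_nonneg n)]
    -- The adjoint at the root is the readout vector v, the gradient of vᵀx in x. The gradient of
    -- the outer occurrence of v, namely x, is the extra entry of `Network.vecAdj`.
    have h1 := hp (.vec (N.readout ξ)) δ
    simp only [Term.eval] at h1
    have h2 : ∀ i α, N.gradVec n ξ θ α i * δ.1 α i = (√(n : ℝ))⁻¹ *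
        ((if N.readout ξ = i then (N.body ξ).toTerm.eval θ α * δ.1 α i else 0) +
          (((N.body ξ).vecAdj i (.vec (N.readout ξ))).map fun t => t.eval θ α).sum * δ.1 α i) := by
      intro i α
      rw [Network.gradVec, Network.vecAdj]
      split_ifs <;> simp <;> ring
    have h3 : ∀ W α β, N.gradMat n ξ θ W α β * δ.2 W α β = (√(n : ℝ))⁻¹ * ((√(n : ℝ))⁻¹ *
        ((((N.body ξ).matAdj W (.vec (N.readout ξ))).map fun p =>
          p.1.eval θ α * p.2.eval θ β).sum * δ.2 W α β)) := by
      intro W α β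
      rw [Network.gradMat, Network.matAdj, ← hn]
      ring
    simp only [smul_apply, sum_apply,
      add_apply, smul_eq_mul, Finset.sum_add_distrib, h1, Network.gradPairing,
      h2, h3, Net.pairing, ← Finset.mul_sum, Finset.sum_ite_eq, Finset.mem_univ, if_true]
    rw [Finset.sum_comm (s := (Finset.univ : Finset I))]
    have h4 : ∀ α, vecEntry (J := J) α (N.readout ξ) δ = δ.1 α (N.readout ξ) := fun _ => rfl
    simp only [h4]
    ring

end Backprop

end TensorProgram

end

/-! ### The main theorem. -/

theorem mainTheorem2 {X I J : Type*} [Fintype I] [DecidableEq I] [Fintype J] [DecidableEq J]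
    (N : TensorProgram.Network X I J) (ν : TensorProgram.Init I J)
    (hN : TensorProgram.BPLike ν N.program) :
    (∀ (n : ℕ) (ξ : X) (θ : TensorProgram.Params I J n), (N.body ξ).RegularAt θ →
      ∃ L : TensorProgram.Params I J n →L[ℝ] ℝ,
        HasFDerivAt (N.output n ξ) L θ ∧ ∀ δ, L δ = N.gradPairing n ξ θ δ) ∧
    ∀ {Ω : Type*} [MeasurableSpace Ω] (P : Measure Ω) [IsProbabilityMeasure P]
      (θ : (n : ℕ) → Ω → TensorProgram.Params I J n),
      (∀ n, HasLaw (θ n) (ν.law n) P) →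
      ∀ s : Finset X, ∀ᵐ ω ∂P, ∀ ξ ∈ s, ∀ ξ' ∈ s,
        Tendsto (fun n => N.ntk n ξ ξ' (θ n ω)) atTop (𝓝 (N.limitKernel ν ξ ξ')) :=
  ⟨fun _ _ _ h => N.hasFDerivAt_output h, fun _ _ _ hθ s => N.ae_tendsto_ntk hN hθ s⟩
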